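/- An instance of fair division of $m\ge 0$ divisible chores among $n\ge 1$ agents is given by costs $c_{ij}\ge 0$ of chore $j$ for agent $i$. It is bivalued if there are real numbers $a,b>0$ with $c_{ij}\in\{a,b\}$ for all $i,j$. A fractional allocation is a matrix $x\in[0,1]^{n\times m}$ with $\sum_i x_{ij}=1$ for every chore $j$; agent $i$ has cost $c_i(x_h)=\sum_j c_{ij}x_{hj}$ for the bundle of agent $h$. The allocation $x$ is envy-free if $c_i(x_i)\le c_i(x_h)$ for all agents $i,h$, and fractionally Pareto-optimal if there is no fractional allocation $y$ with $c_i(y_i)\le c_i(x_i)$ for all $i$ and $c_h(y_h)<c_h(x_h)$ for some $h$. **Theorem.** Given a bivalued instance of divisible chores with all $c_{ij}\in\{a,b\}$ for some real $a,b>0$, an allocation that is both envy-free and fractionally Pareto-optimal exists and can be computed in strongly polynomial time. That is, there is a single algorithm, on a random access machine that stores real numbers and performs the operations $+,-,\times,/$ and comparison on them, which on input $n$, $m$ and the matrix $(c_{ij})$ of any bivalued instance outputs such an allocation; the number of its steps (arithmetic operations included) is bounded by a polynomial in $n$ and $m$; and if all $c_{ij}$ are rational, all numbers occurring in the computation are rational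 with binary encoding length bounded by a polynomial in $n$, $m$ and the encoding length of the input. -/

import Mathlib

open scoped BigOperators

/-! ## Fair division of divisible chores -/

namespace Chores

/-- A fractional allocation of `m` divisible chores to `n` agents: `x i j ∈ [0,1]` is the fraction
of chore `j` given to agent `i`, and every chore is given out completely. -/
def IsAllocation {n m : ℕ} (x : Fin n → Fin m → ℝ) : Prop :=
  (∀ i j, 0 ≤ x i j ∧ x i j ≤ 1) ∧ ∀ j, ∑ i, x i j = 1

/-- Additive cost of a bundle `z` (with fractions `z j`) for an agent whose costs are `d`. -/
def bundleCost {m : ℕ} (d : Fin m → ℝ) (z : Fin m → ℝ) : ℝ := ∑ j, d j * z j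

/-- No agent strictly prefers the bundle of another agent. -/
def EnvyFree {n m : ℕ} (c x : Fin n → Fin m → ℝ) : Prop :=
  ∀ i h, bundleCost (c i) (x i) ≤ bundleCost (c i) (x h)

/-- `y` dominates `x`: no agent is worse off and some agent is strictly better off. -/
def Dominates {n m : ℕ} (c y x : Fin n → Fin m → ℝ) : Prop :=
  (∀ i, bundleCost (c i) (y i) ≤ bundleCost (c i) (x i)) ∧
    ∃ h, bundleCost (c h) (y h) < bundleCost (c h) (x h)

/-- Fractional Pareto optimality: no fractional allocation dominates `x`. -/
def FracParetoOptimal {n m : ℕ} (c x : Fin n → Fin m → ℝ) : Prop :=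
  ∀ y : Fin n → Fin m → ℝ, IsAllocation y → ¬ Dominates c y x

/-- All costs lie in a set `{a, b}` with `a, b > 0`. -/
def Bivalued {n m : ℕ} (c : Fin n → Fin m → ℝ) : Prop :=
  ∃ a b : ℝ, 0 < a ∧ 0 < b ∧ ∀ i j, c i j = a ∨ c i j = b

end Chores

/-! ## A random access machine with arithmetic on numbers, in structured form

The memory has two sorts of cells: index cells, holding natural numbers, and number cells, holding
real numbers. Both are organised in (countably many) arrays with two indices. Programs are fixed
finite texts; array names are part of the text, positions in an array are computed. On indices
there are only addition, truncated subtraction and comparison, so that after `t` steps all indices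
have `O(t)` more bits than at the start; on numbers there are the four arithmetic operations and
comparison. There is no way to convert a number to an index, in particular no rounding. -/

namespace RAM

/-- The memory: `idx A i j` and `num A i j` are the contents of position `(i, j)` of the index
array, respectively of the number array, with name `A`. -/
structure Memory where
  idx : ℕ → ℕ → ℕ → ℕ
  num : ℕ → ℕ → ℕ → ℝ

/-- Store `v` at position `(i, j)` of index array `A`. -/
def Memory.setIdx (σ : Memory) (A i j v : ℕ) : Memory :=
  { σ with idx := fun A' i' j' => if A' = A ∧ i' = i ∧ j' = j then v else σ.idx A' i' j' }

/-- Store `v` at position `(i, j)` of number array `A`. -/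
noncomputable def Memory.setNum (σ : Memory) (A i j : ℕ) (v : ℝ) : Memory :=
  { σ with num := fun A' i' j' => if A' = A ∧ i' = i ∧ j' = j then v else σ.num A' i' j' }

/-- Index expressions: constants, array reads, addition, truncated subtraction. -/
inductive IExpr where
  | lit (k : ℕ)
  | get (A : ℕ) (i j : IExpr)
  | add (e f : IExpr)
  | sub (e f : IExpr)

/-- Value of an index expression. -/
def IExpr.eval (σ : Memory) : IExpr → ℕ
  | .lit k => k
  | .get A i j => σ.idx A (i.eval σ) (j.eval σ)
  | .add e f => e.eval σ + f.eval σ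
  | .sub e f => e.eval σ - f.eval σ

/-- Number of operations performed when evaluating an index expression. -/
def IExpr.cost : IExpr → ℕ
  | .lit _ => 1
  | .get _ i j => i.cost + j.cost + 1
  | .add e f => e.cost + f.cost + 1
  | .sub e f => e.cost + f.cost + 1

/-- Number expressions: the value of an index expression, array reads, and arithmetic. -/
inductive NExpr where
  | ofIdx (e : IExpr)
  | get (A : ℕ) (i j : IExpr)
  | add (e f : NExpr)
  | sub (e f : NExpr)
  | mul (e f : NExpr)
  | div (e f : NExpr)

/-- Value of a number expression; dividing by zero yields zero. -/
noncomputable def NExpr.eval (σ : Memory) : NExpr → ℝ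
  | .ofIdx e => (e.eval σ : ℝ)
  | .get A i j => σ.num A (i.eval σ) (j.eval σ)
  | .add e f => e.eval σ + f.eval σ
  | .sub e f => e.eval σ - f.eval σ
  | .mul e f => e.eval σ * f.eval σ
  | .div e f => e.eval σ / f.eval σ

/-- Number of operations performed when evaluating a number expression. -/
def NExpr.cost : NExpr → ℕ
  | .ofIdx e => e.cost + 1
  | .get _ i j => i.cost + j.cost + 1
  | .add e f => e.cost + f.cost + 1
  | .sub e f => e.cost + f.cost + 1
  | .mul e f => e.cost + f.cost + 1
  | .div e f => e.cost + f.cost + 1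

/-- Every number that occurs in the evaluation of the expression (its value and all intermediate
results) satisfies `ok`. -/
def NExpr.Within (ok : ℝ → Prop) (σ : Memory) : NExpr → Prop
  | .ofIdx e => ok (NExpr.eval σ (.ofIdx e))
  | .get A i j => ok (NExpr.eval σ (.get A i j))
  | .add e f => e.Within ok σ ∧ f.Within ok σ ∧ ok (NExpr.eval σ (.add e f))
  | .sub e f => e.Within ok σ ∧ f.Within ok σ ∧ ok (NExpr.eval σ (.sub e f))
  | .mul e f => e.Within ok σ ∧ f.Within ok σ ∧ ok (NExpr.eval σ (.mul e f))
  | .div e f => e.Within ok σ ∧ f.Within ok σ ∧ ok (NExpr.eval σ (.div e f))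

/-- Tests: comparisons of indices and of numbers, and Boolean combinations. -/
inductive Test where
  | idxLe (e f : IExpr)
  | numLe (e f : NExpr)
  | not (b : Test)
  | and (b d : Test)

/-- The test succeeds. -/
def Test.Holds (σ : Memory) : Test → Prop
  | .idxLe e f => e.eval σ ≤ f.eval σ
  | .numLe e f => e.eval σ ≤ f.eval σ
  | .not b => ¬ b.Holds σ
  | .and b d => b.Holds σ ∧ d.Holds σ

/-- Number of operations performed for a test. -/
def Test.cost : Test → ℕ
  | .idxLe e f => e.cost + f.cost + 1
  | .numLe e f => e.cost + f.cost + 1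
  | .not b => b.cost + 1
  | .and b d => b.cost + d.cost + 1

/-- Every number that occurs in the evaluation of the test satisfies `ok`. -/
def Test.Within (ok : ℝ → Prop) (σ : Memory) : Test → Prop
  | .idxLe _ _ => True
  | .numLe e f => e.Within ok σ ∧ f.Within ok σ
  | .not b => b.Within ok σ
  | .and b d => b.Within ok σ ∧ d.Within ok σ

/-- Programs. `setIdx A i j e` and `setNum A i j e` assign to position `(i, j)` of array `A`;
`loop b p` repeats `p` while the test `b` succeeds. -/
inductive Program where
  | skip
  | setIdx (A : ℕ) (i j : IExpr) (e : IExpr)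
  | setNum (A : ℕ) (i j : IExpr) (e : NExpr)
  | seq (p q : Program)
  | cond (b : Test) (p q : Program)
  | loop (b : Test) (p : Program)

/-- `Run ok p σ t τ`: started in memory `σ`, the program `p` halts after `t` steps in memory `τ`,
and every number that it computes or reads on the way satisfies `ok`. -/
inductive Run (ok : ℝ → Prop) : Program → Memory → ℕ → Memory → Prop where
  | skip (σ : Memory) : Run ok .skip σ 1 σ
  | setIdx (A : ℕ) (i j e : IExpr) (σ : Memory) :
      Run ok (.setIdx A i j e) σ (i.cost + j.cost + e.cost + 1)
        (σ.setIdx A (i.eval σ) (j.eval σ) (e.eval σ))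
  | setNum (A : ℕ) (i j : IExpr) (e : NExpr) (σ : Memory) (he : e.Within ok σ) :
      Run ok (.setNum A i j e) σ (i.cost + j.cost + e.cost + 1)
        (σ.setNum A (i.eval σ) (j.eval σ) (e.eval σ))
  | seq {p q : Program} {σ τ υ : Memory} {s t : ℕ} (hp : Run ok p σ s τ) (hq : Run ok q τ t υ) :
      Run ok (.seq p q) σ (s + t) υ
  | condTrue {b : Test} {p q : Program} {σ τ : Memory} {t : ℕ} (hw : b.Within ok σ)
      (hb : b.Holds σ) (hp : Run ok p σ t τ) : Run ok (.cond b p q) σ (b.cost + t) τ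
  | condFalse {b : Test} {p q : Program} {σ τ : Memory} {t : ℕ} (hw : b.Within ok σ)
      (hb : ¬ b.Holds σ) (hq : Run ok q σ t τ) : Run ok (.cond b p q) σ (b.cost + t) τ
  | loopDone {b : Test} {p : Program} {σ : Memory} (hw : b.Within ok σ) (hb : ¬ b.Holds σ) :
      Run ok (.loop b p) σ b.cost σ
  | loopStep {b : Test} {p : Program} {σ τ υ : Memory} {s t : ℕ} (hw : b.Within ok σ)
      (hb : b.Holds σ) (hp : Run ok p σ s τ) (hl : Run ok (.loop b p) τ t υ) :
      Run ok (.loop b p) σ (b.cost + s + t) υ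

/-- Initial memory for an `n × m` matrix `c`: positions `(0, 0)` and `(0, 1)` of index array `0`
hold `n` and `m`, number array `0` holds the matrix, and all the rest is zero. -/
noncomputable def input {n m : ℕ} (c : Fin n → Fin m → ℝ) : Memory where
  idx := fun A i j =>
    if A = 0 ∧ i = 0 ∧ j = 0 then n else if A = 0 ∧ i = 0 ∧ j = 1 then m else 0
  num := fun A i j =>
    if h : A = 0 ∧ i < n ∧ j < m then c ⟨i, h.2.1⟩ ⟨j, h.2.2⟩ else 0

/-- The `n × m` matrix in number array `1`. -/
def output (n m : ℕ) (τ : Memory) : Fin n → Fin m → ℝ := fun i j => τ.num 1 i j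

/-- Binary encoding length of a rational number: sign, numerator and denominator in lowest
terms. -/
def bitSize (q : ℚ) : ℕ := 1 + q.num.natAbs.size + q.den.size

/-- Binary encoding length of a rational matrix. -/
def totalBitSize {n m : ℕ} (q : Fin n → Fin m → ℚ) : ℕ := ∑ i, ∑ j, bitSize (q i j)

/-- The problem "given a real `n × m` matrix `c` with `Dom c`, find a real `n × m` matrix `x` with
`Sol c x`" can be solved in strongly polynomial time. One program solves it for all `n`, `m` and
`c`; the number of its steps, arithmetic operations included, is bounded by a polynomial in `n` and
`m` alone; and if the entries of `c` are rational, then all numbers that occur in the computation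
are rational numbers whose encoding length is bounded by a polynomial in `n`, `m` and the encoding
length of `c`. -/
def StronglyPolynomial (Dom : ∀ {n m : ℕ}, (Fin n → Fin m → ℝ) → Prop)
    (Sol : ∀ {n m : ℕ}, (Fin n → Fin m → ℝ) → (Fin n → Fin m → ℝ) → Prop) : Prop :=
  ∃ (p : Program) (P Q : Polynomial ℕ),
    ∀ (n m : ℕ) (c : Fin n → Fin m → ℝ), Dom c →
      ∃ (t : ℕ) (τ : Memory),
        Run (fun _ => True) p (input c) t τ ∧
        t ≤ P.eval (n + m) ∧
        Sol c (output n m τ) ∧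
        ∀ q : Fin n → Fin m → ℚ, (∀ i j, c i j = (q i j : ℝ)) →
          Run (fun v => ∃ r : ℚ, v = (r : ℝ) ∧ bitSize r ≤ Q.eval (n + m + totalBitSize q))
            p (input c) t τ

end RAM

/-
Let `a ≤ b` be the least and the largest cost, call chore `j` easy for agent `i` if `c i j = a`, and
suppose that the chores that are easy for someone are assigned to agents for whom they are easy in a
balanced way: fractionally, with every chore shared only among agents of least load for whom it is
easy. Call an agent low if it would not earn more than an equal share when the chores of the agents
with at most its load are paid `a` and all others are paid `b`. With the chores of the low agents
paid `a` and all others paid `b`, low agents keep all of their chores, every other agent keeps just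
the fraction of its chores that earns an equal share, and all that remains is divided among the low
agents in proportion to what they still have to earn. Low agents then pay one unit of cost per unit
of payment and the others `a / b`, which is least possible for each of them: by balancedness, the
chores that are easy for low agents are all assigned to low agents. This is a competitive
equilibrium with equal incomes, hence envy-free and fractionally Pareto-optimal.

A balanced assignment is found with integers. Split every chore into `N = n * (n * n + 1)` units,
and pass units to agents whose load is smaller by at least two until this is no longer possible.
Cut the agents, in order of load, into classes where the loads skip a value. Within a class, loads
differ by less than `n`, which is so little compared with `N` that Hall's condition holds for
dividing the chores of the class equally among its agents. The push-relabel method then carries out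
this division, and as all classes are evenly loaded, the result is balanced. Every loop decreases a
polynomially bounded potential, and the costs only enter formulas of bounded depth over the input,
so encoding lengths stay polynomial.
-/

namespace Chores

section Equilibrium

variable {n m : ℕ} {c x : Fin n → Fin m → ℝ} {p : Fin m → ℝ} {α : Fin n → ℝ} {E : ℝ}

/-- Competitive equilibrium with equal incomes: `p j` is the payment for doing chore `j`, `α i` is
the least cost per unit of payment for agent `i`, and each agent earns `E` by doing only chores
that attain this ratio. -/
structure Equilibrium (c x : Fin n → Fin m → ℝ) (p : Fin m → ℝ) (α : Fin n → ℝ) (E : ℝ) :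
    Prop where
  nonneg : ∀ i j, 0 ≤ x i j
  sum_eq_one : ∀ j, ∑ i, x i j = 1
  rate_pos : ∀ i, 0 < α i
  rate_mul_le : ∀ i j, α i * p j ≤ c i j
  cost_eq : ∀ i j, x i j ≠ 0 → c i j = α i * p j
  income_eq : ∀ i, ∑ j, p j * x i j = E

theorem Equilibrium.isAllocation (h : Equilibrium c x p α E) : IsAllocation x := by
  refine ⟨fun i j => ⟨h.nonneg i j, ?_⟩, h.sum_eq_one⟩
  rw [← h.sum_eq_one j]
  exact Finset.single_le_sum (fun l _ => h.nonneg l j) (Finset.mem_univ i)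

theorem Equilibrium.bundleCost_self (h : Equilibrium c x p α E) (i : Fin n) :
    bundleCost (c i) (x i) = α i * E := by
  rw [← h.income_eq i, bundleCost, Finset.mul_sum]
  refine Finset.sum_congr rfl fun j _ => ?_
  by_cases hx : x i j = 0
  · simp [hx]
  · rw [h.cost_eq i j hx, mul_assoc]

theorem Equilibrium.le_bundleCost (h : Equilibrium c x p α E) (i : Fin n) {z : Fin m → ℝ}
    (hz : ∀ j, 0 ≤ z j) : α i * ∑ j, p j * z j ≤ bundleCost (c i) z := by
  rw [bundleCost, Finset.mul_sum]
  refine Finset.sum_le_sum fun j _ => ?_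
  rw [← mul_assoc]
  exact mul_le_mul_of_nonneg_right (h.rate_mul_le i j) (hz j)

theorem Equilibrium.envyFree (h : Equilibrium c x p α E) : EnvyFree c x := fun i k => by
  rw [h.bundleCost_self, ← h.income_eq k]
  exact h.le_bundleCost i (h.nonneg k)

theorem sum_income_of_sum_eq_one {z : Fin n → Fin m → ℝ} (hz : ∀ j, ∑ i, z i j = 1)
    (p : Fin m → ℝ) : ∑ i, ∑ j, p j * z i j = ∑ j, p j := by
  rw [Finset.sum_comm]
  simp only [← Finset.mul_sum, hz, mul_one]

theorem Equilibrium.fracParetoOptimal (h : Equilibrium c x p α E) : FracParetoOptimal c x := by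
  rintro y ⟨hy, hy_sum⟩ ⟨hle, k, hlt⟩
  have earned_le : ∀ i, α i * ∑ j, p j * y i j ≤ bundleCost (c i) (y i) :=
    fun i => h.le_bundleCost i fun j => (hy i j).1
  have income_le : ∀ i, ∑ j, p j * y i j ≤ E := fun i =>
    le_of_mul_le_mul_left ((earned_le i).trans ((hle i).trans_eq (h.bundleCost_self i)))
      (h.rate_pos i)
  have income_lt : ∑ j, p j * y k j < E :=
    lt_of_mul_lt_mul_left ((earned_le k).trans_lt (hlt.trans_eq (h.bundleCost_self k)))
      (h.rate_pos k).le
  have total_lt : ∑ i, ∑ j, p j * y i j < ∑ i, ∑ j, p j * x i j := by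
    simp only [h.income_eq]
    exact Finset.sum_lt_sum (fun i _ => income_le i) ⟨k, Finset.mem_univ k, income_lt⟩
  rw [sum_income_of_sum_eq_one hy_sum, sum_income_of_sum_eq_one h.sum_eq_one] at total_lt
  exact total_lt.false

end Equilibrium

section Load

variable {ι κ M : Type*} [Fintype κ] [AddCommMonoid M]

/-- The total amount of chores that agent `i` has under `f`. -/
def load (f : ι → κ → M) (i : ι) : M := ∑ j, f i j

end Load

section Balanced

variable {n m : ℕ} {easy : Fin n → Fin m → Prop} {a b : ℝ} {f : Fin n → Fin m → ℝ}

/-- A fractional assignment of the chores that are easy for someone, in which every chore is done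
only by those agents of least load among the agents who find it easy. -/
structure Balanced (easy : Fin n → Fin m → Prop) (f : Fin n → Fin m → ℝ) : Prop where
  nonneg : ∀ i j, 0 ≤ f i j
  easy_of_ne_zero : ∀ i j, f i j ≠ 0 → easy i j
  sum_eq_one : ∀ j, (∃ i, easy i j) → ∑ i, f i j = 1
  load_le : ∀ i h j, f h j ≠ 0 → easy i j → load f h ≤ load f i

theorem Balanced.load_nonneg (hf : Balanced easy f) (i : Fin n) : 0 ≤ load f i :=
  Finset.sum_nonneg fun j _ => hf.nonneg i j

theorem Balanced.sum_le_one (hf : Balanced easy f) (j : Fin m) : ∑ i, f i j ≤ 1 := by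
  by_cases hj : ∃ i, easy i j
  · exact (hf.sum_eq_one j hj).le
  · have hzero : ∀ i, f i j = 0 := fun i => by_contra fun h => hj ⟨i, hf.easy_of_ne_zero i j h⟩
    simp [hzero]

theorem Balanced.sum_load_le (hf : Balanced easy f) : ∑ i, load f i ≤ m := by
  calc ∑ i, load f i = ∑ j, ∑ i, f i j := Finset.sum_comm
    _ ≤ ∑ _j : Fin m, (1 : ℝ) := Finset.sum_le_sum fun j _ => hf.sum_le_one j
    _ = m := by simp

variable (a b f)

/-- What every agent earns if the chores that the agents of `T` have are paid `a`, all others are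
paid `b`, and the total payment is divided equally. -/
noncomputable def income (T : Finset (Fin n)) : ℝ := (b * m - (b - a) * ∑ h ∈ T, load f h) / n

/-- The agents with at most the load of agent `i`. -/
noncomputable def atMost (i : Fin n) : Finset (Fin n) := {h | load f h ≤ load f i}

/-- The agents who would not earn more than an equal share if only they and the agents with at most
their load were paid `a`; only their easy chores will be paid `a`. -/
noncomputable def low : Finset (Fin n) := {i | a * load f i ≤ income a b f (atMost f i)}

/-- The income of all agents in the equilibrium. -/
noncomputable def equalIncome : ℝ := income a b f (low a b f)

/-- The fraction of the chores assigned to agent `i` by `f` that agent `i` keeps. -/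
noncomputable def keep (i : Fin n) : ℝ :=
  if i ∈ low a b f then 1 else equalIncome a b f / (b * load f i)

/-- What agent `i` has to earn in addition to the payment for the chores that it keeps. -/
noncomputable def deficit (i : Fin n) : ℝ :=
  if i ∈ low a b f then equalIncome a b f - a * load f i else 0

/-- The fraction of chore `j` that nobody keeps. -/
noncomputable def rest (j : Fin m) : ℝ := 1 - ∑ i, f i j * keep a b f i

/-- The allocation obtained from `f` when the chores that are not kept are divided in proportion
to the deficits. -/
noncomputable def fairAllocation (i : Fin n) (j : Fin m) : ℝ :=
  f i j * keep a b f i + rest a b f j * (deficit a b f i / ∑ h, deficit a b f h)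

open Classical in
/-- The payment for chore `j`. -/
noncomputable def price (easy : Fin n → Fin m → Prop) (j : Fin m) : ℝ :=
  if ∃ i ∈ low a b f, easy i j then a else b

/-- The cost of agent `i` per unit of payment. -/
noncomputable def rate (i : Fin n) : ℝ := if i ∈ low a b f then 1 else a / b

variable {a b f}

@[simp]
theorem mem_low {i : Fin n} : i ∈ low a b f ↔ a * load f i ≤ income a b f (atMost f i) := by
  simp [low]

@[simp]
theorem mem_atMost {i h : Fin n} : h ∈ atMost f i ↔ load f h ≤ load f i := by simp [atMost]

theorem Balanced.income_anti (hf : Balanced easy f) (hab : a ≤ b) {S T : Finset (Fin n)}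
    (hST : S ⊆ T) : income a b f T ≤ income a b f S := by
  have := Finset.sum_le_sum_of_subset_of_nonneg hST fun i _ _ => hf.load_nonneg i
  have := sub_nonneg.2 hab
  unfold income
  gcongr

theorem Balanced.income_nonneg (hf : Balanced easy f) (ha : 0 ≤ a) (hab : a ≤ b)
    (T : Finset (Fin n)) : 0 ≤ income a b f T := by
  have hT : ∑ h ∈ T, load f h ≤ m :=
    (Finset.sum_le_univ_sum_of_nonneg hf.load_nonneg).trans hf.sum_load_le
  have := mul_le_mul_of_nonneg_left hT (sub_nonneg.2 hab)
  have : 0 ≤ a * m := by positivity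
  exact div_nonneg (by linarith) n.cast_nonneg

theorem Balanced.mem_low_of_le (hf : Balanced easy f) (ha : 0 ≤ a) (hab : a ≤ b) {i h : Fin n}
    (hi : i ∈ low a b f) (hle : load f h ≤ load f i) : h ∈ low a b f := by
  rw [mem_low] at hi ⊢
  calc a * load f h ≤ a * load f i := by gcongr
    _ ≤ income a b f (atMost f i) := hi
    _ ≤ income a b f (atMost f h) := hf.income_anti hab fun l hl =>
      mem_atMost.2 ((mem_atMost.1 hl).trans hle)

theorem Balanced.mul_load_le_equalIncome (hf : Balanced easy f) (ha : 0 ≤ a) (hab : a ≤ b)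
    {i : Fin n} (hi : i ∈ low a b f) : a * load f i ≤ equalIncome a b f := by
  obtain ⟨t, ht, hmax⟩ := (low a b f).exists_max_image (load f) ⟨i, hi⟩
  have low_eq : low a b f = atMost f t := by
    ext l
    exact ⟨fun hl => mem_atMost.2 (hmax l hl),
      fun hl => hf.mem_low_of_le ha hab ht (mem_atMost.1 hl)⟩
  calc a * load f i ≤ a * load f t := mul_le_mul_of_nonneg_left (hmax i hi) ha
    _ ≤ income a b f (atMost f t) := mem_low.1 ht
    _ = equalIncome a b f := by rw [equalIncome, low_eq]

theorem Balanced.equalIncome_le_mul_load (hf : Balanced easy f) (ha : 0 ≤ a) (hab : a ≤ b)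
    {i : Fin n} (hi : i ∉ low a b f) : equalIncome a b f ≤ b * load f i := by
  have hn : 0 < (n : ℝ) := by exact_mod_cast i.pos
  have low_sub : low a b f ⊆ atMost f i := fun l hl => mem_atMost.2 <| le_of_not_ge fun h =>
    hi (hf.mem_low_of_le ha hab hl h)
  have sum_sdiff_le : ∑ h ∈ atMost f i \ low a b f, load f h ≤ n * load f i := by
    calc ∑ h ∈ atMost f i \ low a b f, load f h
        ≤ (atMost f i \ low a b f).card • load f i := Finset.sum_le_card_nsmul _ _ _ fun h hh =>
          mem_atMost.1 (Finset.mem_sdiff.1 hh).1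
      _ ≤ n * load f i := by
          rw [nsmul_eq_mul]
          have := Finset.card_le_univ (atMost f i \ low a b f)
          rw [Fintype.card_fin] at this
          have := hf.load_nonneg i
          gcongr
  have := mul_le_mul_of_nonneg_left sum_sdiff_le (sub_nonneg.2 hab)
  have hsum := Finset.sum_sdiff (f := load f) low_sub
  rw [mem_low, not_le, income, div_lt_iff₀ hn, ← hsum] at hi
  rw [equalIncome, income, div_le_iff₀ hn]
  linarith

theorem Balanced.load_pos (hf : Balanced easy f) (ha : 0 ≤ a) (hab : a ≤ b) {i : Fin n}
    (hi : i ∉ low a b f) : 0 < load f i := by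
  rw [mem_low, not_le] at hi
  exact pos_of_mul_pos_right ((hf.income_nonneg ha hab _).trans_lt hi) ha

theorem Balanced.keep_nonneg (hf : Balanced easy f) (ha : 0 ≤ a) (hab : a ≤ b) (i : Fin n) :
    0 ≤ keep a b f i := by
  rw [keep]
  split_ifs with hi
  · exact zero_le_one
  · exact div_nonneg (hf.income_nonneg ha hab _) (mul_nonneg (ha.trans hab) (hf.load_nonneg i))

theorem Balanced.keep_le_one (hf : Balanced easy f) (ha : 0 < a) (hab : a ≤ b) (i : Fin n) :
    keep a b f i ≤ 1 := by
  rw [keep]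
  split_ifs with hi
  · exact le_rfl
  · rw [div_le_one (mul_pos (ha.trans_le hab) (hf.load_pos ha.le hab hi))]
    exact hf.equalIncome_le_mul_load ha.le hab hi

theorem Balanced.rest_nonneg (hf : Balanced easy f) (ha : 0 < a) (hab : a ≤ b) (j : Fin m) :
    0 ≤ rest a b f j := by
  refine sub_nonneg.2 (le_trans (Finset.sum_le_sum fun i _ => ?_) (hf.sum_le_one j))
  exact mul_le_of_le_one_right (hf.nonneg i j) (hf.keep_le_one ha hab i)

theorem Balanced.deficit_nonneg (hf : Balanced easy f) (ha : 0 ≤ a) (hab : a ≤ b) (i : Fin n) :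
    0 ≤ deficit a b f i := by
  rw [deficit]
  split_ifs with hi
  · exact sub_nonneg.2 (hf.mul_load_le_equalIncome ha hab hi)
  · exact le_rfl

theorem Balanced.mul_load_mul_keep (hf : Balanced easy f) (ha : 0 < a) (hab : a ≤ b) (i : Fin n) :
    b * (load f i * keep a b f i) =
      equalIncome a b f - deficit a b f i + if i ∈ low a b f then (b - a) * load f i else 0 := by
  rw [keep, deficit]
  split_ifs with hi
  · ring
  · have := (hf.load_pos ha.le hab hi).ne'
    have := (ha.trans_le hab).ne'
    field_simp
    ring

theorem Balanced.sum_deficit (hf : Balanced easy f) (hn : 0 < n) (ha : 0 < a) (hab : a ≤ b) :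
    ∑ i, deficit a b f i = b * ∑ j, rest a b f j := by
  have sum_rest : ∑ j, rest a b f j = m - ∑ i, load f i * keep a b f i := by
    simp only [rest, load, Finset.sum_sub_distrib, Finset.sum_mul]
    rw [Finset.sum_comm]
    simp
  have sum_low : ∑ i, (if i ∈ low a b f then (b - a) * load f i else 0) =
      (b - a) * ∑ i ∈ low a b f, load f i := by
    rw [Finset.sum_ite_mem, Finset.univ_inter, Finset.mul_sum]
  have total : n * equalIncome a b f = b * m - (b - a) * ∑ i ∈ low a b f, load f i := by
    rw [equalIncome, income]
    field_simp
  rw [sum_rest, mul_sub, Finset.mul_sum, Finset.sum_congr rfl fun i _ =>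
    hf.mul_load_mul_keep ha hab i, Finset.sum_add_distrib, Finset.sum_sub_distrib, sum_low]
  simp only [Finset.sum_const, Finset.card_univ, Fintype.card_fin, nsmul_eq_mul]
  linarith

theorem Balanced.rest_eq_zero (hf : Balanced easy f) (ha : 0 ≤ a) (hab : a ≤ b) {i : Fin n}
    {j : Fin m} (hi : i ∈ low a b f) (hij : easy i j) : rest a b f j = 0 := by
  have kept : ∀ h, f h j * keep a b f h = f h j := fun h => by
    by_cases hh : f h j = 0
    · rw [hh, zero_mul]
    · rw [keep, if_pos (hf.mem_low_of_le ha hab hi (hf.load_le i h j hh hij)), mul_one]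
  simp only [rest, kept, hf.sum_eq_one j ⟨i, hij⟩, sub_self]

theorem Balanced.price_mul_rest (hf : Balanced easy f) (ha : 0 ≤ a) (hab : a ≤ b) (j : Fin m) :
    price a b f easy j * rest a b f j = b * rest a b f j := by
  rw [price]
  split_ifs with h
  · obtain ⟨i, hi, hij⟩ := h
    simp [hf.rest_eq_zero ha hab hi hij]
  · rfl

theorem Balanced.price_of_ne_zero (hf : Balanced easy f) (ha : 0 ≤ a) (hab : a ≤ b) {i : Fin n}
    {j : Fin m} (hij : f i j ≠ 0) : price a b f easy j = if i ∈ low a b f then a else b := by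
  have heasy := hf.easy_of_ne_zero i j hij
  have hiff : (∃ h ∈ low a b f, easy h j) ↔ i ∈ low a b f :=
    ⟨fun ⟨h, hh, hhj⟩ => hf.mem_low_of_le ha hab hh (hf.load_le h i j hij hhj),
      fun hi => ⟨i, hi, heasy⟩⟩
  simp only [price, hiff]

theorem Balanced.sum_price_mul_keep (hf : Balanced easy f) (ha : 0 < a) (hab : a ≤ b) (i : Fin n) :
    ∑ j, price a b f easy j * (f i j * keep a b f i) = equalIncome a b f - deficit a b f i := by
  have hterm : ∀ j, price a b f easy j * (f i j * keep a b f i) =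
      (if i ∈ low a b f then a else b) * keep a b f i * f i j := fun j => by
    by_cases hij : f i j = 0
    · simp [hij]
    · rw [hf.price_of_ne_zero ha.le hab hij]
      ring
  rw [Finset.sum_congr rfl fun j _ => hterm j, ← Finset.mul_sum, keep, deficit]
  change _ * load f i = _
  split_ifs with hi
  · ring
  · have := (hf.load_pos ha.le hab hi).ne'
    have := (ha.trans_le hab).ne'
    field_simp
    ring

theorem Balanced.deficit_div_mul_sum (hf : Balanced easy f) (ha : 0 ≤ a) (hab : a ≤ b)
    (i : Fin n) :
    deficit a b f i / (∑ h, deficit a b f h) * ∑ h, deficit a b f h = deficit a b f i := by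
  refine div_mul_cancel_of_imp fun hsum => ?_
  exact (Finset.sum_eq_zero_iff_of_nonneg fun h _ => hf.deficit_nonneg ha hab h).1 hsum i
    (Finset.mem_univ i)

theorem Balanced.sum_price_mul_fairAllocation (hf : Balanced easy f) (hn : 0 < n) (ha : 0 < a)
    (hab : a ≤ b) (i : Fin n) :
    ∑ j, price a b f easy j * fairAllocation a b f i j = equalIncome a b f := by
  have hrest : ∑ j, price a b f easy j *
      (rest a b f j * (deficit a b f i / ∑ h, deficit a b f h)) = deficit a b f i := by
    simp only [← mul_assoc, hf.price_mul_rest ha.le hab]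
    rw [← Finset.sum_mul, ← Finset.mul_sum, ← hf.sum_deficit hn ha hab, mul_comm,
      hf.deficit_div_mul_sum ha.le hab]
  simp only [fairAllocation, mul_add, Finset.sum_add_distrib]
  rw [hf.sum_price_mul_keep ha hab, hrest, sub_add_cancel]

theorem Balanced.sum_fairAllocation (hf : Balanced easy f) (hn : 0 < n) (ha : 0 < a)
    (hab : a ≤ b) (j : Fin m) : ∑ i, fairAllocation a b f i j = 1 := by
  simp only [fairAllocation, Finset.sum_add_distrib, ← Finset.mul_sum, ← Finset.sum_div]
  have hrest : rest a b f j *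
      ((∑ i, deficit a b f i) / ∑ h, deficit a b f h) = rest a b f j := by
    rw [← mul_div_assoc]
    refine mul_div_cancel_of_imp fun hsum => ?_
    rw [hf.sum_deficit hn ha hab, mul_eq_zero, or_iff_right (ha.trans_le hab).ne'] at hsum
    exact (Finset.sum_eq_zero_iff_of_nonneg fun h _ => hf.rest_nonneg ha hab h).1 hsum j
      (Finset.mem_univ j)
  rw [hrest, rest, add_sub_cancel]

theorem rate_mul_price_le (ha : 0 < a) (hab : a ≤ b) {c : Fin n → Fin m → ℝ}
    (hc : ∀ i j, easy i j → c i j = a) (hc' : ∀ i j, ¬ easy i j → c i j = b)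
    (i : Fin n) (j : Fin m) : rate a b f i * price a b f easy j ≤ c i j := by
  have hb := ha.trans_le hab
  have hac : a ≤ c i j := by
    by_cases hij : easy i j
    · exact (hc i j hij).ge
    · exact hab.trans_eq (hc' i j hij).symm
  by_cases hi : i ∈ low a b f
  · rw [rate, if_pos hi, one_mul, price]
    split_ifs with hj
    · exact hac
    · exact (hc' i j fun hij => hj ⟨i, hi, hij⟩).ge
  · have hprice : price a b f easy j ≤ b := by
      rw [price]
      split_ifs
      exacts [hab, le_rfl]
    rw [rate, if_neg hi]
    calc a / b * price a b f easy j ≤ a / b * b := by gcongr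
      _ = a := div_mul_cancel₀ a hb.ne'
      _ ≤ c i j := hac

theorem Balanced.cost_eq (hf : Balanced easy f) (ha : 0 < a) (hab : a ≤ b)
    {c : Fin n → Fin m → ℝ} (hc : ∀ i j, easy i j → c i j = a)
    (hc' : ∀ i j, ¬ easy i j → c i j = b) {i : Fin n} {j : Fin m}
    (hij : fairAllocation a b f i j ≠ 0) : c i j = rate a b f i * price a b f easy j := by
  by_cases hfij : f i j = 0
  · have hne : rest a b f j ≠ 0 ∧ deficit a b f i ≠ 0 := by
      constructor <;> rintro h <;> exact hij (by simp [fairAllocation, hfij, h])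
    have hi : i ∈ low a b f := by_contra fun h => hne.2 (if_neg h)
    have hprice : price a b f easy j = b :=
      mul_right_cancel₀ hne.1 (hf.price_mul_rest ha.le hab j)
    rw [hprice, rate, if_pos hi, one_mul]
    exact hc' i j fun h => hne.1 (hf.rest_eq_zero ha.le hab hi h)
  · rw [hc i j (hf.easy_of_ne_zero i j hfij), hf.price_of_ne_zero ha.le hab hfij, rate]
    split_ifs
    · rw [one_mul]
    · rw [div_mul_cancel₀ a (ha.trans_le hab).ne']

theorem Balanced.equilibrium (hf : Balanced easy f) (hn : 0 < n) (ha : 0 < a) (hab : a ≤ b)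
    {c : Fin n → Fin m → ℝ} (hc : ∀ i j, easy i j → c i j = a)
    (hc' : ∀ i j, ¬ easy i j → c i j = b) :
    Equilibrium c (fairAllocation a b f) (price a b f easy) (rate a b f)
      (equalIncome a b f) where
  nonneg i j := add_nonneg (mul_nonneg (hf.nonneg i j) (hf.keep_nonneg ha.le hab i))
    (mul_nonneg (hf.rest_nonneg ha hab j) (div_nonneg (hf.deficit_nonneg ha.le hab i)
      (Finset.sum_nonneg fun h _ => hf.deficit_nonneg ha.le hab h)))
  sum_eq_one := hf.sum_fairAllocation hn ha hab
  rate_pos i := by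
    have := ha.trans_le hab
    rw [rate]
    split_ifs <;> positivity
  rate_mul_le := rate_mul_price_le ha hab hc hc'
  cost_eq _ _ := hf.cost_eq ha hab hc hc'
  income_eq := hf.sum_price_mul_fairAllocation hn ha hab

end Balanced

end Chores

namespace Chores

section Units

variable {ι κ : Type*} [Fintype ι] {adj : ι → κ → Prop} {u : κ → ℕ} {y : ι → κ → ℕ}

/-- An assignment in whole units: agents only do chores that are adjacent to them, and the `u j`
units of every chore `j` with an adjacent agent are all assigned. -/
structure Assigns (adj : ι → κ → Prop) (u : κ → ℕ) (y : ι → κ → ℕ) : Prop where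
  adj_of_pos : ∀ i j, 0 < y i j → adj i j
  sum_eq : ∀ j, (∃ i, adj i j) → ∑ i, y i j = u j

theorem Assigns.sum_le (hy : Assigns adj u y) (j : κ) : ∑ i, y i j ≤ u j := by
  by_cases hj : ∃ i, adj i j
  · exact (hy.sum_eq j hj).le
  · have hzero : ∀ i, y i j = 0 := fun i =>
      Nat.eq_zero_of_not_pos fun h => hj ⟨i, hy.adj_of_pos i j h⟩
    simp [hzero]

variable [Fintype κ]

theorem Assigns.sum_load_le (hy : Assigns adj u y) : ∑ i, load y i ≤ ∑ j, u j := by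
  unfold load
  rw [Finset.sum_comm]
  exact Finset.sum_le_sum fun j _ => hy.sum_le j

theorem Assigns.sum_le_sum_load (hy : Assigns adj u y) {S : Finset ι} {T : Finset κ}
    (hT : ∀ j ∈ T, ∃ i, adj i j) (hS : ∀ j ∈ T, ∀ i, 0 < y i j → i ∈ S) :
    ∑ j ∈ T, u j ≤ ∑ i ∈ S, load y i := by
  have hcol : ∀ j ∈ T, u j = ∑ i ∈ S, y i j := fun j hj => by
    rw [← hy.sum_eq j (hT j hj)]
    exact (Finset.sum_subset S.subset_univ fun i _ hi =>
      Nat.eq_zero_of_not_pos fun h => hi (hS j hj i h)).symm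
  rw [Finset.sum_congr rfl hcol, Finset.sum_comm]
  exact Finset.sum_le_sum fun i _ =>
    Finset.sum_le_univ_sum_of_nonneg fun j => Nat.zero_le (y i j)

theorem Assigns.sum_load_le_sum (hy : Assigns adj u y) {S : Finset ι} {T : Finset κ}
    (hT : ∀ i ∈ S, ∀ j, 0 < y i j → j ∈ T) : ∑ i ∈ S, load y i ≤ ∑ j ∈ T, u j := by
  have hrow : ∀ i ∈ S, load y i = ∑ j ∈ T, y i j := fun i hi =>
    (Finset.sum_subset T.subset_univ fun j _ hj =>
      Nat.eq_zero_of_not_pos fun h => hj (hT i hi j h)).symm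
  rw [Finset.sum_congr rfl hrow, Finset.sum_comm]
  exact Finset.sum_le_sum fun j _ => (Finset.sum_le_univ_sum_of_nonneg fun i =>
    Nat.zero_le (y i j)).trans (hy.sum_le j)

end Units

section Move

open Function

variable {ι κ : Type*} [DecidableEq ι] [DecidableEq κ] {adj : ι → κ → Prop} {u : κ → ℕ}
  {y : ι → κ → ℕ} {i h : ι} {j : κ}

/-- Agent `i` hands over one unit of chore `j` to agent `h`. -/
def moveUnit (y : ι → κ → ℕ) (i : ι) (j : κ) (h : ι) : ι → κ → ℕ :=
  update (update y i (update (y i) j (y i j - 1))) h (update (y h) j (y h j + 1))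

theorem sum_update_add [Fintype ι] (g : ι → ℕ) (i : ι) (v : ℕ) :
    ∑ k, update g i v k + g i = ∑ k, g k + v := by
  rw [Finset.sum_update_of_mem (Finset.mem_univ i), ← Finset.add_sum_erase _ g (Finset.mem_univ i),
    ← Finset.sdiff_singleton_eq_erase]
  ring

theorem sum_apply_update_update [Fintype ι] (F : ι → ℕ → ℕ) (g : ι → ℕ) (hih : i ≠ h) (v w : ℕ) :
    ∑ k, F k (update (update g i v) h w k) + F i (g i) + F h (g h) =
      ∑ k, F k (g k) + F i v + F h w := by
  have hsecond := sum_update_add (fun k => F k (update g i v k)) h (F h w)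
  have hfirst := sum_update_add (fun k => F k (g k)) i (F i v)
  simp only [← apply_update F, update_of_ne hih.symm] at hfirst hsecond
  linarith

theorem moveUnit_apply_of_ne {l : κ} (hl : l ≠ j) (k : ι) : moveUnit y i j h k l = y k l := by
  unfold moveUnit
  by_cases hk : k = h
  · subst hk
    simp [hl]
  · by_cases hk' : k = i
    · subst hk'
      simp [hk, hl]
    · simp [hk, hk']

theorem moveUnit_apply_same (hih : i ≠ h) (k : ι) :
    moveUnit y i j h k j = update (update (y · j) i (y i j - 1)) h (y h j + 1) k := by
  unfold moveUnit
  by_cases hk : k = h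
  · subst hk
    simp
  · by_cases hk' : k = i
    · subst hk'
      simp [hk]
    · simp [hk, hk']

theorem eq_or_pos_of_moveUnit_pos {k : ι} {l : κ} (hpos : 0 < moveUnit y i j h k l) :
    (k = h ∧ l = j) ∨ 0 < y k l := by
  by_cases hl : l = j
  · subst hl
    by_cases hk : k = h
    · exact .inl ⟨hk, rfl⟩
    · right
      rw [moveUnit, update_of_ne hk] at hpos
      by_cases hk' : k = i
      · subst hk'
        simp only [update_self] at hpos
        omega
      · rwa [update_of_ne hk'] at hpos
  · exact .inr (by rwa [moveUnit_apply_of_ne hl] at hpos)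

theorem load_moveUnit [Fintype κ] (hih : i ≠ h) (hy : 0 < y i j) :
    load (moveUnit y i j h) = update (update (load y) i (load y i - 1)) h (load y h + 1) := by
  have hgive := sum_update_add (y i) j (y i j - 1)
  have htake := sum_update_add (y h) j (y h j + 1)
  ext k
  by_cases hk : k = h
  · subst hk
    simp only [load, moveUnit, update_self] at *
    omega
  · by_cases hk' : k = i
    · subst hk'
      simp only [load, moveUnit, update_self, update_of_ne hk] at *
      omega
    · simp only [load, moveUnit, update_of_ne hk, update_of_ne hk']

theorem Assigns.moveUnit [Fintype ι] (hy : Assigns adj u y) (hih : i ≠ h) (hij : 0 < y i j)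
    (hadj : adj h j) : Assigns adj u (moveUnit y i j h) where
  adj_of_pos k l hkl := by
    rcases eq_or_pos_of_moveUnit_pos hkl with ⟨rfl, rfl⟩ | hkl
    exacts [hadj, hy.adj_of_pos k l hkl]
  sum_eq l hl := by
    rw [← hy.sum_eq l hl]
    by_cases hlj : l = j
    · subst hlj
      have := sum_apply_update_update (fun _ v => v) (y · l) hih (y i l - 1) (y h l + 1)
      simp only [moveUnit_apply_same hih]
      omega
    · simp only [moveUnit_apply_of_ne hlj]

theorem sum_load_moveUnit [Fintype ι] [Fintype κ] (F : ι → ℕ → ℕ) (hih : i ≠ h) (hy : 0 < y i j) :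
    ∑ k, F k (load (moveUnit y i j h) k) + F i (load y i) + F h (load y h) =
      ∑ k, F k (load y k) + F i (load y i - 1) + F h (load y h + 1) := by
  rw [load_moveUnit hih hy]
  exact sum_apply_update_update F (load y) hih _ _

theorem sum_sq_load_moveUnit_lt [Fintype ι] [Fintype κ] (hy : 0 < y i j)
    (hlt : load y h + 2 ≤ load y i) :
    ∑ k, load (moveUnit y i j h) k ^ 2 < ∑ k, load y k ^ 2 := by
  have hih : i ≠ h := by
    rintro rfl
    omega
  have hsum := sum_load_moveUnit (fun _ v => v ^ 2) hih hy
  obtain ⟨d, hd⟩ := Nat.exists_eq_add_of_le hlt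
  have hi : load y i - 1 = load y h + 1 + d := by omega
  rw [hi, hd] at hsum
  nlinarith

theorem sum_load_mul_moveUnit_lt [Fintype ι] [Fintype κ] {H : ι → ℕ} (hy : 0 < y i j)
    (hlt : H h < H i) : ∑ k, load (moveUnit y i j h) k * H k < ∑ k, load y k * H k := by
  have hih : i ≠ h := by
    rintro rfl
    exact hlt.false
  have hsum := sum_load_moveUnit (fun k v => v * H k) hih hy
  have hpos : 0 < load y i :=
    hy.trans_le (Finset.single_le_sum (fun _ _ => Nat.zero_le _) (Finset.mem_univ j))
  obtain ⟨d, hd⟩ := Nat.exists_eq_add_of_lt hpos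
  rw [hd, show 0 + d + 1 - 1 = d by omega] at hsum
  nlinarith

end Move

section Transport

variable {ι κ : Type*} [Fintype ι] [Fintype κ] {adj : ι → κ → Prop} {u : κ → ℕ} {cap : ι → ℕ}
  {y : ι → κ → ℕ} {H : ι → ℕ}

/-- Hall's condition for assigning `u j` units of every chore `j` to adjacent agents such that
agent `i` gets at most `cap i` units. -/
def HallCondition (adj : ι → κ → Prop) (u : κ → ℕ) (cap : ι → ℕ) : Prop :=
  ∀ (S : Finset ι) (T : Finset κ), (∀ j ∈ T, ∀ i, adj i j → i ∈ S) → ∑ j ∈ T, u j ≤ ∑ i ∈ S, cap i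

/-- The invariant of the push-relabel method: units pass from an agent with height `H i` to agents
of height at least `H i - 1`, and only agents whose capacity is exhausted have been raised. -/
structure Preflow (adj : ι → κ → Prop) (u : κ → ℕ) (cap : ι → ℕ) (y : ι → κ → ℕ) (H : ι → ℕ) :
    Prop where
  assigns : Assigns adj u y
  height_le_succ : ∀ i h j, 0 < y i j → adj h j → H i ≤ H h + 1
  cap_le_load : ∀ i, 0 < H i → cap i ≤ load y i
  height_le_card : ∀ i, H i ≤ Fintype.card ι

theorem Assigns.preflow_zero (hy : Assigns adj u y) : Preflow adj u cap y fun _ => 0 where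
  assigns := hy
  height_le_succ _ _ _ _ _ := Nat.zero_le _
  cap_le_load _ h := absurd h (lt_irrefl 0)
  height_le_card _ := Nat.zero_le _

theorem Preflow.sum_load_mul_height_le (hp : Preflow adj u cap y H) :
    ∑ i, load y i * H i ≤ (∑ j, u j) * Fintype.card ι :=
  calc ∑ i, load y i * H i ≤ ∑ i, load y i * Fintype.card ι :=
        Finset.sum_le_sum fun i _ => Nat.mul_le_mul_left _ (hp.height_le_card i)
    _ = (∑ i, load y i) * Fintype.card ι := (Finset.sum_mul ..).symm
    _ ≤ (∑ j, u j) * Fintype.card ι := Nat.mul_le_mul_right _ hp.assigns.sum_load_le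

theorem Preflow.moveUnit [DecidableEq ι] [DecidableEq κ] (hp : Preflow adj u cap y H) {i h : ι}
    {j : κ} (hi : cap i < load y i) (hlt : H h < H i) (hij : 0 < y i j) (hhj : adj h j) :
    Preflow adj u cap (moveUnit y i j h) H := by
  have hih : i ≠ h := by
    rintro rfl
    exact hlt.false
  refine ⟨hp.assigns.moveUnit hih hij hhj, fun k l q hkq hlq => ?_, fun k hk => ?_,
    hp.height_le_card⟩
  · rcases eq_or_pos_of_moveUnit_pos hkq with ⟨rfl, rfl⟩ | hkq
    · exact hlt.le.trans (hp.height_le_succ i l q hij hlq)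
    · exact hp.height_le_succ k l q hkq hlq
  · have hk := hp.cap_le_load k hk
    rw [load_moveUnit hih hij]
    rcases eq_or_ne k h with rfl | hkh
    · rw [Function.update_self]
      omega
    · rw [Function.update_of_ne hkh]
      rcases eq_or_ne k i with rfl | hki
      · rw [Function.update_self]
        omega
      · rwa [Function.update_of_ne hki]

theorem exists_height_level_empty {i : ι} (hi : Fintype.card ι ≤ H i) :
    ∃ v < H i, ∀ h, H h ≠ v := by
  classical
  by_contra! hlevels
  have hsub : Finset.range (H i + 1) ⊆ Finset.univ.image H := fun v hv => by
    rcases (Nat.lt_succ_iff.1 (Finset.mem_range.1 hv)).lt_or_eq with hv | rfl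
    · obtain ⟨h, rfl⟩ := hlevels v hv
      exact Finset.mem_image_of_mem H (Finset.mem_univ h)
    · exact Finset.mem_image_of_mem H (Finset.mem_univ i)
  have hcard := (Finset.card_le_card hsub).trans Finset.card_image_le
  rw [Finset.card_range, Finset.card_univ] at hcard
  omega

theorem Preflow.height_lt_card (hp : Preflow adj u cap y H) (hall : HallCondition adj u cap)
    {i : ι} (hi : cap i < load y i) : H i < Fintype.card ι := by
  classical
  by_contra! hge
  obtain ⟨v, hv, hempty⟩ := exists_height_level_empty hge
  let S : Finset ι := {h | v < H h}
  let T : Finset κ := {j | ∃ h ∈ S, 0 < y h j}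
  have hclosed : ∀ j ∈ T, ∀ h, adj h j → h ∈ S := fun j hj h hadj => by
    obtain ⟨k, hk, hkj⟩ := (Finset.mem_filter.1 hj).2
    have hk := (Finset.mem_filter.1 hk).2
    have := hp.height_le_succ k h j hkj hadj
    have := hempty h
    exact Finset.mem_filter.2 ⟨Finset.mem_univ h, by omega⟩
  have hover : ∑ h ∈ S, cap h < ∑ h ∈ S, load y h :=
    Finset.sum_lt_sum (fun h hh => hp.cap_le_load h (Nat.zero_lt_of_lt (Finset.mem_filter.1 hh).2))
      ⟨i, Finset.mem_filter.2 ⟨Finset.mem_univ i, hv⟩, hi⟩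
  have hunits : ∑ h ∈ S, load y h ≤ ∑ j ∈ T, u j := hp.assigns.sum_load_le_sum fun h hh j hj =>
    Finset.mem_filter.2 ⟨Finset.mem_univ j, h, hh, hj⟩
  exact (hall S T hclosed).not_gt (hover.trans_le hunits)

/-- Heights after raising every agent whose capacity is exceeded by one. -/
def raise (cap g H : ι → ℕ) (i : ι) : ℕ := if cap i < g i then H i + 1 else H i

theorem Preflow.raise (hp : Preflow adj u cap y H) (hall : HallCondition adj u cap)
    (hmoves : ∀ i j h, cap i < load y i → H h < H i → 0 < y i j → ¬ adj h j) :
    Preflow adj u cap y (raise cap (load y) H) where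
  assigns := hp.assigns
  height_le_succ i h j hij hhj := by
    have := hp.height_le_succ i h j hij hhj
    have := fun hi hlt => hmoves i j h hi hlt hij hhj
    unfold Chores.raise
    split_ifs <;> grind
  cap_le_load i hi := by
    unfold Chores.raise at hi
    split_ifs at hi with hlt
    exacts [hlt.le, hp.cap_le_load i hi]
  height_le_card i := by
    unfold Chores.raise
    split_ifs with hlt
    exacts [hp.height_lt_card hall hlt, hp.height_le_card i]

theorem sum_lt_sum_raise {g : ι → ℕ} {i : ι} (hi : cap i < g i) :
    ∑ k, H k < ∑ k, raise cap g H k := by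
  refine Finset.sum_lt_sum (fun k _ => ?_) ⟨i, Finset.mem_univ i, ?_⟩
  · unfold raise
    split_ifs
    exacts [Nat.le_succ _, le_rfl]
  · rw [raise, if_pos hi]
    exact Nat.lt_succ_self _

end Transport

end Chores

namespace Chores

section Rank

variable {ι : Type*} [Fintype ι] {g : ι → ℕ} {i h : ι}

/-- The number of agents whose load is above that of agent `i` and above a gap in the loads. Agents
have equal rank if and only if no gap separates their loads. -/
def rank (g : ι → ℕ) (i : ι) : ℕ :=
  Fintype.card {t // g i < g t ∧ ∀ h, g h + 1 ≠ g t}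

theorem rank_le_rank (hle : g i ≤ g h + 1) : rank g h ≤ rank g i := by
  refine Fintype.card_subtype_mono _ _ fun t ht => ⟨?_, ht.2⟩
  have := ht.2 h
  omega

theorem exists_succ_eq_of_rank_eq (heq : rank g h = rank g i) (hlt : g h < g i) {t : ι}
    (ht : g h < g t) (hti : g t ≤ g i) : ∃ l, g l + 1 = g t := by
  simp only [rank, Fintype.card_subtype] at heq
  have hset := Finset.eq_of_subset_of_card_le
    (Finset.monotone_filter_right Finset.univ fun _ _ hl => ⟨hlt.trans hl.1, hl.2⟩) heq.le
  by_contra! hgap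
  have hmem := hset.ge (Finset.mem_filter.2 ⟨Finset.mem_univ t, ht, hgap⟩)
  exact hti.not_gt (Finset.mem_filter.1 hmem).2.1

theorem le_add_card_of_rank_eq (heq : rank g h = rank g i) : g i ≤ g h + Fintype.card ι := by
  classical
  by_contra! hlt
  have hattained : ∀ d, d ≤ g i - g h → ∃ t, g t + d = g i := fun d => by
    induction d with
    | zero => exact fun _ => ⟨i, rfl⟩
    | succ d ih =>
      intro hd
      obtain ⟨t, ht⟩ := ih (by omega)
      obtain ⟨l, hl⟩ := exists_succ_eq_of_rank_eq heq (by omega) (t := t) (by omega) (by omega)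
      exact ⟨l, by omega⟩
  have hsub' : Finset.Icc (g h) (g i) ⊆ Finset.univ.image g := fun v hv => by
    rw [Finset.mem_Icc] at hv
    obtain ⟨t, ht⟩ := hattained (g i - v) (by omega)
    exact Finset.mem_image.2 ⟨t, Finset.mem_univ t, by omega⟩
  have hcard := (Finset.card_le_card hsub').trans Finset.card_image_le
  rw [Nat.card_Icc, Finset.card_univ] at hcard
  omega

theorem le_add_card_of_rank_le (hle : rank g h ≤ rank g i) : g i ≤ g h + Fintype.card ι := by
  rcases hle.lt_or_eq with hlt | heq
  · have : ¬ g h ≤ g i + 1 := fun h' => (rank_le_rank h').not_gt hlt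
    omega
  · exact le_add_card_of_rank_eq heq

end Rank

section Classes

variable {ι κ : Type*} [Fintype ι] {adj : ι → κ → Prop} [∀ i j, Decidable (adj i j)]
  {g : ι → ℕ}

variable (adj g) in
/-- One more than the largest rank of an adjacent agent, and `0` if there is none. -/
def choreRank (j : κ) : ℕ := Finset.sup {i | adj i j} fun i => rank g i + 1

variable (adj g) in
/-- Adjacency restricted to the adjacent agents of largest rank. -/
def classAdj (i : ι) (j : κ) : Prop := adj i j ∧ rank g i + 1 = choreRank adj g j

variable (g) in
/-- The number of agents with the rank of agent `i`. -/
def classAgents (i : ι) : ℕ := Fintype.card {h // rank g h = rank g i}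

variable (adj g) in
/-- The number of chores to be done by the agents with the rank of agent `i`. -/
def classChores [Fintype κ] (i : ι) : ℕ := Fintype.card {j // choreRank adj g j = rank g i + 1}

variable (adj g) in
/-- The number of agents in the class that has to do chore `j`. -/
def choreAgents (j : κ) : ℕ := Fintype.card {i // rank g i + 1 = choreRank adj g j}

theorem rank_lt_choreRank {i : ι} {j : κ} (hij : adj i j) : rank g i + 1 ≤ choreRank adj g j :=
  Finset.le_sup (f := fun i => rank g i + 1) (Finset.mem_filter.2 ⟨Finset.mem_univ i, hij⟩)

theorem choreRank_eq {i : ι} {j : κ} (hij : adj i j) (hle : ∀ h, adj h j → rank g h ≤ rank g i) :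
    choreRank adj g j = rank g i + 1 :=
  le_antisymm (Finset.sup_le fun h hh => Nat.succ_le_succ (hle h (Finset.mem_filter.1 hh).2))
    (rank_lt_choreRank hij)

theorem exists_classAdj {i : ι} {j : κ} (hij : adj i j) : ∃ h, classAdj adj g h j := by
  obtain ⟨h, hh, hsup⟩ := Finset.exists_mem_eq_sup {i | adj i j}
    ⟨i, Finset.mem_filter.2 ⟨Finset.mem_univ i, hij⟩⟩ fun i => rank g i + 1
  exact ⟨h, (Finset.mem_filter.1 hh).2, hsup.symm⟩

theorem exists_adj_of_choreRank_eq {j : κ} {r : ℕ} (hj : choreRank adj g j = r + 1) :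
    ∃ i, adj i j := by
  by_contra! hnone
  have hempty : ({i | adj i j} : Finset ι) = ∅ := Finset.filter_false_of_mem fun i _ => hnone i
  rw [choreRank, hempty] at hj
  exact (Nat.succ_ne_zero r) hj.symm

theorem choreAgents_eq_classAgents {i : ι} {j : κ} (hij : rank g i + 1 = choreRank adj g j) :
    choreAgents adj g j = classAgents g i := by
  simp only [choreAgents, classAgents, ← hij, Nat.add_right_cancel_iff]

theorem classAgents_pos (i : ι) : 0 < classAgents g i := Fintype.card_pos_iff.2 ⟨i, rfl⟩

theorem choreAgents_le (j : κ) : choreAgents adj g j ≤ Fintype.card ι := Fintype.card_subtype_le _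

theorem sum_choreAgents [Fintype κ] : ∑ j, choreAgents adj g j = ∑ i, classChores adj g i := by
  simp only [choreAgents, classChores, Fintype.card_subtype, Finset.card_filter]
  rw [Finset.sum_comm]
  simp only [eq_comm]

/-- With `N` units per chore, `T` is so heavy for `S` that it exceeds the chores per agent in `S'`
at most by an amount that rounding to whole numbers of chores removes. -/
theorem card_mul_card_le {S S' : Finset ι} {N t c : ℕ}
    (hN : N = Fintype.card ι * (Fintype.card ι * Fintype.card ι + 1))
    (hS : N * t ≤ ∑ i ∈ S, g i) (hS' : ∑ h ∈ S', g h ≤ N * c)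
    (hg : ∀ i ∈ S, ∀ h ∈ S', g i ≤ g h + Fintype.card ι) : t * S'.card ≤ c * S.card := by
  rcases (Fintype.card ι).eq_zero_or_pos with hn | hn
  · simp [Nat.eq_zero_of_le_zero (S'.card_le_univ.trans_eq hn)]
  have hcard : S.card * S'.card ≤ Fintype.card ι * Fintype.card ι :=
    Nat.mul_le_mul S.card_le_univ S'.card_le_univ
  have hsum : (∑ i ∈ S, g i) * S'.card ≤
      S.card * ∑ h ∈ S', g h + S.card * S'.card * Fintype.card ι := by
    calc (∑ i ∈ S, g i) * S'.card = ∑ i ∈ S, ∑ _h ∈ S', g i := by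
          simp only [Finset.sum_const, smul_eq_mul, mul_comm, Finset.mul_sum]
      _ ≤ ∑ _i ∈ S, ∑ h ∈ S', (g h + Fintype.card ι) :=
          Finset.sum_le_sum fun i hi => Finset.sum_le_sum fun h hh => hg i hi h hh
      _ = S.card * ∑ h ∈ S', g h + S.card * S'.card * Fintype.card ι := by
          simp only [Finset.sum_add_distrib, Finset.sum_const, smul_eq_mul]
          ring
  have hlt : N * (t * S'.card) < N * (c * S.card + 1) := by
    calc N * (t * S'.card) = N * t * S'.card := by ring
      _ ≤ (∑ i ∈ S, g i) * S'.card := by gcongr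
      _ ≤ S.card * (N * c) + Fintype.card ι * Fintype.card ι * Fintype.card ι :=
          hsum.trans (by gcongr)
      _ < N * (c * S.card + 1) := by
          rw [hN]
          nlinarith
  exact Nat.lt_succ_iff.1 (lt_of_mul_lt_mul_left hlt (Nat.zero_le N))

end Classes

section Stable

variable {ι κ : Type*} [Fintype ι] [Fintype κ] {adj : ι → κ → Prop} {y : ι → κ → ℕ} {N : ℕ}

/-- No unit can be handed over to an adjacent agent whose load is smaller by two or more. -/
def Stable (adj : ι → κ → Prop) (y : ι → κ → ℕ) : Prop :=
  ∀ i j h, 0 < y i j → adj h j → load y i ≤ load y h + 1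

variable [∀ i j, Decidable (adj i j)]

theorem Stable.choreRank_eq (hs : Stable adj y) {u : κ → ℕ} (hy : Assigns adj u y) {i : ι} {j : κ}
    (hij : 0 < y i j) : choreRank adj (load y) j = rank (load y) i + 1 :=
  Chores.choreRank_eq (hy.adj_of_pos i j hij) fun h hh => rank_le_rank (hs i j h hij hh)

theorem Stable.sum_load_class_le (hs : Stable adj y) (hy : Assigns adj (fun _ => N) y) (i : ι) :
    ∑ h with rank (load y) h = rank (load y) i, load y h ≤ N * classChores adj (load y) i := by
  refine (hy.sum_load_le_sum (T := {j | choreRank adj (load y) j = rank (load y) i + 1})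
    fun h hh j hj => ?_).trans_eq ?_
  · rw [Finset.mem_filter] at hh ⊢
    exact ⟨Finset.mem_univ j, hh.2 ▸ hs.choreRank_eq hy hj⟩
  · rw [Finset.sum_const, smul_eq_mul, mul_comm, classChores, Fintype.card_subtype]

theorem Stable.le_sum_load_of_closed (hs : Stable adj y) (hy : Assigns adj (fun _ => N) y)
    {S : Finset ι} {T : Finset κ} {r : ℕ} (hT : ∀ j ∈ T, choreRank adj (load y) j = r + 1)
    (hS : ∀ j ∈ T, ∀ i, classAdj adj (load y) i j → i ∈ S) :
    N * T.card ≤ ∑ i ∈ S with rank (load y) i = r, load y i := by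
  rw [mul_comm, ← smul_eq_mul, ← Finset.sum_const]
  refine hy.sum_le_sum_load (fun j hj => exists_adj_of_choreRank_eq (hT j hj)) fun j hj i hij => ?_
  have hrank := hs.choreRank_eq hy hij
  have := hT j hj
  exact Finset.mem_filter.2 ⟨hS j hj i ⟨hy.adj_of_pos i j hij, hrank.symm⟩, by omega⟩

theorem Stable.classChores_mul_le (hs : Stable adj y) (hy : Assigns adj (fun _ => N) y)
    (hN : N = Fintype.card ι * (Fintype.card ι * Fintype.card ι + 1)) {i h : ι}
    (hle : rank (load y) h ≤ rank (load y) i) :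
    classChores adj (load y) i * classAgents (load y) h ≤
      classChores adj (load y) h * classAgents (load y) i := by
  have hload := hs.le_sum_load_of_closed hy (S := Finset.univ)
    (T := {j | choreRank adj (load y) j = rank (load y) i + 1})
    (fun j hj => (Finset.mem_filter.1 hj).2) fun _ _ i _ => Finset.mem_univ i
  have := card_mul_card_le hN hload (hs.sum_load_class_le hy h) fun k hk l hl => by
    rw [Finset.mem_filter] at hk hl
    exact le_add_card_of_rank_le (by rwa [hk.2, hl.2])
  simpa only [classChores, classAgents, Fintype.card_subtype] using this

theorem Stable.card_mul_classAgents_le (hs : Stable adj y) (hy : Assigns adj (fun _ => N) y)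
    (hN : N = Fintype.card ι * (Fintype.card ι * Fintype.card ι + 1)) {S : Finset ι}
    {T : Finset κ} (hS : ∀ j ∈ T, ∀ i, classAdj adj (load y) i j → i ∈ S) (i : ι) :
    (Finset.card {j ∈ T | choreRank adj (load y) j = rank (load y) i + 1}) *
        classAgents (load y) i ≤
      classChores adj (load y) i * Finset.card {h ∈ S | rank (load y) h = rank (load y) i} := by
  have hload := hs.le_sum_load_of_closed hy (S := S)
    (T := {j ∈ T | choreRank adj (load y) j = rank (load y) i + 1})
    (fun j hj => (Finset.mem_filter.1 hj).2) fun j hj => hS j (Finset.mem_filter.1 hj).1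
  have := card_mul_card_le hN hload (hs.sum_load_class_le hy i) fun k hk l hl => by
    rw [Finset.mem_filter] at hk hl
    exact le_add_card_of_rank_eq (by rw [hk.2, hl.2])
  rwa [classAgents, Fintype.card_subtype]

theorem Stable.hallCondition (hs : Stable adj y) (hy : Assigns adj (fun _ => N) y)
    (hN : N = Fintype.card ι * (Fintype.card ι * Fintype.card ι + 1)) :
    HallCondition (classAdj adj (load y)) (choreAgents adj (load y))
      (classChores adj (load y)) := by
  classical
  intro S T hST
  have hclass := hs.card_mul_classAgents_le hy hN hST
  let r := rank (load y)
  have hr : ∀ i ∈ (Finset.univ : Finset ι), r i ∈ Finset.univ.image r :=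
    fun i hi => Finset.mem_image_of_mem r hi
  calc ∑ j ∈ T, choreAgents adj (load y) j
      = ∑ i, Finset.card {j ∈ T | choreRank adj (load y) j = r i + 1} := by
        simp only [choreAgents, Fintype.card_subtype, Finset.card_filter]
        rw [Finset.sum_comm]
        simp only [eq_comm, r]
    _ = ∑ v ∈ Finset.univ.image r, ∑ i with r i = v,
          Finset.card {j ∈ T | choreRank adj (load y) j = r i + 1} :=
        (Finset.sum_fiberwise_of_maps_to hr _).symm
    _ ≤ ∑ v ∈ Finset.univ.image r, ∑ i ∈ S with r i = v, classChores adj (load y) i := by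
        refine Finset.sum_le_sum fun v hv => ?_
        obtain ⟨i, -, rfl⟩ := Finset.mem_image.1 hv
        have hcap : ∀ h, r h = r i → classChores adj (load y) h = classChores adj (load y) i :=
          fun h hh => by simp only [classChores, show rank (load y) h = rank (load y) i from hh]
        rw [Finset.sum_const_nat fun h hh => by rw [(Finset.mem_filter.1 hh).2],
          Finset.sum_const_nat fun h hh => hcap h (Finset.mem_filter.1 hh).2]
        simpa only [classAgents, Fintype.card_subtype, mul_comm] using hclass i
    _ = ∑ i ∈ S, classChores adj (load y) i :=
        Finset.sum_fiberwise_of_maps_to (fun i _ => hr i (Finset.mem_univ i)) _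

theorem sum_load_eq_sum_classChores {g : ι → ℕ} {z : ι → κ → ℕ}
    (hz : Assigns (classAdj adj g) (choreAgents adj g) z) :
    ∑ i, load z i = ∑ i, classChores adj g i := by
  rw [← sum_choreAgents]
  unfold load
  rw [Finset.sum_comm]
  refine Finset.sum_congr rfl fun j _ => ?_
  by_cases hj : ∃ i, classAdj adj g i j
  · exact hz.sum_eq j hj
  · refine le_antisymm (hz.sum_le j) (le_of_eq_of_le ?_ (Nat.zero_le _))
    refine Fintype.card_eq_zero_iff.2 ⟨fun ⟨i, hi⟩ => hj ?_⟩
    obtain ⟨h, hh⟩ := exists_adj_of_choreRank_eq hi.symm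
    exact exists_classAdj hh

end Stable

section BalancedOfStable

variable {n m N : ℕ} {adj : Fin n → Fin m → Prop} [∀ i j, Decidable (adj i j)]
  {y z : Fin n → Fin m → ℕ}

theorem load_div_classAgents {g : Fin n → ℕ} (i : Fin n) :
    load (fun i j => (z i j / classAgents g i : ℝ)) i = load z i / classAgents g i := by
  simp only [load, Nat.cast_sum, Finset.sum_div]

theorem Stable.balanced (hs : Stable adj y) (hy : Assigns adj (fun _ => N) y)
    (hN : N = n * (n * n + 1))
    (hz : Assigns (classAdj adj (load y)) (choreAgents adj (load y)) z)
    (hload : ∀ i, load z i ≤ classChores adj (load y) i) :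
    Balanced adj fun i j => (z i j / classAgents (load y) i : ℝ) := by
  have hload : ∀ i, load z i = classChores adj (load y) i := fun i =>
    (Finset.sum_eq_sum_iff_of_le fun i _ => hload i).1 (sum_load_eq_sum_classChores hz) i
      (Finset.mem_univ i)
  have hadj : ∀ i j, (z i j / classAgents (load y) i : ℝ) ≠ 0 → classAdj adj (load y) i j :=
    fun i j hij => hz.adj_of_pos i j (Nat.pos_of_ne_zero fun h => hij (by simp [h]))
  have hpos : ∀ i, 0 < (classAgents (load y) i : ℝ) := fun i => by
    exact_mod_cast classAgents_pos i
  refine ⟨fun i j => by positivity, fun i j hij => (hadj i j hij).1, fun j ⟨i, hij⟩ => ?_,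
    fun i h j hhj hij => ?_⟩
  · obtain ⟨h, hh⟩ := exists_classAdj (g := load y) hij
    have hterm : ∀ k, (z k j / classAgents (load y) k : ℝ) =
        z k j / choreAgents adj (load y) j := fun k => by
      rcases (z k j).eq_zero_or_pos with hk | hk
      · simp [hk]
      · rw [choreAgents_eq_classAgents (hz.adj_of_pos k j hk).2]
    simp only [hterm, ← Finset.sum_div]
    rw [← hz.sum_eq j ⟨h, hh⟩, Nat.cast_sum, div_self]
    rw [← Nat.cast_sum, hz.sum_eq j ⟨h, hh⟩, choreAgents_eq_classAgents hh.2]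
    exact (hpos h).ne'
  · have hrank : rank (load y) i ≤ rank (load y) h := by
      have := rank_lt_choreRank (g := load y) hij
      have := (hadj h j hhj).2
      omega
    rw [load_div_classAgents, load_div_classAgents, hload, hload, div_le_div_iff₀ (hpos h) (hpos i)]
    exact_mod_cast hs.classChores_mul_le hy (by simpa using hN) hrank

end BalancedOfStable

end Chores

namespace RAM

section Run

variable {ok ok' : ℝ → Prop}

theorem NExpr.Within.mono (h : ∀ v, ok v → ok' v) {σ : Memory} {e : NExpr}
    (he : e.Within ok σ) : e.Within ok' σ := by
  induction e with
  | ofIdx e => exact h _ he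
  | get A i j => exact h _ he
  | add e f ihe ihf => exact ⟨ihe he.1, ihf he.2.1, h _ he.2.2⟩
  | sub e f ihe ihf => exact ⟨ihe he.1, ihf he.2.1, h _ he.2.2⟩
  | mul e f ihe ihf => exact ⟨ihe he.1, ihf he.2.1, h _ he.2.2⟩
  | div e f ihe ihf => exact ⟨ihe he.1, ihf he.2.1, h _ he.2.2⟩

theorem Test.Within.mono (h : ∀ v, ok v → ok' v) {σ : Memory} {b : Test}
    (hb : b.Within ok σ) : b.Within ok' σ := by
  induction b with
  | idxLe e f => trivial
  | numLe e f => exact ⟨NExpr.Within.mono h hb.1, NExpr.Within.mono h hb.2⟩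
  | not b ih => exact ih hb
  | and b d ihb ihd => exact ⟨ihb hb.1, ihd hb.2⟩

theorem Run.mono (h : ∀ v, ok v → ok' v) {p : Program} {σ τ : Memory} {t : ℕ}
    (hr : Run ok p σ t τ) : Run ok' p σ t τ := by
  induction hr with
  | skip σ => exact .skip σ
  | setIdx A i j e σ => exact .setIdx A i j e σ
  | setNum A i j e σ he => exact .setNum A i j e σ (NExpr.Within.mono h he)
  | seq _ _ ihp ihq => exact .seq ihp ihq
  | condTrue hw hb _ ih => exact .condTrue (Test.Within.mono h hw) hb ih
  | condFalse hw hb _ ih => exact .condFalse (Test.Within.mono h hw) hb ih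
  | loopDone hw hb => exact .loopDone (Test.Within.mono h hw) hb
  | loopStep hw hb _ _ ihp ihl => exact .loopStep (Test.Within.mono h hw) hb ihp ihl

end Run

section Timed

open Polynomial

/-- A program together with a polynomial in `n + m` that bounds the number of its steps. -/
structure TimedProgram where
  prog : Program
  time : ℕ[X]

namespace TimedProgram

/-- The program that does nothing. -/
noncomputable def skip : TimedProgram := ⟨.skip, 1⟩

/-- Assignment to an index array. -/
noncomputable def setIdx (A : ℕ) (i j e : IExpr) : TimedProgram :=
  ⟨.setIdx A i j e, C (i.cost + j.cost + e.cost + 1)⟩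

/-- Assignment to a number array. -/
noncomputable def setNum (A : ℕ) (i j : IExpr) (e : NExpr) : TimedProgram :=
  ⟨.setNum A i j e, C (i.cost + j.cost + e.cost + 1)⟩

/-- Sequential composition. -/
noncomputable def seq (p q : TimedProgram) : TimedProgram :=
  ⟨.seq p.prog q.prog, p.time + q.time⟩

/-- Case distinction. -/
noncomputable def cond (b : Test) (p q : TimedProgram) : TimedProgram :=
  ⟨.cond b p.prog q.prog, C b.cost + p.time + q.time⟩

/-- A loop that is claimed to end after at most `bound` rounds. -/
noncomputable def loop (bound : ℕ[X]) (b : Test) (p : TimedProgram) : TimedProgram :=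
  ⟨.loop b p.prog, (bound + 1) * (C b.cost + p.time)⟩

end TimedProgram

notation:60 p:61 "⨟" q:60 => TimedProgram.seq p q

variable {ok : ℝ → Prop} {k : ℕ} {p q : TimedProgram} {b : Test} {σ : Memory}
  {Post Post' : Memory → Prop}

/-- Total correctness: started in `σ`, the program halts within its time bound in a memory with
property `Post`, and all numbers that occur on the way satisfy `ok`. -/
def Halts (ok : ℝ → Prop) (k : ℕ) (p : TimedProgram) (σ : Memory) (Post : Memory → Prop) : Prop :=
  ∃ t τ, Run ok p.prog σ t τ ∧ t ≤ p.time.eval k ∧ Post τ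

theorem Halts.mono (hp : Halts ok k p σ Post) (h : ∀ τ, Post τ → Post' τ) :
    Halts ok k p σ Post' := by
  obtain ⟨t, τ, hr, ht, hτ⟩ := hp
  exact ⟨t, τ, hr, ht, h τ hτ⟩

theorem halts_skip (h : Post σ) : Halts ok k .skip σ Post :=
  ⟨1, σ, .skip σ, by simp [TimedProgram.skip], h⟩

theorem halts_setIdx {A : ℕ} {i j e : IExpr}
    (h : Post (σ.setIdx A (i.eval σ) (j.eval σ) (e.eval σ))) :
    Halts ok k (.setIdx A i j e) σ Post :=
  ⟨_, _, .setIdx A i j e σ, by simp [TimedProgram.setIdx], h⟩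

theorem halts_setNum {A : ℕ} {i j : IExpr} {e : NExpr} (he : e.Within ok σ)
    (h : Post (σ.setNum A (i.eval σ) (j.eval σ) (e.eval σ))) :
    Halts ok k (.setNum A i j e) σ Post :=
  ⟨_, _, .setNum A i j e σ he, by simp [TimedProgram.setNum], h⟩

theorem halts_seq (h : Halts ok k p σ fun τ => Halts ok k q τ Post) :
    Halts ok k (p ⨟ q) σ Post := by
  obtain ⟨s, τ, hp, hs, t, υ, hq, ht, hυ⟩ := h
  exact ⟨s + t, υ, .seq hp hq, by simpa [TimedProgram.seq] using add_le_add hs ht, hυ⟩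

theorem halts_cond (hb : b.Within ok σ) (hp : b.Holds σ → Halts ok k p σ Post)
    (hq : ¬ b.Holds σ → Halts ok k q σ Post) : Halts ok k (.cond b p q) σ Post := by
  by_cases h : b.Holds σ
  · obtain ⟨t, τ, hr, ht, hτ⟩ := hp h
    refine ⟨_, τ, .condTrue hb h hr, ?_, hτ⟩
    simp only [TimedProgram.cond, eval_add, eval_C]
    omega
  · obtain ⟨t, τ, hr, ht, hτ⟩ := hq h
    refine ⟨_, τ, .condFalse hb h hr, ?_, hτ⟩
    simp only [TimedProgram.cond, eval_add, eval_C]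
    omega

theorem halts_loop {I : Memory → Prop} (μ : Memory → ℕ) {bound : ℕ[X]}
    (hb : ∀ τ, I τ → b.Within ok τ)
    (hstep : ∀ τ, I τ → b.Holds τ → Halts ok k p τ fun υ => I υ ∧ μ υ < μ τ)
    (hpost : ∀ τ, I τ → ¬ b.Holds τ → Post τ) (hσ : I σ) (hbound : μ σ ≤ bound.eval k) :
    Halts ok k (.loop bound b p) σ Post := by
  suffices H : ∀ N σ, I σ → μ σ ≤ N → ∃ t τ, Run ok (.loop b p.prog) σ t τ ∧
      t ≤ (N + 1) * (b.cost + p.time.eval k) ∧ Post τ by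
    obtain ⟨t, τ, hr, ht, hτ⟩ := H _ σ hσ hbound
    exact ⟨t, τ, hr, by simpa [TimedProgram.loop] using ht, hτ⟩
  clear hσ hbound
  intro N
  induction N with
  | zero =>
    intro σ hσ hN
    have hdone : ¬ b.Holds σ := fun h => by
      obtain ⟨-, υ, -, -, -, hlt⟩ := hstep σ hσ h
      omega
    exact ⟨_, σ, .loopDone (hb σ hσ) hdone, by omega, hpost σ hσ hdone⟩
  | succ N ih =>
    intro σ hσ hN
    by_cases h : b.Holds σ
    · obtain ⟨s, υ, hr, hs, hυ, hlt⟩ := hstep σ hσ h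
      obtain ⟨t, τ, hl, ht, hτ⟩ := ih υ hυ (by omega)
      refine ⟨_, τ, .loopStep (hb σ hσ) h hr hl, ?_, hτ⟩
      rw [add_mul]
      omega
    · refine ⟨_, σ, .loopDone (hb σ hσ) h, ?_, hpost σ hσ h⟩
      rw [add_mul]
      omega

end Timed

section Loops

open Polynomial

/-- The possible numbers of rounds of a counting loop. -/
inductive Dim where
  | one
  | agents
  | chores

/-- The number of rounds for an `n × m` matrix. -/
@[reducible]
def Dim.size (n m : ℕ) : Dim → ℕ
  | one => 1
  | agents => n
  | chores => m

/-- The expression for the number of rounds. -/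
def Dim.expr : Dim → IExpr
  | one => .lit 1
  | agents => .get 0 (.lit 0) (.lit 0)
  | chores => .get 0 (.lit 0) (.lit 1)

theorem Dim.size_le {n : ℕ} (hn : 0 < n) (m : ℕ) (d : Dim) : d.size n m ≤ n + m := by
  cases d <;> dsimp only [Dim.size] <;> omega

/-- Position `(0, 0)` of index array `A`. -/
def scalar (A : ℕ) : IExpr := .get A (.lit 0) (.lit 0)

/-- Repeats `p` while the scalar `v` counts from zero to `d`, and then resets it to zero. -/
noncomputable def forLoop (v : ℕ) (d : Dim) (p : TimedProgram) : TimedProgram :=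
  .loop X (.not (.idxLe d.expr (scalar v)))
    (p ⨟ .setIdx v (.lit 0) (.lit 0) (.add (scalar v) (.lit 1))) ⨟
  .setIdx v (.lit 0) (.lit 0) (.lit 0)

variable {ok : ℝ → Prop} {k n m : ℕ} {σ : Memory} {Post : Memory → Prop}

theorem halts_forLoop {p : TimedProgram} {v N : ℕ} {d : Dim} {I : ℕ → Memory → Prop} (hN : N ≤ k)
    (hI : ∀ i τ, I i τ → τ.idx v 0 0 = i ∧ d.expr.eval τ = N)
    (hstep : ∀ i < N, ∀ τ, I i τ →
      Halts ok k p τ fun υ => υ.idx v 0 0 = i ∧ I (i + 1) (υ.setIdx v 0 0 (i + 1)))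
    (hpost : ∀ τ, I N τ → Post (τ.setIdx v 0 0 0)) (hσ : I 0 σ) :
    Halts ok k (forLoop v d p) σ Post := by
  refine halts_seq (halts_loop (I := fun τ => ∃ i ≤ N, I i τ) (fun τ => N - τ.idx v 0 0)
    (fun _ _ => trivial) (fun τ hτ hb => ?_) (fun τ hτ hb => ?_) ⟨0, N.zero_le, hσ⟩ ?_)
  · obtain ⟨i, -, hτ⟩ := hτ
    simp only [Test.Holds, scalar, IExpr.eval, hI i τ hτ, not_le] at hb
    refine halts_seq ((hstep i hb τ hτ).mono fun υ hυ => halts_setIdx ?_)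
    simp only [scalar, IExpr.eval, hυ.1]
    refine ⟨⟨i + 1, hb, hυ.2⟩, ?_⟩
    rw [(hI _ _ hυ.2).1, (hI i τ hτ).1]
    omega
  · obtain ⟨i, hiN, hτ⟩ := hτ
    simp only [Test.Holds, scalar, IExpr.eval, hI i τ hτ, not_not] at hb
    obtain rfl : i = N := le_antisymm hiN hb
    exact halts_setIdx (hpost τ hτ)
  · simpa using (Nat.sub_le _ _).trans hN

theorem halts_forLoop_counter {p : TimedProgram} {v N : ℕ} {d : Dim} {place : Memory → ℕ → Memory}
    {I : ℕ → Memory → Prop} (hN : N ≤ k) (hread : ∀ τ i, (place τ i).idx v 0 0 = i)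
    (hwrite : ∀ τ i i', (place τ i).setIdx v 0 0 i' = place τ i')
    (hd : ∀ i τ, I i τ → d.expr.eval (place τ i) = N)
    (hstep : ∀ i < N, ∀ τ, I i τ →
      Halts ok k p (place τ i) fun υ => ∃ τ', I (i + 1) τ' ∧ υ = place τ' i)
    (hpost : ∀ τ, I N τ → Post (place τ 0)) (hσ : I 0 σ) :
    Halts ok k (forLoop v d p) (place σ 0) Post := by
  refine halts_forLoop (I := fun i υ => ∃ τ, I i τ ∧ υ = place τ i) hN ?_ ?_ ?_ ⟨σ, hσ, rfl⟩
  · rintro i _ ⟨τ, hτ, rfl⟩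
    exact ⟨hread τ i, hd i τ hτ⟩
  · rintro i hi _ ⟨τ, hτ, rfl⟩
    refine (hstep i hi τ hτ).mono ?_
    rintro _ ⟨υ, hυ, rfl⟩
    exact ⟨hread υ i, υ, hυ, hwrite υ i (i + 1)⟩
  · rintro _ ⟨τ, hτ, rfl⟩
    rw [hwrite]
    exact hpost τ hτ

/-- The sizes are stored in index array `0` as in the input, and the loop counters, in index arrays
`1`, `2` and `3`, are zero. -/
structure Ready (n m : ℕ) (σ : Memory) : Prop where
  agents : σ.idx 0 0 0 = n
  chores : σ.idx 0 0 1 = m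
  row : σ.idx 1 0 0 = 0
  col : σ.idx 2 0 0 = 0
  layer : σ.idx 3 0 0 = 0

/-- The memory with the loop counters set to `i`, `j` and `l`. -/
def Memory.atCell (σ : Memory) (i j l : ℕ) : Memory :=
  ((σ.setIdx 1 0 0 i).setIdx 2 0 0 j).setIdx 3 0 0 l

theorem Memory.atCell_row (σ : Memory) (i j l : ℕ) : (σ.atCell i j l).idx 1 0 0 = i := by
  simp [Memory.atCell, Memory.setIdx]

theorem Memory.atCell_col (σ : Memory) (i j l : ℕ) : (σ.atCell i j l).idx 2 0 0 = j := by
  simp [Memory.atCell, Memory.setIdx]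

theorem Memory.atCell_layer (σ : Memory) (i j l : ℕ) : (σ.atCell i j l).idx 3 0 0 = l := by
  simp [Memory.atCell, Memory.setIdx]

theorem Memory.atCell_idx (σ : Memory) (i j l : ℕ) {A : ℕ} (h1 : A ≠ 1) (h2 : A ≠ 2)
    (h3 : A ≠ 3) : (σ.atCell i j l).idx A = σ.idx A := by
  simp [Memory.atCell, Memory.setIdx, h1, h2, h3]

theorem Memory.atCell_num (σ : Memory) (i j l : ℕ) : (σ.atCell i j l).num = σ.num := rfl

theorem Memory.atCell_setIdx_row (σ : Memory) (i j l i' : ℕ) :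
    (σ.atCell i j l).setIdx 1 0 0 i' = σ.atCell i' j l := by
  simp only [Memory.atCell, Memory.setIdx, Memory.mk.injEq, and_true]
  grind

theorem Memory.atCell_setIdx_col (σ : Memory) (i j l j' : ℕ) :
    (σ.atCell i j l).setIdx 2 0 0 j' = σ.atCell i j' l := by
  simp only [Memory.atCell, Memory.setIdx, Memory.mk.injEq, and_true]
  grind

theorem Memory.atCell_setIdx_layer (σ : Memory) (i j l l' : ℕ) :
    (σ.atCell i j l).setIdx 3 0 0 l' = σ.atCell i j l' := by
  simp only [Memory.atCell, Memory.setIdx, Memory.mk.injEq, and_true]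
  grind

theorem Ready.atCell_zero (h : Ready n m σ) : σ.atCell 0 0 0 = σ := by
  obtain ⟨-, -, hrow, hcol, hlayer⟩ := h
  simp only [Memory.atCell, Memory.setIdx]
  congr
  grind

theorem Ready.eval_dim (h : Ready n m σ) (i j l : ℕ) (d : Dim) :
    d.expr.eval (σ.atCell i j l) = d.size n m := by
  cases d
  · rfl
  · simpa [Dim.expr, IExpr.eval, Memory.atCell_idx] using h.agents
  · simpa [Dim.expr, IExpr.eval, Memory.atCell_idx] using h.chores

/-- For every row and column, runs `init` and then `body` for every layer. -/
noncomputable def forCells (R C L : Dim) (init body : TimedProgram) : TimedProgram :=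
  forLoop 1 R (forLoop 2 C (init ⨟ forLoop 3 L body))

theorem halts_forCells {R C L : Dim} {init body : TimedProgram} {J : ℕ → ℕ → Memory → Prop}
    {K : ℕ → ℕ → ℕ → Memory → Prop} (hk : ∀ d : Dim, d.size n m ≤ k)
    (hJ : ∀ i j τ, J i j τ → Ready n m τ) (hK : ∀ i j l τ, K i j l τ → Ready n m τ)
    (hinit : ∀ i < R.size n m, ∀ j < C.size n m, ∀ τ, J i j τ →
      Halts ok k init (τ.atCell i j 0) fun υ => ∃ τ', K i j 0 τ' ∧ υ = τ'.atCell i j 0)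
    (hbody : ∀ i < R.size n m, ∀ j < C.size n m, ∀ l < L.size n m, ∀ τ, K i j l τ →
      Halts ok k body (τ.atCell i j l) fun υ => ∃ τ', K i j (l + 1) τ' ∧ υ = τ'.atCell i j l)
    (hcol : ∀ i j τ, K i j (L.size n m) τ → J i (j + 1) τ)
    (hrow : ∀ i τ, J i (C.size n m) τ → J (i + 1) 0 τ)
    (hpost : ∀ τ, J (R.size n m) 0 τ → Post τ) (hσ : J 0 0 σ) :
    Halts ok k (forCells R C L init body) σ Post := by
  have hlayers : ∀ i < R.size n m, ∀ j < C.size n m, ∀ τ, K i j 0 τ →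
      Halts ok k (forLoop 3 L body) (τ.atCell i j 0) fun υ =>
        ∃ τ', J i (j + 1) τ' ∧ υ = τ'.atCell i j 0 := fun i hi j hj τ hτ =>
    halts_forLoop_counter (hk L) (fun υ => υ.atCell_layer i j) (fun υ => υ.atCell_setIdx_layer i j)
      (fun l υ hυ => (hK i j l υ hυ).eval_dim i j l L) (hbody i hi j hj)
      (fun υ hυ => ⟨υ, hcol i j υ hυ, rfl⟩) hτ
  have hcols : ∀ i < R.size n m, ∀ τ, J i 0 τ →
      Halts ok k (forLoop 2 C (init ⨟ forLoop 3 L body)) (τ.atCell i 0 0) fun υ =>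
        ∃ τ', J (i + 1) 0 τ' ∧ υ = τ'.atCell i 0 0 := fun i hi τ hτ =>
    halts_forLoop_counter (place := fun υ j => υ.atCell i j 0) (hk C)
      (fun υ j => υ.atCell_col i j 0) (fun υ j => υ.atCell_setIdx_col i j 0)
      (fun j υ hυ => (hJ i j υ hυ).eval_dim i j 0 C)
      (fun j hj υ hυ => halts_seq ((hinit i hi j hj υ hυ).mono
        fun _ ⟨υ', hυ', heq⟩ => heq ▸ hlayers i hi j hj υ' hυ'))
      (fun υ hυ => ⟨υ, hrow i υ hυ, rfl⟩) hτ
  rw [← (hJ 0 0 σ hσ).atCell_zero]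
  refine halts_forLoop_counter (place := fun υ i => υ.atCell i 0 0) (hk R)
    (fun υ i => υ.atCell_row i 0 0) (fun υ i => υ.atCell_setIdx_row i 0 0)
    (fun i υ hυ => (hJ i 0 υ hυ).eval_dim i 0 0 R) hcols (fun υ hυ => ?_) hσ
  rw [(hJ _ 0 υ hυ).atCell_zero]
  exact hpost υ hυ

end Loops

section Arrays

variable {V : Type*} {ok : ℝ → Prop} {k n m A : ℕ} {σ : Memory} {Post : Memory → Prop}

/-- The array `f` with `v` stored at position `(i, j)`. -/
def write (f : ℕ → ℕ → V) (i j : ℕ) (v : V) : ℕ → ℕ → V :=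
  Function.update f i (Function.update (f i) j v)

theorem write_apply (f : ℕ → ℕ → V) (i j : ℕ) (v : V) (i' j' : ℕ) :
    write f i j v i' j' = if i' = i ∧ j' = j then v else f i' j' := by
  simp only [write, Function.update_apply]
  grind

@[simp]
theorem write_self (f : ℕ → ℕ → V) (i j : ℕ) : write f i j (f i j) = f := by
  simp [write]

@[simp]
theorem Memory.setIdx_idx (σ : Memory) (A i j v B : ℕ) :
    (σ.setIdx A i j v).idx B = if B = A then write (σ.idx A) i j v else σ.idx B := by
  funext x y
  simp only [Memory.setIdx]
  grind [write_apply]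

/-- The memory in which `f` replaces index array `A`. -/
def Memory.putIdx (σ : Memory) (A : ℕ) (f : ℕ → ℕ → ℕ) : Memory :=
  { σ with idx := Function.update σ.idx A f }

@[simp]
theorem Memory.putIdx_idx (σ : Memory) (A B : ℕ) (f : ℕ → ℕ → ℕ) :
    (σ.putIdx A f).idx B = if B = A then f else σ.idx B :=
  Function.update_apply ..

@[simp]
theorem Memory.putIdx_num (σ : Memory) (A : ℕ) (f : ℕ → ℕ → ℕ) : (σ.putIdx A f).num = σ.num := rfl

theorem Memory.putIdx_self (σ : Memory) (A : ℕ) : σ.putIdx A (σ.idx A) = σ := by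
  simp [Memory.putIdx]

theorem Memory.setIdx_putIdx (σ : Memory) (A : ℕ) (f : ℕ → ℕ → ℕ) (i j v : ℕ) :
    (σ.putIdx A f).setIdx A i j v = σ.putIdx A (write f i j v) := by
  simp only [Memory.putIdx, Memory.setIdx, Memory.mk.injEq, and_true]
  funext A' x y
  simp only [Function.update_apply]
  grind [write_apply]

theorem Memory.setIdx_atCell (σ : Memory) (hA : 4 ≤ A) (i j l i' j' v : ℕ) :
    (σ.atCell i j l).setIdx A i' j' v = (σ.setIdx A i' j' v).atCell i j l := by
  simp only [Memory.atCell, Memory.setIdx, Memory.mk.injEq, and_true]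
  grind

theorem Ready.putIdx (h : Ready n m σ) (hA : 4 ≤ A) (f : ℕ → ℕ → ℕ) :
    Ready n m (σ.putIdx A f) := by
  obtain ⟨h1, h2, h3, h4, h5⟩ := h
  constructor <;> rw [Memory.putIdx_idx, if_neg (by omega)] <;> assumption

theorem halts_fill {put : (ℕ → ℕ → V) → Memory} {R C L : Dim} {init body : TimedProgram}
    {Cell : ℕ → ℕ → ℕ → V → Prop} (hk : ∀ d : Dim, d.size n m ≤ k)
    (hput : ∀ f, Ready n m (put f))
    (hinit : ∀ f, ∀ i < R.size n m, ∀ j < C.size n m,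
      Halts ok k init ((put f).atCell i j 0) fun υ =>
        ∃ v, Cell i j 0 v ∧ υ = (put (write f i j v)).atCell i j 0)
    (hbody : ∀ f, ∀ i < R.size n m, ∀ j < C.size n m, ∀ l < L.size n m, Cell i j l (f i j) →
      Halts ok k body ((put f).atCell i j l) fun υ =>
        ∃ v, Cell i j (l + 1) v ∧ υ = (put (write f i j v)).atCell i j l)
    (hpost : ∀ f, (∀ i < R.size n m, ∀ j < C.size n m, Cell i j (L.size n m) (f i j)) →
      Post (put f)) (f : ℕ → ℕ → V) :
    Halts ok k (forCells R C L init body) (put f) Post := by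
  let Filled (i j : ℕ) (f : ℕ → ℕ → V) : Prop :=
    ∀ i' < R.size n m, ∀ j' < C.size n m, i' < i ∨ i' = i ∧ j' < j →
      Cell i' j' (L.size n m) (f i' j')
  refine halts_forCells (J := fun i j τ => ∃ f, τ = put f ∧ Filled i j f)
    (K := fun i j l τ => ∃ f, τ = put f ∧ Filled i j f ∧ Cell i j l (f i j)) hk ?_ ?_ ?_ ?_ ?_ ?_
    ?_ ⟨f, rfl, fun i' _ j' _ h => by omega⟩
  · rintro i j τ ⟨f, rfl, -⟩
    exact hput f
  · rintro i j l τ ⟨f, rfl, -⟩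
    exact hput f
  · rintro i hi j hj τ ⟨f, rfl, hf⟩
    refine (hinit f i hi j hj).mono ?_
    rintro υ ⟨v, hv, rfl⟩
    refine ⟨_, ⟨_, rfl, fun i' hi' j' hj' h => ?_, by simpa [write_apply] using hv⟩, rfl⟩
    rw [write_apply, if_neg (by omega)]
    exact hf i' hi' j' hj' h
  · rintro i hi j hj l hl τ ⟨f, rfl, hf, hcell⟩
    refine (hbody f i hi j hj l hl hcell).mono ?_
    rintro υ ⟨v, hv, rfl⟩
    refine ⟨_, ⟨_, rfl, fun i' hi' j' hj' h => ?_, by simpa [write_apply] using hv⟩, rfl⟩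
    rw [write_apply, if_neg (by omega)]
    exact hf i' hi' j' hj' h
  · rintro i j τ ⟨f, rfl, hf, hcell⟩
    refine ⟨f, rfl, fun i' hi' j' hj' h => ?_⟩
    by_cases h' : i' = i ∧ j' = j
    · rwa [h'.1, h'.2]
    · exact hf i' hi' j' hj' (by omega)
  · rintro i τ ⟨f, rfl, hf⟩
    exact ⟨f, rfl, fun i' hi' j' hj' h => hf i' hi' j' hj' (by omega)⟩
  · rintro τ ⟨f, rfl, hf⟩
    exact hpost f fun i hi j hj => hf i hi j hj (.inl hi)

end Arrays

section IndexArrays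

attribute [simp] IExpr.eval Test.Holds scalar Memory.atCell_row Memory.atCell_col
  Memory.atCell_layer Memory.atCell_idx Memory.atCell_num

variable {ok : ℝ → Prop} {k n m A : ℕ} {σ : Memory} {Post : Memory → Prop} {R C L : Dim}

/-- Row of the current cell. -/
@[simp]
def row : IExpr := .get 1 (.lit 0) (.lit 0)

/-- Column of the current cell. -/
@[simp]
def col : IExpr := .get 2 (.lit 0) (.lit 0)

/-- Layer of the current cell. -/
@[simp]
def layer : IExpr := .get 3 (.lit 0) (.lit 0)

/-- Sets every cell of index array `A` to `e₀`, and then, layer by layer, to `e` where `b` holds. -/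
noncomputable def fillIdx (A : ℕ) (R C L : Dim) (e₀ : IExpr) (b : Test) (e : IExpr) :
    TimedProgram :=
  forCells R C L (.setIdx A row col e₀) (.cond b (.setIdx A row col e) .skip)

theorem halts_fillIdx {e₀ e : IExpr} {b : Test} {Cell : ℕ → ℕ → ℕ → ℕ → Prop}
    (hk : ∀ d : Dim, d.size n m ≤ k) (hσ : Ready n m σ) (hA : 4 ≤ A)
    (hb : ∀ τ : Memory, τ.num = σ.num → b.Within ok τ)
    (hinit : ∀ f, ∀ i < R.size n m, ∀ j < C.size n m,
      Cell i j 0 (e₀.eval ((σ.putIdx A f).atCell i j 0)))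
    (hset : ∀ f, ∀ i < R.size n m, ∀ j < C.size n m, ∀ l < L.size n m, Cell i j l (f i j) →
      b.Holds ((σ.putIdx A f).atCell i j l) →
        Cell i j (l + 1) (e.eval ((σ.putIdx A f).atCell i j l)))
    (hskip : ∀ f, ∀ i < R.size n m, ∀ j < C.size n m, ∀ l < L.size n m, Cell i j l (f i j) →
      ¬ b.Holds ((σ.putIdx A f).atCell i j l) → Cell i j (l + 1) (f i j))
    (hpost : ∀ f, (∀ i < R.size n m, ∀ j < C.size n m, Cell i j (L.size n m) (f i j)) →
      Post (σ.putIdx A f)) :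
    Halts ok k (fillIdx A R C L e₀ b e) σ Post := by
  rw [← σ.putIdx_self A]
  refine halts_fill hk (hσ.putIdx hA) (fun f i hi j hj => halts_setIdx ?_)
    (fun f i hi j hj l hl hf =>
      halts_cond (hb _ rfl) (fun h => halts_setIdx ?_) fun h => halts_skip ?_) hpost _
  · exact ⟨_, hinit f i hi j hj, by simp [Memory.setIdx_atCell _ hA, Memory.setIdx_putIdx]⟩
  · exact ⟨_, hset f i hi j hj l hl hf h, by simp [Memory.setIdx_atCell _ hA, Memory.setIdx_putIdx]⟩
  · exact ⟨_, hskip f i hi j hj l hl hf h, by simp⟩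

/-- Sets every cell of index array `A` to the sum of `e` over all layers where `b` holds. -/
noncomputable def sumIdx (A : ℕ) (R C L : Dim) (b : Test) (e : IExpr) : TimedProgram :=
  fillIdx A R C L (.lit 0) b (.add (.get A row col) e)

open scoped Classical in
theorem halts_sumIdx {e : IExpr} {b : Test} (hk : ∀ d : Dim, d.size n m ≤ k) (hσ : Ready n m σ)
    (hA : 4 ≤ A) (hb : ∀ τ : Memory, τ.num = σ.num → b.Within ok τ)
    (hbA : ∀ f i j l, b.Holds ((σ.putIdx A f).atCell i j l) ↔ b.Holds (σ.atCell i j l))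
    (heA : ∀ f i j l, e.eval ((σ.putIdx A f).atCell i j l) = e.eval (σ.atCell i j l))
    (hpost : ∀ f, (∀ i < R.size n m, ∀ j < C.size n m, f i j = ∑ l : Fin (L.size n m),
      if b.Holds (σ.atCell i j l) then e.eval (σ.atCell i j l) else 0) → Post (σ.putIdx A f)) :
    Halts ok k (sumIdx A R C L b e) σ Post := by
  refine halts_fillIdx (Cell := fun i j l v => v = ∑ l' ∈ Finset.range l,
    if b.Holds (σ.atCell i j l') then e.eval (σ.atCell i j l') else 0) hk hσ hA hb ?_ ?_ ?_ ?_
  · simp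
  · intro f i _ j _ l _ hf h
    rw [hbA] at h
    rw [Finset.sum_range_succ, ← hf, if_pos h, ← heA f]
    have := Memory.atCell_idx (σ.putIdx A f) i j l (A := A) (by omega) (by omega) (by omega)
    simp [this]
  · intro f i _ j _ l _ hf h
    rw [hbA] at h
    rw [Finset.sum_range_succ, ← hf, if_neg h, add_zero]
  · exact fun f hf => hpost f fun i hi j hj => by
      rw [hf i hi j hj, Fin.sum_univ_eq_sum_range fun l =>
        if b.Holds (σ.atCell i j l) then e.eval (σ.atCell i j l) else 0]

end IndexArrays

/-- The index arrays besides the sizes and the loop counters. -/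
inductive Arr
  | adj | quota | units | holder | alloc | load | moved | gap | rank | choreRank | size | cap
  | height | excess | next | atMost | isLow

/-- The number under which an array is stored. -/
@[simp]
def Arr.code : Arr → ℕ
  | adj => 4
  | quota => 5
  | units => 6
  | holder => 7
  | alloc => 8
  | load => 9
  | moved => 10
  | gap => 11
  | rank => 12
  | choreRank => 13
  | size => 14
  | cap => 15
  | height => 16
  | excess => 17
  | next => 18
  | atMost => 19
  | isLow => 20

instance : CoeOut Arr ℕ := ⟨Arr.code⟩

section Exchange

open Chores

variable {ok : ℝ → Prop} {k n m : ℕ} {σ τ : Memory} {Post : Memory → Prop}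
  {y : Fin n → Fin m → ℕ} {F : ℕ}

/-- The entries of a vector are stored in column zero. -/
@[simp]
def vec (A : ℕ) (i : IExpr) : IExpr := .get A i (.lit 0)

/-- Positivity of an index. -/
@[simp]
def pos (e : IExpr) : Test := .idxLe (.lit 1) e

/-- Agent `row` hands over one unit of chore `col` to agent `layer`. -/
noncomputable def moveProg : TimedProgram :=
  .setIdx Arr.alloc row col (.sub (.get Arr.alloc row col) (.lit 1)) ⨟
  .setIdx Arr.alloc layer col (.add (.get Arr.alloc layer col) (.lit 1)) ⨟
  .setIdx Arr.load row (.lit 0) (.sub (vec Arr.load row) (.lit 1)) ⨟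
  .setIdx Arr.load layer (.lit 0) (.add (vec Arr.load layer) (.lit 1)) ⨟
  .setIdx Arr.moved (.lit 0) (.lit 0) (.lit 1)

/-- Tries to move a unit from every agent, of every chore, to every agent. -/
noncomputable def sweepProg (guard : Test) : TimedProgram :=
  forCells .agents .chores .agents .skip
    (.cond (.and (pos (.get Arr.alloc row col)) (.and (pos (.get Arr.adj layer col)) guard))
      moveProg .skip)

/-- Moves units until no move is enabled. -/
noncomputable def exchangeProg (bound : Polynomial ℕ) (guard : Test) : TimedProgram :=
  .setIdx Arr.moved (.lit 0) (.lit 0) (.lit 1) ⨟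
  .loop bound (pos (scalar Arr.moved))
    (.setIdx Arr.moved (.lit 0) (.lit 0) (.lit 0) ⨟ sweepProg guard)

/-- The memory `τ` differs from `σ` only in that the allocation is `y`, with its loads, and that
the flag for a move is `F`. -/
structure Exchanging (σ : Memory) (y : Fin n → Fin m → ℕ) (F : ℕ) (τ : Memory) : Prop where
  num : τ.num = σ.num
  idx : ∀ A : ℕ, A ≠ Arr.alloc → A ≠ Arr.load → A ≠ Arr.moved → τ.idx A = σ.idx A
  alloc : ∀ (i : Fin n) (j : Fin m), τ.idx Arr.alloc i j = y i j
  load : ∀ i : Fin n, τ.idx Arr.load i 0 = load y i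
  moved : τ.idx Arr.moved 0 0 = F

theorem Exchanging.setMoved (h : Exchanging σ y F τ) (F' : ℕ) :
    Exchanging σ y F' (τ.setIdx Arr.moved 0 0 F') where
  num := h.num
  idx A h1 h2 h3 := by rw [Memory.setIdx_idx, if_neg h3, h.idx A h1 h2 h3]
  alloc i j := by simpa using h.alloc i j
  load i := by simpa using h.load i
  moved := by simp [write_apply]

theorem Exchanging.ready (h : Exchanging σ y F τ) (hσ : Ready n m σ) : Ready n m τ := by
  obtain ⟨h1, h2, h3, h4, h5⟩ := hσ
  constructor <;> rw [h.idx _ (by simp) (by simp) (by simp)] <;> assumption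

theorem Exchanging.halts_move {i h : Fin n} {j : Fin m} (hτ : Exchanging σ y F τ)
    (hih : i ≠ h) (hij : 0 < y i j) :
    Halts ok k moveProg (τ.atCell i j h) fun υ =>
      ∃ τ', Exchanging σ (moveUnit y i j h) 1 τ' ∧ υ = τ'.atCell i j h := by
  refine halts_seq (halts_setIdx (halts_seq (halts_setIdx (halts_seq (halts_setIdx
    (halts_seq (halts_setIdx (halts_setIdx ⟨_, ?_, by simp [Memory.setIdx_atCell]; rfl⟩))))))))
  constructor
  · exact hτ.num
  · intro A h1 h2 h3
    have := hτ.idx A h1 h2 h3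
    simp only [Arr.code] at h1 h2 h3
    simp [h1, h2, h3, this]
  · intro i' j'
    have := hτ.alloc
    simp only [Arr.code, Memory.setIdx_idx, write_apply, and_true, Nat.reduceEqDiff, if_true,
      if_false, moveUnit, Function.update_apply] at this ⊢
    grind
  · intro i'
    have := hτ.load
    rw [load_moveUnit hih hij]
    simp only [Arr.code, Memory.setIdx_idx, write_apply, and_true, Nat.reduceEqDiff, if_true,
      if_false, Nat.succ_ne_self, Function.update_apply] at this ⊢
    grind
  · simp [write_apply]

variable {bound : Polynomial ℕ} {guard : Test} {G : (Fin n → Fin m → ℕ) → Fin n → Fin n → Prop}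
  {adj : Fin n → Fin m → Prop} {Inv : (Fin n → Fin m → ℕ) → Prop} {μ : (Fin n → Fin m → ℕ) → ℕ}

/-- A unit of chore `j` can move from agent `i` to the adjacent agent `h`, and `G` admits it. -/
def Enabled (adj : Fin n → Fin m → Prop) (G : (Fin n → Fin m → ℕ) → Fin n → Fin n → Prop)
    (y : Fin n → Fin m → ℕ) (i : Fin n) (j : Fin m) (h : Fin n) : Prop :=
  0 < y i j ∧ adj h j ∧ G y i h

/-- The hypotheses on an exchange: `guard` tests `G`, and the enabled moves preserve `Inv` and
decrease `μ`. -/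
structure ExchangeRule (σ : Memory) (guard : Test) (adj : Fin n → Fin m → Prop)
    (G : (Fin n → Fin m → ℕ) → Fin n → Fin n → Prop) (Inv : (Fin n → Fin m → ℕ) → Prop)
    (μ : (Fin n → Fin m → ℕ) → ℕ) : Prop where
  ready : Ready n m σ
  adj_iff : ∀ i j, adj i j ↔ 1 ≤ σ.idx Arr.adj i j
  guard_within : ∀ ok τ, guard.Within ok τ
  guard_holds_iff : ∀ y F τ, Exchanging σ y F τ → ∀ (i h : Fin n) (j : Fin m),
    guard.Holds (τ.atCell i j h) ↔ G y i h
  move : ∀ y i j h, Inv y → Enabled adj G y i j h →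
    i ≠ h ∧ Inv (moveUnit y i j h) ∧ μ (moveUnit y i j h) < μ y

theorem ExchangeRule.halts_sweep (hr : ExchangeRule σ guard adj G Inv μ)
    (hk : ∀ d : Dim, d.size n m ≤ k) (hy : Inv y) (hτ : Exchanging σ y 0 τ)
    (hpost : ∀ y' F τ', Exchanging σ y' F τ' → Inv y' →
      (F = 1 ∧ μ y' < μ y ∨ F = 0 ∧ y' = y ∧ ∀ i j h, ¬ Enabled adj G y i j h) → Post τ') :
    Halts ok k (sweepProg guard) τ Post := by
  let Visited (i j h : ℕ) (τ' : Memory) : Prop := ∃ y' F, Exchanging σ y' F τ' ∧ Inv y' ∧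
    (F = 1 ∧ μ y' < μ y ∨ F = 0 ∧ y' = y ∧ ∀ (i' : Fin n) (j' : Fin m) (h' : Fin n),
      (i' < i ∨ (i' : ℕ) = i ∧ (j' < j ∨ (j' : ℕ) = j ∧ h' < h)) → ¬ Enabled adj G y i' j' h')
  have hready : ∀ i j h τ', Visited i j h τ' → Ready n m τ' :=
    fun i j h τ' ⟨_, _, hτ', _⟩ => hτ'.ready hr.ready
  refine halts_forCells (J := fun i j => Visited i j 0) (K := Visited) hk (fun i j => hready i j 0)
    hready (fun i _ j _ τ' hτ' => halts_skip ⟨τ', hτ', rfl⟩) ?_ ?_ ?_ ?_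
    ⟨y, 0, hτ, hy, .inr ⟨rfl, rfl, by omega⟩⟩
  · rintro i hi j hj h hh τ' ⟨y', F, hτ', hy', hF⟩
    lift i to Fin n using hi
    lift j to Fin m using hj
    lift h to Fin n using hh
    have halloc := hτ'.alloc i j
    have hadj := hτ'.idx Arr.adj (by simp) (by simp) (by simp)
    have hiff : (Test.and (pos (.get Arr.alloc row col)) (.and (pos (.get Arr.adj layer col))
        guard)).Holds (τ'.atCell i j h) ↔ Enabled adj G y' i j h := by
      rw [Enabled, hr.adj_iff, ← hr.guard_holds_iff y' F τ' hτ' i h j, ← hadj, ← halloc]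
      simp [Nat.one_le_iff_ne_zero, Nat.pos_iff_ne_zero]
    refine halts_cond ⟨trivial, trivial, hr.guard_within ok _⟩ (fun hb => ?_) fun hb => ?_
    · obtain ⟨hih, hinv, hlt⟩ := hr.move y' i j h hy' (hiff.1 hb)
      refine (hτ'.halts_move hih (hiff.1 hb).1).mono ?_
      rintro _ ⟨υ, hυ, rfl⟩
      exact ⟨υ, ⟨_, 1, hυ, hinv, .inl ⟨rfl, hF.elim (hlt.trans ·.2) (·.2.1 ▸ hlt)⟩⟩, rfl⟩
    · refine halts_skip ⟨τ', ⟨y', F, hτ', hy', hF.imp_right fun hF => ⟨hF.1, hF.2.1, ?_⟩⟩, rfl⟩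
      intro i' j' h' hlt henabled
      by_cases heq : i' = i ∧ j' = j ∧ h' = h
      · obtain ⟨rfl, rfl, rfl⟩ := heq
        exact hb (hiff.2 (hF.2.1 ▸ henabled))
      · exact hF.2.2 i' j' h' (by omega) henabled
  · rintro i j τ' ⟨y', F, hτ', hy', hF⟩
    refine ⟨y', F, hτ', hy', hF.imp_right fun hF => ⟨hF.1, hF.2.1, fun i' j' h' hlt => ?_⟩⟩
    exact hF.2.2 i' j' h' (by simp only [Dim.size]; omega)
  · rintro i τ' ⟨y', F, hτ', hy', hF⟩
    refine ⟨y', F, hτ', hy', hF.imp_right fun hF => ⟨hF.1, hF.2.1, fun i' j' h' hlt => ?_⟩⟩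
    exact hF.2.2 i' j' h' (by simp only [Dim.size]; omega)
  · rintro τ' ⟨y', F, hτ', hy', hF⟩
    exact hpost y' F τ' hτ' hy' (hF.imp_right fun hF => ⟨hF.1, hF.2.1, fun i j h =>
      hF.2.2 i j h (.inl i.isLt)⟩)

theorem ExchangeRule.halts_exchange (hr : ExchangeRule σ guard adj G Inv μ)
    (hk : ∀ d : Dim, d.size n m ≤ k) (hy : Inv y) (hbound : μ y + 1 ≤ bound.eval k)
    (halloc : ∀ (i : Fin n) (j : Fin m), σ.idx Arr.alloc i j = y i j)
    (hload : ∀ i : Fin n, σ.idx Arr.load i 0 = load y i)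
    (hpost : ∀ y' τ, Exchanging σ y' 0 τ → Inv y' → (∀ i j h, ¬ Enabled adj G y' i j h) → Post τ) :
    Halts ok k (exchangeProg bound guard) σ Post := by
  have hσ : Exchanging σ y (σ.idx Arr.moved 0 0) σ :=
    ⟨rfl, fun _ _ _ _ => rfl, halloc, hload, rfl⟩
  let potential (τ : Memory) : ℕ :=
    μ (fun i j => τ.idx Arr.alloc i j) + τ.idx Arr.moved 0 0
  have hpotential : ∀ y' F τ, Exchanging σ y' F τ → potential τ = μ y' + F := fun y' F τ hτ => by
    simp only [potential, hτ.alloc, hτ.moved]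
  have htest : ∀ (y' : Fin n → Fin m → ℕ) F τ, Exchanging σ y' F τ →
      ((pos (scalar Arr.moved)).Holds τ ↔ 1 ≤ F) := fun y' F τ hτ => by rw [← hτ.moved]; rfl
  refine halts_seq (halts_setIdx (halts_loop (I := fun τ => ∃ y' F, Exchanging σ y' F τ ∧ Inv y' ∧
    (F = 1 ∨ F = 0 ∧ ∀ i j h, ¬ Enabled adj G y' i j h)) potential
    (fun _ _ => trivial) ?_ ?_ ⟨y, 1, hσ.setMoved 1, hy, .inl rfl⟩ ?_))
  · rintro τ ⟨y', F, hτ, hy', hF⟩ hb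
    rw [htest y' F τ hτ] at hb
    obtain rfl : F = 1 := hF.elim id fun h => by omega
    refine halts_seq (halts_setIdx (hr.halts_sweep hk hy' (hτ.setMoved 0) ?_))
    intro y'' F τ' hτ' hy'' hF
    refine ⟨⟨y'', F, hτ', hy'', hF.imp And.left
      fun ⟨hzero, heq, hstuck⟩ => ⟨hzero, heq ▸ hstuck⟩⟩, ?_⟩
    rw [hpotential _ _ _ hτ, hpotential _ _ _ hτ']
    rcases hF with ⟨rfl, hlt⟩ | ⟨rfl, rfl, -⟩ <;> omega
  · rintro τ ⟨y', F, hτ, hy', hF⟩ hb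
    rw [htest y' F τ hτ] at hb
    rcases hF with rfl | ⟨rfl, hstuck⟩
    · exact absurd le_rfl hb
    · exact hpost y' τ hτ hy' hstuck
  · exact (hpotential y 1 _ (hσ.setMoved 1)).trans_le hbound

end Exchange

section Tests

variable {ok : ℝ → Prop} {k n m A : ℕ} {σ : Memory} {Post : Memory → Prop} {R C L : Dim}

/-- The test that always succeeds. -/
def always : Test := .idxLe (.lit 0) (.lit 0)

/-- Equality of indices. -/
def idxEq (e f : IExpr) : Test := .and (.idxLe e f) (.idxLe f e)

/-- Strict comparison of indices. -/
def idxLt (e f : IExpr) : Test := .not (.idxLe f e)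

@[simp]
theorem always_holds (σ : Memory) : always.Holds σ := le_rfl

@[simp]
theorem idxEq_holds (e f : IExpr) : (idxEq e f).Holds σ ↔ e.eval σ = f.eval σ :=
  le_antisymm_iff.symm

@[simp]
theorem idxLt_holds (e f : IExpr) : (idxLt e f).Holds σ ↔ e.eval σ < f.eval σ := not_le

/-- Sets every cell of index array `A` to the number of layers where `b` holds. -/
noncomputable def countIdx (A : ℕ) (R C L : Dim) (b : Test) : TimedProgram :=
  sumIdx A R C L b (.lit 1)

theorem halts_countIdx {b : Test} (hk : ∀ d : Dim, d.size n m ≤ k) (hσ : Ready n m σ)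
    (hA : 4 ≤ A) (hb : ∀ τ : Memory, τ.num = σ.num → b.Within ok τ)
    (hbA : ∀ f i j l, b.Holds ((σ.putIdx A f).atCell i j l) ↔ b.Holds (σ.atCell i j l))
    (hpost : ∀ f, (∀ i < R.size n m, ∀ j < C.size n m, ∀ P : Fin (L.size n m) → Prop,
      (∀ l : Fin (L.size n m), b.Holds (σ.atCell i j l) ↔ P l) →
        ∀ {_ : Fintype {l // P l}}, f i j = Fintype.card {l // P l}) → Post (σ.putIdx A f)) :
    Halts ok k (countIdx A R C L b) σ Post := by
  classical
  refine halts_sumIdx hk hσ hA hb hbA (fun _ _ _ _ => rfl) fun f hf =>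
    hpost f fun i hi j hj P hP _ => (hf i hi j hj).trans ?_
  simp only [hP, IExpr.eval]
  rw [Fintype.card_subtype, Finset.card_filter]

/-- Stores in index array `A` in which cells `b` holds, as positive entries. -/
noncomputable def flagIdx (A : ℕ) (R C : Dim) (b : Test) : TimedProgram := countIdx A R C .one b

theorem halts_flagIdx {b : Test} (hk : ∀ d : Dim, d.size n m ≤ k) (hσ : Ready n m σ)
    (hA : 4 ≤ A) (hb : ∀ τ : Memory, τ.num = σ.num → b.Within ok τ)
    (hbA : ∀ f i j l, b.Holds ((σ.putIdx A f).atCell i j l) ↔ b.Holds (σ.atCell i j l))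
    (hpost : ∀ f, (∀ i < R.size n m, ∀ j < C.size n m, 1 ≤ f i j ↔ b.Holds (σ.atCell i j 0)) →
      Post (σ.putIdx A f)) :
    Halts ok k (flagIdx A R C b) σ Post := by
  classical
  refine halts_countIdx hk hσ hA hb hbA fun f hf => hpost f fun i hi j hj => ?_
  rw [hf i hi j hj (fun _ => b.Holds (σ.atCell i j 0)) (by simp), Nat.one_le_iff_ne_zero,
    ← Nat.pos_iff_ne_zero, Fintype.card_pos_iff, nonempty_subtype, exists_const]

end Tests

section Distribute

open Chores

variable {ok : ℝ → Prop} {k n m : ℕ} {σ : Memory} {Post : Memory → Prop}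
  {adj : Fin n → Fin m → Prop} {u : Fin m → ℕ}

/-- Assigns all units of every chore to the last adjacent agent. -/
noncomputable def distributeProg : TimedProgram :=
  fillIdx Arr.holder .chores .one .agents (.lit 0) (pos (.get Arr.adj layer row)) layer ⨟
  sumIdx Arr.alloc .agents .chores .one
    (.and (pos (.get Arr.adj row col)) (idxEq (vec Arr.holder col) row)) (vec Arr.units col) ⨟
  sumIdx Arr.load .agents .one .chores always (.get Arr.alloc row layer)

theorem assigns_of_holder [∀ i j, Decidable (adj i j)] {holder : Fin m → ℕ}
    (hholder : ∀ j, (∃ i, adj i j) → ∃ i, adj i j ∧ holder j = i) :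
    Assigns adj u fun i j => if adj i j ∧ holder j = i then u j else 0 where
  adj_of_pos i j h := by
    by_contra hij
    simp [hij] at h
  sum_eq j hj := by
    obtain ⟨i, hij, hi⟩ := hholder j hj
    rw [Finset.sum_eq_single i (fun h _ hne => ?_) (by simp), if_pos ⟨hij, hi⟩]
    exact if_neg fun hh => hne (Fin.ext (hh.2.symm.trans hi))

theorem halts_distribute (hk : ∀ d : Dim, d.size n m ≤ k) (hσ : Ready n m σ)
    (hadj : ∀ i j, adj i j ↔ 1 ≤ σ.idx Arr.adj i j)
    (hu : ∀ j : Fin m, σ.idx Arr.units j 0 = u j)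
    (hpost : ∀ holder alloc ld (y : Fin n → Fin m → ℕ), Assigns adj u y →
      (∀ (i : Fin n) (j : Fin m), alloc i j = y i j) → (∀ i : Fin n, ld i 0 = load y i) →
      Post (((σ.putIdx Arr.holder holder).putIdx Arr.alloc alloc).putIdx Arr.load ld)) :
    Halts ok k distributeProg σ Post := by
  classical
  refine halts_seq (halts_fillIdx (Cell := fun j _ l v => ∀ i < l, 1 ≤ σ.idx Arr.adj i j →
    v < l ∧ 1 ≤ σ.idx Arr.adj v j) hk hσ (by simp) (fun _ _ => trivial) (by simp) ?_ ?_ ?_)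
  · simp +contextual
  · intro f j _ _ _ l _ hf hnot i hi hij
    have hne : i ≠ l := by
      rintro rfl
      exact absurd hij (by simpa using hnot)
    obtain ⟨hv, hv'⟩ := hf i (by omega) hij
    exact ⟨by omega, hv'⟩
  intro holder hholder
  have hσ' := hσ.putIdx (A := Arr.holder) (by simp) holder
  refine halts_seq (halts_sumIdx hk hσ' (by simp) (fun _ _ => ⟨trivial, trivial, trivial⟩)
    (by simp) (by simp) fun alloc halloc => ?_)
  refine halts_sumIdx hk (hσ'.putIdx (by simp) alloc) (by simp) (fun _ _ => trivial) (by simp)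
    (by simp) fun ld hld => ?_
  have hy : ∀ (i : Fin n) (j : Fin m),
      alloc i j = if adj i j ∧ holder j 0 = i then u j else 0 := fun i j => by
    rw [halloc i i.isLt j j.isLt, hadj, ← hu]
    simp [le_antisymm_iff]
  refine hpost holder alloc ld _ (assigns_of_holder (holder := fun j => holder j 0) ?_) hy ?_
  · rintro j ⟨i, hij⟩
    obtain ⟨hlt, hpos⟩ := hholder j j.isLt 0 one_pos i i.isLt ((hadj i j).1 hij)
    exact ⟨⟨_, hlt⟩, (hadj ⟨_, hlt⟩ j).2 hpos, rfl⟩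
  · intro i
    rw [hld i i.isLt 0 one_pos]
    simp [load, hy]

end Distribute

section Stabilize

open Chores Polynomial

variable {ok : ℝ → Prop} {k n m : ℕ} {σ : Memory} {Post : Memory → Prop}
  {adj : Fin n → Fin m → Prop}

/-- Splits every chore into `n * (n * n + 1)` units, and stores this number for each of them. -/
noncomputable def splitProg : TimedProgram :=
  sumIdx Arr.quota .one .one .agents always Dim.agents.expr ⨟
  sumIdx Arr.units .chores .one .agents always (.add (scalar Arr.quota) (.lit 1))

theorem halts_split (hk : ∀ d : Dim, d.size n m ≤ k) (hσ : Ready n m σ)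
    (hpost : ∀ quota units, (∀ j : Fin m, units j 0 = n * (n * n + 1)) →
      Post ((σ.putIdx Arr.quota quota).putIdx Arr.units units)) :
    Halts ok k splitProg σ Post := by
  refine halts_seq (halts_sumIdx hk hσ (by simp) (fun _ _ => trivial) (by simp)
    (by simp [Dim.expr]) fun quota hquota => ?_)
  refine halts_sumIdx hk (hσ.putIdx (by simp) quota) (by simp) (fun _ _ => trivial) (by simp)
    (by simp) fun units hunits => hpost quota units fun j => ?_
  have hn : quota 0 0 = n * n := by
    simpa [Dim.expr, hσ.agents] using hquota 0 one_pos 0 one_pos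
  simpa [hn] using hunits j j.isLt 0 one_pos

/-- The giver's load exceeds the receiver's by at least two. -/
def levelGuard : Test := .idxLe (.add (vec Arr.load layer) (.lit 2)) (vec Arr.load row)

theorem exchangeRule_level (hσ : Ready n m σ) (hadj : ∀ i j, adj i j ↔ 1 ≤ σ.idx Arr.adj i j)
    (u : Fin m → ℕ) :
    ExchangeRule σ levelGuard adj (fun y i h => load y h + 2 ≤ load y i) (Assigns adj u)
      fun y => ∑ i, load y i ^ 2 where
  ready := hσ
  adj_iff := hadj
  guard_within _ _ := trivial
  guard_holds_iff y F τ hτ i h j := by simp [levelGuard, ← hτ.load]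
  move := by
    rintro y i j h hy ⟨hij, hhj, hlt⟩
    have hih : i ≠ h := by
      rintro rfl
      omega
    exact ⟨hih, hy.moveUnit hih hij hhj, sum_sq_load_moveUnit_lt hij hlt⟩

/-- Assigns units of every chore to adjacent agents until no agent could profitably pass a unit
on. -/
noncomputable def stabilizeProg : TimedProgram :=
  splitProg ⨟ distributeProg ⨟ exchangeProg ((X * (X * (X * X + 1))) ^ 2 + 1) levelGuard

theorem halts_stabilize (hk : ∀ d : Dim, d.size n m ≤ k) (hσ : Ready n m σ)
    (hadj : ∀ i j, adj i j ↔ 1 ≤ σ.idx Arr.adj i j)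
    (hpost : ∀ τ (y : Fin n → Fin m → ℕ), Ready n m τ → τ.num = σ.num →
      τ.idx Arr.adj = σ.idx Arr.adj → (∀ i : Fin n, τ.idx Arr.load i 0 = load y i) →
      Assigns adj (fun _ => n * (n * n + 1)) y → Stable adj y → Post τ) :
    Halts ok k stabilizeProg σ Post := by
  refine halts_seq (halts_split hk hσ fun quota units hu => ?_)
  have hσ₁ := (hσ.putIdx (A := Arr.quota) (by simp) quota).putIdx (A := Arr.units) (by simp) units
  refine halts_seq (halts_distribute hk hσ₁ (adj := adj) (by simpa using hadj) (by simpa using hu)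
    fun holder alloc ld y hy halloc hload => ?_)
  have hσ₂ := ((hσ₁.putIdx (A := Arr.holder) (by simp) holder).putIdx (A := Arr.alloc)
    (by simp) alloc).putIdx (A := Arr.load) (by simp) ld
  refine (exchangeRule_level hσ₂ (adj := adj) (by simpa using hadj) _).halts_exchange hk hy ?_
    (by simpa using halloc) (by simpa using hload) fun y' τ hτ hy' hstuck => ?_
  · have hn : n ≤ k := hk .agents
    have hm : m ≤ k := hk .chores
    simp only [eval_add, eval_pow, eval_mul, eval_X, eval_one]
    gcongr
    calc ∑ i, load y i ^ 2 ≤ (∑ i, load y i) ^ 2 :=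
          Finset.sum_sq_le_sq_sum_of_nonneg fun i _ => Nat.zero_le _
      _ ≤ (m * (n * (n * n + 1))) ^ 2 := by
          gcongr
          simpa using hy.sum_load_le
      _ ≤ (k * (k * (k * k + 1))) ^ 2 := by gcongr
  · refine hpost τ y' (hτ.ready hσ₂) (by simp [hτ.num]) ?_ hτ.load hy' fun i j h hij hhj => ?_
    · simpa using hτ.idx Arr.adj (by simp) (by simp) (by simp)
    · have := hstuck i j h
      simp only [Enabled, hij, hhj, true_and] at this
      omega

end Stabilize

section Classes

open Chores

variable {ok : ℝ → Prop} {k n m : ℕ} {σ : Memory} {Post : Memory → Prop}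
  {adj : Fin n → Fin m → Prop} {g : Fin n → ℕ}

/-- Computes the ranks of all agents. -/
noncomputable def rankProg : TimedProgram :=
  countIdx Arr.gap .agents .one .agents
    (idxEq (.add (vec Arr.load layer) (.lit 1)) (vec Arr.load row)) ⨟
  countIdx Arr.rank .agents .one .agents
    (.and (idxLt (vec Arr.load row) (vec Arr.load layer)) (.not (pos (vec Arr.gap layer))))

theorem halts_rank (hk : ∀ d : Dim, d.size n m ≤ k) (hσ : Ready n m σ)
    (hg : ∀ i : Fin n, σ.idx Arr.load i 0 = g i)
    (hpost : ∀ gap rk, (∀ i : Fin n, rk i 0 = rank g i) →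
      Post ((σ.putIdx Arr.gap gap).putIdx Arr.rank rk)) :
    Halts ok k rankProg σ Post := by
  refine halts_seq (halts_countIdx hk hσ (by simp) (fun _ _ => ⟨trivial, trivial⟩) (by simp)
    fun gap hgap => ?_)
  refine halts_countIdx hk (hσ.putIdx (by simp) gap) (by simp) (fun _ _ => ⟨trivial, trivial⟩)
    (by simp) fun rk hrk => hpost gap rk fun i => ?_
  have hgap : ∀ t : Fin n, gap t 0 = 0 ↔ ∀ h, g h + 1 ≠ g t := fun t => by
    rw [hgap t t.isLt 0 one_pos (fun h => g h + 1 = g t) (by simp [← hg]), Fintype.card_eq_zero_iff,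
      isEmpty_subtype]
  exact hrk i i.isLt 0 one_pos _ fun t => by simp [hgap, ← hg]

/-- Computes the ranks of all chores. -/
noncomputable def choreRankProg : TimedProgram :=
  fillIdx Arr.choreRank .chores .one .agents (.lit 0)
    (.and (pos (.get Arr.adj layer row))
      (idxLt (vec Arr.choreRank row) (.add (vec Arr.rank layer) (.lit 1))))
    (.add (vec Arr.rank layer) (.lit 1))

theorem halts_choreRank [∀ i j, Decidable (adj i j)] (hk : ∀ d : Dim, d.size n m ≤ k)
    (hσ : Ready n m σ) (hadj : ∀ i j, adj i j ↔ 1 ≤ σ.idx Arr.adj i j)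
    (hrank : ∀ i : Fin n, σ.idx Arr.rank i 0 = rank g i)
    (hpost : ∀ f, (∀ j : Fin m, f j 0 = choreRank adj g j) → Post (σ.putIdx Arr.choreRank f)) :
    Halts ok k choreRankProg σ Post := by
  refine halts_fillIdx (Cell := fun j _ l v => ∀ w, v ≤ w ↔
    ∀ i < l, 1 ≤ σ.idx Arr.adj i j → σ.idx Arr.rank i 0 + 1 ≤ w) hk hσ (by simp)
    (fun _ _ => ⟨trivial, trivial⟩) (by simp) ?_ ?_ fun f hf => hpost f fun j => ?_
  · rintro f j - c hc l - hf ⟨hpos, hlt⟩ w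
    obtain rfl := Nat.lt_one_iff.1 hc
    simp only [Nat.forall_lt_succ_right, ← hf w]
    have hpos : 1 ≤ σ.idx Arr.adj l j := by simpa using hpos
    have hlt : f j 0 ≤ σ.idx Arr.rank l 0 := by simpa using hlt
    suffices σ.idx Arr.rank l 0 + 1 ≤ w ↔
        f j 0 ≤ w ∧ (1 ≤ σ.idx Arr.adj l j → σ.idx Arr.rank l 0 + 1 ≤ w) by simpa
    omega
  · intro f j _ c hc l _ hf hb w
    obtain rfl := Nat.lt_one_iff.1 hc
    simp only [Nat.forall_lt_succ_right, ← hf w]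
    have hb : 1 ≤ σ.idx Arr.adj l j → σ.idx Arr.rank l 0 < f j 0 := by simpa using hb
    omega
  · refine eq_of_forall_ge_iff fun w => ?_
    rw [hf j j.isLt 0 one_pos, choreRank, Finset.sup_le_iff]
    simp [Fin.forall_iff, hadj, ← hrank]

/-- Restricts the adjacency to the agents of largest rank. -/
noncomputable def classAdjProg : TimedProgram :=
  flagIdx Arr.next .agents .chores (.and (pos (.get Arr.adj row col))
    (idxEq (.add (vec Arr.rank row) (.lit 1)) (vec Arr.choreRank col))) ⨟
  flagIdx Arr.adj .agents .chores (pos (.get Arr.next row col))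

/-- Computes the sizes of the classes. -/
noncomputable def classSizeProg : TimedProgram :=
  countIdx Arr.size .agents .one .agents (idxEq (vec Arr.rank layer) (vec Arr.rank row)) ⨟
  countIdx Arr.cap .agents .one .chores
    (idxEq (vec Arr.choreRank layer) (.add (vec Arr.rank row) (.lit 1))) ⨟
  countIdx Arr.units .chores .one .agents
    (idxEq (.add (vec Arr.rank layer) (.lit 1)) (vec Arr.choreRank row))

variable [∀ i j, Decidable (adj i j)]

theorem halts_classAdj (hk : ∀ d : Dim, d.size n m ≤ k)
    (hσ : Ready n m σ) (hadj : ∀ i j, adj i j ↔ 1 ≤ σ.idx Arr.adj i j)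
    (hrank : ∀ i : Fin n, σ.idx Arr.rank i 0 = rank g i)
    (hchore : ∀ j : Fin m, σ.idx Arr.choreRank j 0 = choreRank adj g j)
    (hpost : ∀ next f, (∀ i j, classAdj adj g i j ↔ 1 ≤ f i j) →
      Post ((σ.putIdx Arr.next next).putIdx Arr.adj f)) :
    Halts ok k classAdjProg σ Post := by
  refine halts_seq (halts_flagIdx hk hσ (by simp) (fun _ _ => ⟨trivial, trivial, trivial⟩) (by simp)
    fun next hnext => ?_)
  refine halts_flagIdx hk (hσ.putIdx (by simp) next) (by simp) (fun _ _ => trivial) (by simp)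
    fun f hf => hpost next f fun i j => ?_
  rw [hf i i.isLt j j.isLt, classAdj, hadj, ← hrank, ← hchore]
  simpa using (hnext i i.isLt j j.isLt).symm

theorem halts_classSize (hk : ∀ d : Dim, d.size n m ≤ k) (hσ : Ready n m σ)
    (hrank : ∀ i : Fin n, σ.idx Arr.rank i 0 = rank g i)
    (hchore : ∀ j : Fin m, σ.idx Arr.choreRank j 0 = choreRank adj g j)
    (hpost : ∀ size cap units, (∀ i : Fin n, size i 0 = classAgents g i) →
      (∀ i : Fin n, cap i 0 = classChores adj g i) →
      (∀ j : Fin m, units j 0 = choreAgents adj g j) →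
      Post (((σ.putIdx Arr.size size).putIdx Arr.cap cap).putIdx Arr.units units)) :
    Halts ok k classSizeProg σ Post := by
  refine halts_seq (halts_countIdx hk hσ (by simp) (fun _ _ => ⟨trivial, trivial⟩) (by simp)
    fun size hsize => ?_)
  have hσ' := hσ.putIdx (A := Arr.size) (by simp) size
  refine halts_seq (halts_countIdx hk hσ' (by simp) (fun _ _ => ⟨trivial, trivial⟩) (by simp)
    fun cap hcap => ?_)
  refine halts_countIdx hk (hσ'.putIdx (by simp) cap) (by simp) (fun _ _ => ⟨trivial, trivial⟩)
    (by simp) fun units hunits => hpost size cap units (fun i => ?_) (fun i => ?_) fun j => ?_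
  · exact hsize i i.isLt 0 one_pos _ fun l => by simp [← hrank]
  · exact hcap i i.isLt 0 one_pos _ fun l => by simp [← hrank, ← hchore]
  · exact hunits j j.isLt 0 one_pos _ fun l => by simp [← hrank, ← hchore]

/-- Turns the assignment problem into the one for the classes. -/
noncomputable def classesProg : TimedProgram :=
  rankProg ⨟ choreRankProg ⨟ classAdjProg ⨟ classSizeProg

theorem halts_classes (hk : ∀ d : Dim, d.size n m ≤ k) (hσ : Ready n m σ)
    (hadj : ∀ i j, adj i j ↔ 1 ≤ σ.idx Arr.adj i j)
    (hg : ∀ i : Fin n, σ.idx Arr.load i 0 = g i)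
    (hpost : ∀ τ, Ready n m τ → τ.num = σ.num →
      (∀ i j, classAdj adj g i j ↔ 1 ≤ τ.idx Arr.adj i j) →
      (∀ i : Fin n, τ.idx Arr.size i 0 = classAgents g i) →
      (∀ i : Fin n, τ.idx Arr.cap i 0 = classChores adj g i) →
      (∀ j : Fin m, τ.idx Arr.units j 0 = choreAgents adj g j) → Post τ) :
    Halts ok k classesProg σ Post := by
  refine halts_seq (halts_rank hk hσ hg fun gap rk hrank => ?_)
  have hσ₁ := (hσ.putIdx (A := Arr.gap) (by simp) gap).putIdx (A := Arr.rank) (by simp) rk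
  refine halts_seq (halts_choreRank hk hσ₁ (adj := adj) (g := g) (by simpa using hadj)
    (by simpa using hrank) fun crk hchore => ?_)
  have hσ₂ := hσ₁.putIdx (A := Arr.choreRank) (by simp) crk
  refine halts_seq (halts_classAdj hk hσ₂ (adj := adj) (g := g) (by simpa using hadj)
    (by simpa using hrank) (by simpa using hchore) fun next f hclass => ?_)
  have hσ₃ := (hσ₂.putIdx (A := Arr.next) (by simp) next).putIdx (A := Arr.adj) (by simp) f
  refine halts_classSize hk hσ₃ (adj := adj) (g := g) (by simpa using hrank)
    (by simpa using hchore) fun size cap units hsize hcap hunits => ?_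
  refine hpost _ (((hσ₃.putIdx (by simp) size).putIdx (by simp) cap).putIdx (by simp) units) rfl
    ?_ ?_ ?_ ?_
  · simpa using hclass
  · simpa using hsize
  · simpa using hcap
  · simpa using hunits

end Classes

section Transport

open Chores Polynomial

variable {ok : ℝ → Prop} {k n m : ℕ} {σ τ : Memory} {Post : Memory → Prop}
  {adj : Fin n → Fin m → Prop} {u : Fin m → ℕ} {cap : Fin n → ℕ} {y : Fin n → Fin m → ℕ}
  {H : Fin n → ℕ}

/-- A memory that holds the adjacency `adj`, the capacities `cap`, the allocation `y`, with its
loads, and the heights `H`, and whose numbers and class sizes are those of `σ`. -/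
structure Pushing (σ : Memory) (adj : Fin n → Fin m → Prop) (cap : Fin n → ℕ)
    (y : Fin n → Fin m → ℕ) (H : Fin n → ℕ) (τ : Memory) : Prop where
  ready : Ready n m τ
  num : τ.num = σ.num
  adj_iff : ∀ i j, adj i j ↔ 1 ≤ τ.idx Arr.adj i j
  cap : ∀ i : Fin n, τ.idx Arr.cap i 0 = cap i
  size : τ.idx Arr.size = σ.idx Arr.size
  alloc : ∀ (i : Fin n) (j : Fin m), τ.idx Arr.alloc i j = y i j
  load : ∀ i : Fin n, τ.idx Arr.load i 0 = load y i
  height : ∀ i : Fin n, τ.idx Arr.height i 0 = H i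

/-- The giver exceeds its capacity and is higher than the receiver. -/
def pushGuard : Test :=
  .and (idxLt (vec Arr.cap row) (vec Arr.load row))
    (idxLt (vec Arr.height layer) (vec Arr.height row))

theorem Pushing.exchangeRule (hτ : Pushing σ adj cap y H τ) :
    ExchangeRule τ pushGuard adj (fun y i h => cap i < Chores.load y i ∧ H h < H i)
      (fun y => Preflow adj u cap y H) fun y => ∑ i, Chores.load y i * H i where
  ready := hτ.ready
  adj_iff := hτ.adj_iff
  guard_within _ _ := ⟨trivial, trivial⟩
  guard_holds_iff y' F τ' hτ' i h j := by
    rw [← hτ.cap, ← hτ.height, ← hτ.height, ← hτ'.load,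
      ← hτ'.idx Arr.cap (by simp) (by simp) (by simp),
      ← hτ'.idx Arr.height (by simp) (by simp) (by simp)]
    simp [pushGuard]
  move := by
    rintro y i j h hy ⟨hij, hhj, hi, hlt⟩
    exact ⟨fun h => (h ▸ hlt).false, hy.moveUnit hi hlt hij hhj, sum_load_mul_moveUnit_lt hij hlt⟩

theorem Pushing.halts_exchange (hk : ∀ d : Dim, d.size n m ≤ k)
    (hτ : Pushing σ adj cap y H τ) (hu : ∀ j, u j ≤ n)
    (hy : Preflow adj u cap y H)
    (hpost : ∀ y' τ', Pushing σ adj cap y' H τ' → Preflow adj u cap y' H →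
      (∀ i j h, cap i < Chores.load y' i → H h < H i → 0 < y' i j → ¬ adj h j) → Post τ') :
    Halts ok k (exchangeProg (X * X * X + 1) pushGuard) τ Post := by
  refine hτ.exchangeRule.halts_exchange hk hy ?_ hτ.alloc hτ.load
    fun y' τ' hτ' hy' hstuck => ?_
  · have hn : n ≤ k := hk .agents
    have hm : m ≤ k := hk .chores
    simp only [eval_add, eval_mul, eval_X, eval_one]
    gcongr
    calc ∑ i, Chores.load y i * H i ≤ (∑ j, u j) * n := by
          simpa using hy.sum_load_mul_height_le
      _ ≤ (m * n) * n := by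
          gcongr
          simpa using Finset.sum_le_sum fun j (_ : j ∈ Finset.univ) => hu j
      _ ≤ k * k * k := by gcongr
  · have hidx (A : ℕ) (h1 : A ≠ Arr.alloc) (h2 : A ≠ Arr.load) (h3 : A ≠ Arr.moved) (i j : ℕ) :
        τ'.idx A i j = τ.idx A i j := by rw [hτ'.idx A h1 h2 h3]
    refine hpost y' τ' ⟨hτ'.ready hτ.ready, hτ'.num.trans hτ.num, fun i j => ?_, fun i => ?_, ?_,
      hτ'.alloc, hτ'.load, fun i => ?_⟩ hy' fun i j h hi hlt hij hhj =>
        hstuck i j h ⟨hij, hhj, hi, hlt⟩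
    · rw [hidx _ (by simp) (by simp) (by simp), hτ.adj_iff]
    · rw [hidx _ (by simp) (by simp) (by simp), hτ.cap]
    · rw [hτ'.idx _ (by simp) (by simp) (by simp), hτ.size]
    · rw [hidx _ (by simp) (by simp) (by simp), hτ.height]

/-- Raises all agents that exceed their capacity. -/
noncomputable def raiseProg : TimedProgram :=
  fillIdx Arr.next .agents .one .one (vec Arr.height row)
    (idxLt (vec Arr.cap row) (vec Arr.load row)) (.add (vec Arr.height row) (.lit 1)) ⨟
  sumIdx Arr.height .agents .one .one always (vec Arr.next row)

theorem Pushing.halts_raise (hk : ∀ d : Dim, d.size n m ≤ k) (hτ : Pushing σ adj cap y H τ)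
    (hpost : ∀ τ', Pushing σ adj cap y (raise cap (Chores.load y) H) τ' → Post τ') :
    Halts ok k raiseProg τ Post := by
  refine halts_seq (halts_fillIdx (Cell := fun i _ l v => v = if 0 < l ∧ τ.idx Arr.cap i 0 <
    τ.idx Arr.load i 0 then τ.idx Arr.height i 0 + 1 else τ.idx Arr.height i 0)
    hk hτ.ready (by simp) (fun _ _ => trivial) (by simp) (by simp +contextual) ?_
    fun next hnext => ?_)
  · intro f i _ j _ l hl hf hb
    obtain rfl := Nat.lt_one_iff.1 hl
    simpa [hf] using hb
  have hτ' := hτ.ready.putIdx (A := Arr.next) (by simp) next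
  refine halts_sumIdx hk hτ' (by simp) (fun _ _ => trivial) (by simp) (by simp) fun f hf => ?_
  refine hpost _ ⟨hτ'.putIdx (by simp) f, hτ.num, ?_, ?_, ?_, ?_, ?_, fun i => ?_⟩
  · simpa using hτ.adj_iff
  · simpa using hτ.cap
  · simpa using hτ.size
  · simpa using hτ.alloc
  · simpa using hτ.load
  · have hf := hf i i.isLt 0 one_pos
    have hnext := hnext i i.isLt 0 one_pos
    rw [hτ.height, hτ.load, hτ.cap] at hnext
    simpa [raise, hnext] using hf

/-- Counts the agents that exceed their capacity. -/
noncomputable def countExcessProg : TimedProgram :=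
  countIdx Arr.excess .one .one .agents (idxLt (vec Arr.cap layer) (vec Arr.load layer))

theorem Pushing.halts_countExcess (hk : ∀ d : Dim, d.size n m ≤ k) (hτ : Pushing σ adj cap y H τ)
    (hpost : ∀ τ', Pushing σ adj cap y H τ' →
      (1 ≤ τ'.idx Arr.excess 0 0 ↔ ∃ i, cap i < Chores.load y i) → Post τ') :
    Halts ok k countExcessProg τ Post := by
  refine halts_countIdx hk hτ.ready (by simp) (fun _ _ => trivial) (by simp) fun f hf => ?_
  refine hpost _ ⟨hτ.ready.putIdx (by simp) f, hτ.num, ?_, ?_, ?_, ?_, ?_, ?_⟩ ?_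
  · simpa using hτ.adj_iff
  · simpa using hτ.cap
  · simpa using hτ.size
  · simpa using hτ.alloc
  · simpa using hτ.load
  · simpa using hτ.height
  · have hcount : f 0 0 = Fintype.card {i // cap i < Chores.load y i} :=
      hf 0 one_pos 0 one_pos _ (by simp [← hτ.cap, ← hτ.load])
    simp [hcount, Nat.one_le_iff_ne_zero, ← Nat.pos_iff_ne_zero, Fintype.card_pos_iff]

/-- Moves units downhill, out of the agents that exceed their capacity, until this is no longer
possible. -/
noncomputable def pushProg : TimedProgram :=
  exchangeProg (X * X * X + 1) pushGuard ⨟ countExcessProg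

/-- The state after pushing: no unit can move downhill out of an agent that exceeds its capacity. -/
structure Pushed (σ : Memory) (adj : Fin n → Fin m → Prop) (u : Fin m → ℕ) (cap : Fin n → ℕ)
    (y : Fin n → Fin m → ℕ) (H : Fin n → ℕ) (τ : Memory) : Prop where
  pushing : Pushing σ adj cap y H τ
  preflow : Preflow adj u cap y H
  stuck : ∀ i j h, cap i < Chores.load y i → H h < H i → 0 < y i j → ¬ adj h j
  excess : 1 ≤ τ.idx Arr.excess 0 0 ↔ ∃ i, cap i < Chores.load y i

theorem Pushing.halts_push (hk : ∀ d : Dim, d.size n m ≤ k) (hτ : Pushing σ adj cap y H τ)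
    (hu : ∀ j, u j ≤ n) (hy : Preflow adj u cap y H)
    (hpost : ∀ y' τ', Pushed σ adj u cap y' H τ' → Post τ') : Halts ok k pushProg τ Post :=
  halts_seq (hτ.halts_exchange hk hu hy fun y' _ hτ₁ hy' hstuck =>
    hτ₁.halts_countExcess hk fun τ₂ hτ₂ hexcess => hpost y' τ₂ ⟨hτ₂, hy', hstuck, hexcess⟩)

/-- Raises and pushes until no agent exceeds its capacity. -/
noncomputable def relabelProg : TimedProgram :=
  .loop (X * X) (pos (scalar Arr.excess)) (raiseProg ⨟ pushProg)

theorem Pushed.halts_relabel (hk : ∀ d : Dim, d.size n m ≤ k) (hτ : Pushed σ adj u cap y H τ)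
    (hall : HallCondition adj u cap) (hu : ∀ j, u j ≤ n)
    (hpost : ∀ τ' y' H', Pushing σ adj cap y' H' τ' → Assigns adj u y' →
      (∀ i, Chores.load y' i ≤ cap i) → Post τ') :
    Halts ok k relabelProg τ Post := by
  refine halts_loop (I := fun τ => ∃ y H, Pushed σ adj u cap y H τ)
    (fun τ => n * n - ∑ i : Fin n, τ.idx Arr.height i 0) (fun _ _ => trivial) ?_ ?_ ⟨y, H, hτ⟩ ?_
  · rintro τ ⟨y, H, hτ⟩ hb
    refine halts_seq (hτ.pushing.halts_raise hk fun τ₁ hτ₁ => ?_)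
    have hraised := hτ.preflow.raise hall hτ.stuck
    refine hτ₁.halts_push hk hu hraised fun y' τ₂ hτ₂ => ⟨⟨y', _, hτ₂⟩, ?_⟩
    obtain ⟨i, hi⟩ := hτ.excess.1 hb
    have hlt := sum_lt_sum_raise (H := H) hi
    have hle : ∑ i, Chores.raise cap (Chores.load y) H i ≤ n * n := by
      simpa using Finset.sum_le_card_nsmul Finset.univ _ _ fun i _ => hraised.height_le_card i
    simp only [hτ.pushing.height, hτ₂.pushing.height]
    omega
  · rintro τ ⟨y, H, hτ⟩ hb
    refine hpost τ y H hτ.pushing hτ.preflow.assigns fun i => ?_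
    by_contra! hi
    exact hb (hτ.excess.2 ⟨i, hi⟩)
  · have hn : n ≤ k := hk .agents
    simp only [eval_mul, eval_X]
    exact (Nat.sub_le _ _).trans (Nat.mul_le_mul hn hn)

/-- Assigns the units without exceeding capacities, by the push-relabel method. -/
noncomputable def transportProg : TimedProgram :=
  distributeProg ⨟ sumIdx Arr.height .agents .one .one always (.lit 0) ⨟ pushProg ⨟ relabelProg

theorem halts_transport (hk : ∀ d : Dim, d.size n m ≤ k) (hσ : Ready n m σ)
    (hadj : ∀ i j, adj i j ↔ 1 ≤ σ.idx Arr.adj i j)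
    (hunits : ∀ j : Fin m, σ.idx Arr.units j 0 = u j)
    (hcap : ∀ i : Fin n, σ.idx Arr.cap i 0 = cap i) (hall : HallCondition adj u cap)
    (hu : ∀ j, u j ≤ n)
    (hpost : ∀ τ z H, Pushing σ adj cap z H τ → Assigns adj u z →
      (∀ i, Chores.load z i ≤ cap i) → Post τ) :
    Halts ok k transportProg σ Post := by
  refine halts_seq (halts_distribute hk hσ hadj hunits fun holder alloc ld y hy halloc hload => ?_)
  have hσ₁ := ((hσ.putIdx (A := Arr.holder) (by simp) holder).putIdx (A := Arr.alloc)
    (by simp) alloc).putIdx (A := Arr.load) (by simp) ld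
  refine halts_seq (halts_sumIdx hk hσ₁ (by simp) (fun _ _ => trivial) (by simp) (by simp)
    fun height hheight => ?_)
  refine halts_seq (Pushing.halts_push (σ := σ) (adj := adj) (y := y) (H := fun _ => 0) hk
    ⟨hσ₁.putIdx (by simp) height, rfl, by simpa using hadj, by simpa using hcap, by simp,
      by simpa using halloc, by simpa using hload, fun i => ?_⟩ hu hy.preflow_zero
    fun z τ hτ => hτ.halts_relabel hk hall hu hpost)
  simpa using hheight i i.isLt 0 one_pos

end Transport

section Balance

open Chores

variable {ok : ℝ → Prop} {k n m : ℕ} {σ : Memory} {Post : Memory → Prop}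
  {adj : Fin n → Fin m → Prop}

/-- Computes a balanced fractional assignment of chores to adjacent agents, as the quotients of the
entries of an allocation and the sizes of the classes. -/
noncomputable def balanceProg : TimedProgram := stabilizeProg ⨟ classesProg ⨟ transportProg

theorem halts_balance (hk : ∀ d : Dim, d.size n m ≤ k) (hσ : Ready n m σ)
    (hadj : ∀ i j, adj i j ↔ 1 ≤ σ.idx Arr.adj i j)
    (hpost : ∀ τ, Ready n m τ → τ.num = σ.num →
      (∀ (i : Fin n) (j : Fin m), τ.idx Arr.alloc i j ≤ n) →
      (∀ i : Fin n, τ.idx Arr.size i 0 ≤ n) →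
      Balanced adj (fun (i : Fin n) (j : Fin m) =>
        (τ.idx Arr.alloc i j / τ.idx Arr.size i 0 : ℝ)) → Post τ) :
    Halts ok k balanceProg σ Post := by
  classical
  refine halts_seq (halts_stabilize hk hσ hadj fun τ₁ y h₁ hnum₁ hadj₁ hload hy hs => ?_)
  refine halts_seq (halts_classes hk h₁ (adj := adj) (by rwa [hadj₁]) hload
    fun τ₂ h₂ hnum₂ hadj₂ hsize hcap hunits => ?_)
  have hunits_le (j : Fin m) : choreAgents adj (Chores.load y) j ≤ n := by
    simpa using choreAgents_le (adj := adj) (g := Chores.load y) j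
  refine halts_transport hk h₂ hadj₂ hunits hcap (hs.hallCondition hy (by simp)) hunits_le
    fun τ z H hτ hz hle => ?_
  have hsize' (i : Fin n) : τ.idx Arr.size i 0 = classAgents (Chores.load y) i := by
    rw [hτ.size, hsize]
  refine hpost τ hτ.ready (hτ.num.trans (hnum₂.trans hnum₁)) (fun i j => ?_) (fun i => ?_) ?_
  · rw [hτ.alloc]
    exact (Finset.single_le_sum_of_canonicallyOrdered (Finset.mem_univ i)).trans
      ((hz.sum_le j).trans (hunits_le j))
  · rw [hsize']
    exact (Fintype.card_subtype_le _).trans_eq (Fintype.card_fin n)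
  · simp only [hτ.alloc, hsize']
    exact hs.balanced hy rfl hz hle

end Balance

section Formula

variable {n m : ℕ} {c : Fin n → Fin m → ℝ} {d d' s t L : ℕ} {v w : ℝ}

/-- The number `v` is the value of an arithmetic formula of depth at most `d` over the entries of
`c` and the natural numbers up to `n + m`, in which sums may have up to `n + m` further terms. -/
inductive Formula (c : Fin n → Fin m → ℝ) : ℕ → ℝ → Prop
  | natCast {d k : ℕ} (hk : k ≤ n + m) : Formula c d k
  | entry {d : ℕ} (i : Fin n) (j : Fin m) : Formula c d (c i j)
  | succ {d : ℕ} {v : ℝ} (hv : Formula c d v) : Formula c (d + 1) v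
  | add {d : ℕ} {v w : ℝ} (hv : Formula c d v) (hw : Formula c d w) : Formula c (d + 1) (v + w)
  | sub {d : ℕ} {v w : ℝ} (hv : Formula c d v) (hw : Formula c d w) : Formula c (d + 1) (v - w)
  | mul {d : ℕ} {v w : ℝ} (hv : Formula c d v) (hw : Formula c d w) : Formula c (d + 1) (v * w)
  | div {d : ℕ} {v w : ℝ} (hv : Formula c d v) (hw : Formula c d w) : Formula c (d + 1) (v / w)
  | sum {d l : ℕ} {v : ℝ} {f : ℕ → ℝ} (hl : l ≤ n + m) (hv : Formula c d v)
      (hf : ∀ i < l, Formula c d (f i)) : Formula c (d + 1) (v + ∑ i ∈ Finset.range l, f i)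

theorem Formula.mono (hv : Formula c d v) (hd : d ≤ d') : Formula c d' v := by
  induction hd with
  | refl => exact hv
  | step _ ih => exact ih.succ

theorem Formula.zero : Formula c d 0 := by
  simpa using Formula.natCast (c := c) (d := d) (k := 0) (Nat.zero_le _)

/-- The number `v` is a fraction whose numerator and denominator are at most `2 ^ s`. -/
def Fits (s : ℕ) (v : ℝ) : Prop :=
  ∃ a b : ℤ, b ≠ 0 ∧ v = a / b ∧ |a| ≤ 2 ^ s ∧ |b| ≤ 2 ^ s

theorem Fits.mono (hv : Fits s v) (hst : s ≤ t) : Fits t v := by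
  obtain ⟨a, b, hb, rfl, ha, hb'⟩ := hv
  have hpow : (2 : ℤ) ^ s ≤ 2 ^ t := pow_le_pow_right₀ one_le_two hst
  exact ⟨a, b, hb, rfl, ha.trans hpow, hb'.trans hpow⟩

theorem fits_natCast {k : ℕ} (hk : k ≤ s) : Fits s (k : ℝ) := by
  refine ⟨k, 1, one_ne_zero, by simp, ?_, by simpa using one_le_pow₀ one_le_two⟩
  rw [Nat.abs_cast]
  exact_mod_cast hk.trans Nat.lt_two_pow_self.le

theorem fits_ratCast {q : ℚ} (hq : bitSize q ≤ s) : Fits s (q : ℝ) := by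
  unfold bitSize at hq
  have hnum : q.num.natAbs ≤ 2 ^ s := (Nat.size_le.1 (by omega)).le
  have hden : q.den ≤ 2 ^ s := (Nat.size_le.1 (by omega)).le
  refine ⟨q.num, q.den, by simp, by exact_mod_cast (Rat.num_div_den q).symm, ?_, ?_⟩
  · rw [Int.abs_eq_natAbs]
    exact_mod_cast hnum
  · rw [Nat.abs_cast]
    exact_mod_cast hden

theorem Fits.mul (hv : Fits s v) (hw : Fits t w) : Fits (s + t) (v * w) := by
  obtain ⟨a, b, hb, rfl, ha, hb'⟩ := hv
  obtain ⟨a', b', hb₀, rfl, ha', hb''⟩ := hw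
  refine ⟨a * a', b * b', mul_ne_zero hb hb₀, by push_cast; rw [div_mul_div_comm], ?_, ?_⟩ <;>
  · rw [abs_mul, pow_add]
    gcongr

theorem Fits.inv (hv : Fits s v) : Fits s v⁻¹ := by
  obtain ⟨a, b, -, rfl, ha, hb'⟩ := hv
  rcases eq_or_ne a 0 with rfl | ha₀
  · exact ⟨0, 1, one_ne_zero, by simp, by simp, by simpa using one_le_pow₀ one_le_two⟩
  · exact ⟨b, a, ha₀, inv_div _ _, hb', ha⟩

theorem Fits.div (hv : Fits s v) (hw : Fits t w) : Fits (s + t) (v / w) := by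
  rw [div_eq_mul_inv]
  exact hv.mul hw.inv

theorem Fits.add (hv : Fits s v) (hw : Fits t w) : Fits (s + t + 1) (v + w) := by
  obtain ⟨a, b, hb, rfl, ha, hb'⟩ := hv
  obtain ⟨a', b', hb₀, rfl, ha', hb''⟩ := hw
  refine ⟨a * b' + b * a', b * b', mul_ne_zero hb hb₀, ?_, ?_, ?_⟩
  · push_cast
    exact div_add_div _ _ (by exact_mod_cast hb) (by exact_mod_cast hb₀)
  · calc |a * b' + b * a'| ≤ |a| * |b'| + |b| * |a'| := by
          rw [← abs_mul, ← abs_mul]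
          exact abs_add_le _ _
      _ ≤ 2 ^ s * 2 ^ t + 2 ^ s * 2 ^ t := by gcongr
      _ = 2 ^ (s + t + 1) := by ring
  · calc |b * b'| ≤ 2 ^ s * 2 ^ t := by
          rw [abs_mul]
          gcongr
      _ ≤ 2 ^ (s + t + 1) := by
          rw [← pow_add]
          exact pow_le_pow_right₀ one_le_two (Nat.le_succ _)

theorem Fits.neg (hv : Fits s v) : Fits s (-v) := by
  obtain ⟨a, b, hb, rfl, ha, hb'⟩ := hv
  exact ⟨-a, b, hb, by push_cast; rw [neg_div], by rwa [abs_neg], hb'⟩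

theorem Fits.sub (hv : Fits s v) (hw : Fits t w) : Fits (s + t + 1) (v - w) := by
  rw [sub_eq_add_neg]
  exact hv.add hw.neg

theorem Fits.sum {f : ℕ → ℝ} {l : ℕ} (hv : Fits s v) (hf : ∀ i < l, Fits t (f i)) :
    Fits (s + l * (t + 1)) (v + ∑ i ∈ Finset.range l, f i) := by
  induction l with
  | zero => simpa using hv
  | succ l ih =>
    rw [Finset.sum_range_succ, ← add_assoc]
    refine ((ih fun i hi => hf i (by omega)).add (hf l (by omega))).mono (le_of_eq ?_)
    ring

theorem Fits.exists_bitSize_le (hv : Fits s v) : ∃ r : ℚ, v = r ∧ bitSize r ≤ 2 * s + 3 := by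
  obtain ⟨a, b, hb, rfl, ha, hb'⟩ := hv
  refine ⟨Rat.divInt a b, by rw [Rat.cast_divInt], ?_⟩
  have hlt : (2 : ℤ) ^ s < 2 ^ (s + 1) := pow_lt_pow_right₀ one_lt_two (Nat.lt_succ_self s)
  have hnum : |(Rat.divInt a b).num| ≤ |a| := by
    rcases eq_or_ne a 0 with rfl | ha₀
    · simp
    · exact Int.le_of_dvd (abs_pos.2 ha₀) ((abs_dvd_abs _ _).2 (Rat.num_dvd a hb))
  have hden : ((Rat.divInt a b).den : ℤ) ≤ |b| :=
    Int.le_of_dvd (abs_pos.2 hb) ((dvd_abs _ _).2 (Rat.den_dvd a b))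
  have hnum_size : (Rat.divInt a b).num.natAbs.size ≤ s + 1 := Nat.size_le.2 (by zify; omega)
  have hden_size : (Rat.divInt a b).den.size ≤ s + 1 := Nat.size_le.2 (by zify; omega)
  unfold bitSize
  omega

theorem Formula.fits (hL : n + m ≤ L) (hc : ∀ i j, Fits L (c i j)) (hv : Formula c d v) :
    Fits ((3 * (L + 1)) ^ (d + 1)) v := by
  have hbase (d : ℕ) : L ≤ (3 * (L + 1)) ^ (d + 1) :=
    (by omega : L ≤ 3 * (L + 1)).trans (Nat.le_self_pow (by omega) _)
  have hstep {d e : ℕ} {v : ℝ} (hv : Fits e v)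
      (he : e ≤ 3 * (3 * (L + 1)) ^ (d + 1)) :
      Fits ((3 * (L + 1)) ^ (d + 1 + 1)) v := by
    refine hv.mono (he.trans ?_)
    rw [pow_succ' _ (d + 1)]
    gcongr
    omega
  have hpos (d : ℕ) : 1 ≤ (3 * (L + 1)) ^ (d + 1) := Nat.one_le_pow _ _ (by omega)
  induction hv with
  | natCast hk => exact fits_natCast ((hk.trans hL).trans (hbase _))
  | entry i j => exact (hc i j).mono (hbase _)
  | succ _ ih => exact hstep ih (by omega)
  | @add d _ _ _ _ ihv ihw => exact hstep (ihv.add ihw) (by linarith [hpos d])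
  | @sub d _ _ _ _ ihv ihw => exact hstep (ihv.sub ihw) (by linarith [hpos d])
  | mul _ _ ihv ihw => exact hstep (ihv.mul ihw) (by omega)
  | div _ _ ihv ihw => exact hstep (ihv.div ihw) (by omega)
  | @sum d l _ _ hl _ _ ihv ihf =>
    refine (ihv.sum ihf).mono ?_
    rw [pow_succ' _ (d + 1)]
    nlinarith [hpos d, hl.trans hL]

theorem bitSize_le_totalBitSize (q : Fin n → Fin m → ℚ) (i : Fin n) (j : Fin m) :
    bitSize (q i j) ≤ totalBitSize q :=
  (Finset.single_le_sum_of_canonicallyOrdered (f := fun j => bitSize (q i j))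
    (Finset.mem_univ j)).trans (Finset.single_le_sum_of_canonicallyOrdered
      (f := fun i => ∑ j, bitSize (q i j)) (Finset.mem_univ i))

/-- Bounds, in terms of the encoding length of the input, the encoding length of the value of a
formula of depth `d`. -/
noncomputable def formulaSize (d : ℕ) : Polynomial ℕ := 2 * (3 * (.X + 1)) ^ (d + 1) + 3

theorem Formula.exists_bitSize_le {q : Fin n → Fin m → ℚ} (hq : ∀ i j, c i j = q i j)
    (hv : Formula c d v) :
    ∃ r : ℚ, v = r ∧ bitSize r ≤ (formulaSize d).eval (n + m + totalBitSize q) := by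
  have hfits := hv.fits (L := n + m + totalBitSize q) (by omega) fun i j => by
    rw [hq]
    exact fits_ratCast ((bitSize_le_totalBitSize q i j).trans (by omega))
  simpa [formulaSize] using hfits.exists_bitSize_le

end Formula

section Expressions

variable {n m : ℕ} {c : Fin n → Fin m → ℝ} {d D A : ℕ} {σ τ : Memory} {e : NExpr}

/-- The nesting depth of the operations. -/
@[simp]
def NExpr.depth : NExpr → ℕ
  | .ofIdx _ => 0
  | .get _ _ _ => 0
  | .add e f => max e.depth f.depth + 1
  | .sub e f => max e.depth f.depth + 1
  | .mul e f => max e.depth f.depth + 1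
  | .div e f => max e.depth f.depth + 1

/-- The indices that the expression uses as numbers are at most `N`. -/
@[simp]
def NExpr.IdxLe (N : ℕ) (σ : Memory) : NExpr → Prop
  | .ofIdx e => e.eval σ ≤ N
  | .get _ _ _ => True
  | .add e f => e.IdxLe N σ ∧ f.IdxLe N σ
  | .sub e f => e.IdxLe N σ ∧ f.IdxLe N σ
  | .mul e f => e.IdxLe N σ ∧ f.IdxLe N σ
  | .div e f => e.IdxLe N σ ∧ f.IdxLe N σ

/-- The expression does not read number array `A`. -/
@[simp]
def NExpr.Avoids (A : ℕ) : NExpr → Prop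
  | .ofIdx _ => True
  | .get B _ _ => B ≠ A
  | .add e f => e.Avoids A ∧ f.Avoids A
  | .sub e f => e.Avoids A ∧ f.Avoids A
  | .mul e f => e.Avoids A ∧ f.Avoids A
  | .div e f => e.Avoids A ∧ f.Avoids A

theorem NExpr.formula_eval (hσ : ∀ A i j, Formula c d (σ.num A i j)) (he : e.IdxLe (n + m) σ) :
    Formula c (d + e.depth) (e.eval σ) := by
  induction e with
  | ofIdx e => exact .natCast he
  | get A i j => exact hσ A _ _
  | add e f ihe ihf =>
    exact ((ihe he.1).mono (by simp)).add ((ihf he.2).mono (by simp))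
  | sub e f ihe ihf =>
    exact ((ihe he.1).mono (by simp)).sub ((ihf he.2).mono (by simp))
  | mul e f ihe ihf =>
    exact ((ihe he.1).mono (by simp)).mul ((ihf he.2).mono (by simp))
  | div e f ihe ihf =>
    exact ((ihe he.1).mono (by simp)).div ((ihf he.2).mono (by simp))

theorem NExpr.within_formula (hσ : ∀ A i j, Formula c d (σ.num A i j))
    (he : e.IdxLe (n + m) σ) (hD : d + e.depth ≤ D) : e.Within (Formula c D) σ := by
  have heval := (e.formula_eval hσ he).mono hD
  induction e with
  | ofIdx e => exact heval
  | get A i j => exact heval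
  | add e f ihe ihf | sub e f ihe ihf | mul e f ihe ihf | div e f ihe ihf =>
    have hD' : d + max e.depth f.depth + 1 ≤ D := hD
    have he' : d + e.depth ≤ D := by omega
    have hf' : d + f.depth ≤ D := by omega
    exact ⟨ihe he.1 he' ((e.formula_eval hσ he.1).mono he'),
      ihf he.2 hf' ((f.formula_eval hσ he.2).mono hf'), heval⟩

theorem IExpr.eval_congr (h : τ.idx = σ.idx) (e : IExpr) : e.eval τ = e.eval σ := by
  induction e <;> simp_all

theorem NExpr.Avoids.eval_congr (he : e.Avoids A) (hidx : τ.idx = σ.idx)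
    (hnum : ∀ B ≠ A, τ.num B = σ.num B) : e.eval τ = e.eval σ := by
  induction e <;> simp_all [NExpr.eval, IExpr.eval_congr hidx]

theorem NExpr.Avoids.within_congr {ok : ℝ → Prop} (he : e.Avoids A) (hidx : τ.idx = σ.idx)
    (hnum : ∀ B ≠ A, τ.num B = σ.num B) : e.Within ok τ ↔ e.Within ok σ := by
  induction e <;> simp_all [NExpr.Within, NExpr.eval, IExpr.eval_congr hidx,
    NExpr.Avoids.eval_congr (A := A) _ hidx hnum]

end Expressions

section NumberArrays

attribute [simp] NExpr.eval

variable {n m : ℕ} {c : Fin n → Fin m → ℝ} {k d d' D A : ℕ} {σ : Memory} {Post : Memory → Prop}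
  {R C L : Dim} {e₀ e : NExpr} {b : Test}

/-- The memory in which `f` replaces number array `A`. -/
def Memory.putNum (σ : Memory) (A : ℕ) (f : ℕ → ℕ → ℝ) : Memory :=
  { σ with num := Function.update σ.num A f }

@[simp]
theorem Memory.putNum_num (σ : Memory) (A B : ℕ) (f : ℕ → ℕ → ℝ) :
    (σ.putNum A f).num B = if B = A then f else σ.num B :=
  Function.update_apply ..

@[simp]
theorem Memory.putNum_idx (σ : Memory) (A : ℕ) (f : ℕ → ℕ → ℝ) : (σ.putNum A f).idx = σ.idx := rfl

theorem Memory.setNum_atCell_putNum (σ : Memory) (A : ℕ) (f : ℕ → ℕ → ℝ) (i j l : ℕ) (v : ℝ) :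
    ((σ.putNum A f).atCell i j l).setNum A i j v =
      (σ.putNum A (write f i j v)).atCell i j l := by
  simp only [Memory.atCell, Memory.setIdx, Memory.putNum, Memory.setNum, Memory.mk.injEq, true_and]
  funext A' x y
  simp only [Function.update_apply]
  grind [write_apply]

theorem NExpr.Avoids.eval_putNum (he : e.Avoids A) (σ : Memory) (f : ℕ → ℕ → ℝ) (i j l : ℕ) :
    e.eval ((σ.putNum A f).atCell i j l) = e.eval (σ.atCell i j l) :=
  he.eval_congr rfl fun B hB => by simp [hB]

theorem NExpr.Avoids.within_putNum {ok : ℝ → Prop} (he : e.Avoids A) (σ : Memory)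
    (f : ℕ → ℕ → ℝ) (i j l : ℕ) :
    e.Within ok ((σ.putNum A f).atCell i j l) ↔ e.Within ok (σ.atCell i j l) :=
  he.within_congr rfl fun B hB => by simp [hB]

/-- The memory is ready for the next instruction, and all numbers in it are values of formulas of
depth at most `d` over the entries of `c`. -/
structure Stage (c : Fin n → Fin m → ℝ) (d : ℕ) (σ : Memory) : Prop extends Ready n m σ where
  formula : ∀ A i j, Formula c d (σ.num A i j)

theorem Stage.putIdx (h : Stage c d σ) (hA : 4 ≤ A) (f : ℕ → ℕ → ℕ) : Stage c d (σ.putIdx A f) :=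
  ⟨h.toReady.putIdx hA f, h.formula⟩

theorem Stage.putNum (h : Stage c d σ) (hd : d ≤ d') {f : ℕ → ℕ → ℝ}
    (hf : ∀ i j, Formula c d' (f i j)) : Stage c d' (σ.putNum A f) where
  toReady := ⟨h.agents, h.chores, h.row, h.col, h.layer⟩
  formula B i j := by
    rw [Memory.putNum_num]
    split_ifs
    exacts [hf i j, (h.formula B i j).mono hd]

/-- Sets every cell of number array `A` to `e₀`, and then, layer by layer, to `e` where `b`
holds. -/
noncomputable def fillNum (A : ℕ) (R C L : Dim) (e₀ : NExpr) (b : Test) (e : NExpr) :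
    TimedProgram :=
  forCells R C L (.setNum A row col e₀) (.cond b (.setNum A row col e) .skip)

theorem halts_fillNum {Cell : ℕ → ℕ → ℕ → ℝ → Prop}
    (hk : ∀ d : Dim, d.size n m ≤ k) (hσ : Stage c d σ) (hd : d ≤ d')
    (hinit : ∀ f, ∀ i < R.size n m, ∀ j < C.size n m, Stage c d' (σ.putNum A f) →
      e₀.Within (Formula c D) ((σ.putNum A f).atCell i j 0) ∧
      Formula c d' (e₀.eval ((σ.putNum A f).atCell i j 0)) ∧
      Cell i j 0 (e₀.eval ((σ.putNum A f).atCell i j 0)))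
    (htest : ∀ f, ∀ i < R.size n m, ∀ j < C.size n m, ∀ l < L.size n m,
      Stage c d' (σ.putNum A f) → b.Within (Formula c D) ((σ.putNum A f).atCell i j l))
    (hset : ∀ f, ∀ i < R.size n m, ∀ j < C.size n m, ∀ l < L.size n m,
      Stage c d' (σ.putNum A f) → Cell i j l (f i j) → b.Holds ((σ.putNum A f).atCell i j l) →
      e.Within (Formula c D) ((σ.putNum A f).atCell i j l) ∧
      Formula c d' (e.eval ((σ.putNum A f).atCell i j l)) ∧
      Cell i j (l + 1) (e.eval ((σ.putNum A f).atCell i j l)))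
    (hskip : ∀ f, ∀ i < R.size n m, ∀ j < C.size n m, ∀ l < L.size n m, Cell i j l (f i j) →
      ¬ b.Holds ((σ.putNum A f).atCell i j l) → Cell i j (l + 1) (f i j))
    (hpost : ∀ f, Stage c d' (σ.putNum A f) →
      (∀ i < R.size n m, ∀ j < C.size n m, Cell i j (L.size n m) (f i j)) →
      Post (σ.putNum A f)) :
    Halts (Formula c D) k (fillNum A R C L e₀ b e) σ Post := by
  have hput (f : ℕ → ℕ → {v : ℝ // Formula c d' v}) :
      Stage c d' (σ.putNum A fun i j => (f i j : ℝ)) := hσ.putNum hd fun i j => (f i j).2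
  have hwrite (f : ℕ → ℕ → {v : ℝ // Formula c d' v}) (i j : ℕ) (v : {v : ℝ // Formula c d' v}) :
      write (fun i j => (f i j : ℝ)) i j v = fun x y => (write f i j v x y).val := by
    funext x y
    simp only [write_apply, apply_ite Subtype.val]
  let f₀ (i j : ℕ) : {v : ℝ // Formula c d' v} := ⟨σ.num A i j, (hσ.formula A i j).mono hd⟩
  have hf₀ : σ = σ.putNum A fun i j => (f₀ i j : ℝ) := by simp [f₀, Memory.putNum]
  rw [hf₀]
  refine halts_fill (V := {v : ℝ // Formula c d' v}) (put := fun f => σ.putNum A fun i j => f i j)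
    (Cell := fun i j l v => Cell i j l v) hk (fun f => (hput f).toReady) ?_ ?_
    (fun f hf => hpost _ (hput f) hf) f₀
  · intro f i hi j hj
    obtain ⟨hw, hv, hcell⟩ := hinit _ i hi j hj (hput f)
    refine halts_setNum hw ⟨⟨_, hv⟩, hcell, ?_⟩
    simp only [← hwrite, IExpr.eval, row, col, Memory.atCell_row, Memory.atCell_col,
      Memory.setNum_atCell_putNum]
  · intro f i hi j hj l hl hcell
    refine halts_cond (htest _ i hi j hj l hl (hput f)) (fun hb => ?_) fun hb => halts_skip ?_
    · obtain ⟨hw, hv, hcell'⟩ := hset _ i hi j hj l hl (hput f) hcell hb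
      refine halts_setNum hw ⟨⟨_, hv⟩, hcell', ?_⟩
      simp only [← hwrite, IExpr.eval, row, col, Memory.atCell_row, Memory.atCell_col,
        Memory.setNum_atCell_putNum]
    · exact ⟨f i j, hskip _ i hi j hj l hl hcell hb, by rw [write_self]⟩

end NumberArrays

section Sums

variable {n m : ℕ} {c : Fin n → Fin m → ℝ} {d D A : ℕ} {σ : Memory} {Post : Memory → Prop}
  {R C L : Dim} {e₀ e : NExpr} {b : Test}

theorem Stage.eval_atCell (hσ : Stage c d σ) {i j l : ℕ}
    (hidx : e.IdxLe (n + m) (σ.atCell i j l)) : Formula c (d + e.depth) (e.eval (σ.atCell i j l)) :=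
  e.formula_eval (fun A => hσ.formula A) hidx

theorem Stage.within_putNum (hσ : Stage c d σ) (hD : d + e.depth ≤ D) (hA : e.Avoids A)
    (f : ℕ → ℕ → ℝ) {i j l : ℕ} (hidx : e.IdxLe (n + m) (σ.atCell i j l)) :
    e.Within (Formula c D) ((σ.putNum A f).atCell i j l) :=
  (hA.within_putNum σ f i j l).2 (e.within_formula (fun A => hσ.formula A) hidx hD)

/-- Sets every cell of number array `A` to the sum of `e₀` and of `e` over all layers where `b`
holds. -/
noncomputable def sumNum (A : ℕ) (R C L : Dim) (e₀ : NExpr) (b : Test) (e : NExpr) : TimedProgram :=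
  fillNum A R C L e₀ b (.add (.get A row col) e)

open scoped Classical in
theorem halts_sumNum (hk : ∀ d : Dim, d.size n m ≤ n + m) (hσ : Stage c d σ) (hD : d + 4 ≤ D)
    (hdepth₀ : e₀.depth ≤ 3) (hdepth : e.depth ≤ 3) (hA₀ : e₀.Avoids A) (hA : e.Avoids A)
    (hb : ∀ τ : Memory, b.Within (Formula c D) τ)
    (hbA : ∀ f i j l, b.Holds ((σ.putNum A f).atCell i j l) ↔ b.Holds (σ.atCell i j l))
    (hidx₀ : ∀ i < R.size n m, ∀ j < C.size n m, e₀.IdxLe (n + m) (σ.atCell i j 0))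
    (hidx : ∀ i < R.size n m, ∀ j < C.size n m, ∀ l < L.size n m,
      e.IdxLe (n + m) (σ.atCell i j l))
    (hpost : ∀ f, Stage c (d + 4) (σ.putNum A f) → (∀ i < R.size n m, ∀ j < C.size n m,
      f i j = e₀.eval (σ.atCell i j 0) + ∑ l : Fin (L.size n m),
        if b.Holds (σ.atCell i j l) then e.eval (σ.atCell i j l) else 0) →
      Post (σ.putNum A f)) :
    Halts (Formula c D) (n + m) (sumNum A R C L e₀ b e) σ Post := by
  let term (i j l : ℕ) : ℝ := if b.Holds (σ.atCell i j l) then e.eval (σ.atCell i j l) else 0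
  let partialSum (i j l : ℕ) : ℝ := e₀.eval (σ.atCell i j 0) + ∑ l' ∈ Finset.range l, term i j l'
  have hsucc (i j l : ℕ) : partialSum i j (l + 1) = partialSum i j l + term i j l := by
    simp only [partialSum, Finset.sum_range_succ, add_assoc]
  have hformula : ∀ i < R.size n m, ∀ j < C.size n m, ∀ l ≤ L.size n m,
      Formula c (d + 4) (partialSum i j l) := fun i hi j hj l hl => by
    refine .sum (hl.trans (hk L)) ((hσ.eval_atCell (hidx₀ i hi j hj)).mono (by omega))
      fun l' hl' => ?_
    simp only [term]
    split_ifs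
    exacts [(hσ.eval_atCell (hidx i hi j hj l' (by omega))).mono (by omega), .zero]
  refine halts_fillNum (d' := d + 4) (Cell := fun i j l v => v = partialSum i j l) hk hσ (by omega)
    (fun f i hi j hj _ => ⟨hσ.within_putNum (by omega) hA₀ f (hidx₀ i hi j hj), ?_⟩)
    (fun f _ _ _ _ _ _ _ => hb _) (fun f i hi j hj l hl hf hcell hl' => ?_)
    (fun f i _ j _ l _ hcell hl' => ?_) fun f hf hcell => hpost f hf fun i hi j hj => ?_
  · rw [hA₀.eval_putNum]
    exact ⟨(hσ.eval_atCell (hidx₀ i hi j hj)).mono (by omega), by simp [partialSum]⟩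
  · have hval : NExpr.eval ((σ.putNum A f).atCell i j l) (.add (.get A row col) e) =
        partialSum i j (l + 1) := by
      rw [hsucc, ← hcell]
      simp [hA.eval_putNum, term, if_pos ((hbA f i j l).1 hl')]
    have hsum := hformula i hi j hj (l + 1) hl
    rw [hval]
    exact ⟨⟨(hf.formula A _ _).mono hD, hσ.within_putNum (by omega) hA f (hidx i hi j hj l hl),
      by rw [hval]; exact hsum.mono hD⟩, hsum, rfl⟩
  · rw [hsucc, ← hcell]
    simp [term, if_neg (mt (hbA f i j l).2 hl')]
  · rw [hcell i hi j hj, Fin.sum_univ_eq_sum_range (term i j)]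

/-- Sets every cell of number array `A` to `e`. -/
noncomputable def letNum (A : ℕ) (R C : Dim) (e : NExpr) : TimedProgram :=
  sumNum A R C .one e always (.ofIdx (.lit 0))

theorem halts_letNum (hk : ∀ d : Dim, d.size n m ≤ n + m) (hσ : Stage c d σ) (hD : d + 4 ≤ D)
    (hdepth : e.depth ≤ 3) (hA : e.Avoids A)
    (hidx : ∀ i < R.size n m, ∀ j < C.size n m, e.IdxLe (n + m) (σ.atCell i j 0))
    (hpost : ∀ f, Stage c (d + 4) (σ.putNum A f) →
      (∀ i < R.size n m, ∀ j < C.size n m, f i j = e.eval (σ.atCell i j 0)) →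
      Post (σ.putNum A f)) :
    Halts (Formula c D) (n + m) (letNum A R C e) σ Post :=
  halts_sumNum hk hσ hD hdepth (by simp) hA (by simp) (fun _ => trivial) (by simp) hidx (by simp)
    fun f hf heq => hpost f hf (by simpa using heq)

end Sums

section Minimum

variable {n m : ℕ} {c : Fin n → Fin m → ℝ} {d D A B : ℕ} {σ : Memory} {Post : Memory → Prop}
  {R L : Dim} {e : NExpr}

/-- Sets the entries of vector `A` to the minimum of `e` over all layers. -/
noncomputable def minNum (A : ℕ) (R L : Dim) (e : NExpr) : TimedProgram :=
  fillNum A R .one L e (.numLe e (.get A row col)) e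

theorem halts_minNum (hk : ∀ d : Dim, d.size n m ≤ n + m) (hσ : Stage c d σ) (hD : d + 1 ≤ D)
    (hL : 0 < L.size n m) (hdepth : e.depth ≤ 1) (hA : e.Avoids A)
    (hidx : ∀ i l, e.IdxLe (n + m) (σ.atCell i 0 l))
    (hpost : ∀ f, Stage c (d + 1) (σ.putNum A f) → (∀ i < R.size n m,
      (∃ l < L.size n m, f i 0 = e.eval (σ.atCell i 0 l)) ∧
      ∀ l < L.size n m, f i 0 ≤ e.eval (σ.atCell i 0 l)) → Post (σ.putNum A f)) :
    Halts (Formula c D) (n + m) (minNum A R L e) σ Post := by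
  have hwithin (f : ℕ → ℕ → ℝ) (i l : ℕ) :
      e.Within (Formula c D) ((σ.putNum A f).atCell i 0 l) :=
    hσ.within_putNum (by omega) hA f (hidx i l)
  have hformula (f : ℕ → ℕ → ℝ) (i l : ℕ) :
      Formula c (d + 1) (e.eval ((σ.putNum A f).atCell i 0 l)) := by
    rw [hA.eval_putNum]
    exact (hσ.eval_atCell (hidx i l)).mono (by omega)
  refine halts_fillNum (Cell := fun i _ l v => (∃ l' < L.size n m, v = e.eval (σ.atCell i 0 l')) ∧
    ∀ l' < l, v ≤ e.eval (σ.atCell i 0 l')) hk hσ (Nat.le_succ d) ?_ ?_ ?_ ?_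
    fun f hf hcell => hpost f hf fun i hi => hcell i hi 0 one_pos
  · intro f i _ j hj _
    obtain rfl : j = 0 := by simpa using hj
    exact ⟨hwithin f i 0, hformula f i 0, ⟨0, hL, hA.eval_putNum ..⟩, by simp⟩
  · intro f i _ j hj l _ hf
    obtain rfl : j = 0 := by simpa using hj
    exact ⟨hwithin f i l, (hf.formula A _ _).mono hD⟩
  · rintro f i - j hj l hl - ⟨-, hmin⟩ hle
    obtain rfl : j = 0 := by simpa using hj
    simp only [Test.Holds, hA.eval_putNum] at hle
    refine ⟨hwithin f i l, hformula f i l, ⟨l, hl, hA.eval_putNum ..⟩, fun l' hl' => ?_⟩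
    rw [hA.eval_putNum]
    rcases Nat.lt_succ_iff_lt_or_eq.1 hl' with h | rfl
    · exact (hle.trans (by simp)).trans (hmin l' h)
    · exact le_rfl
  · rintro f i - j hj l - ⟨hmem, hmin⟩ hlt
    obtain rfl : j = 0 := by simpa using hj
    simp only [Test.Holds, hA.eval_putNum, not_le] at hlt
    refine ⟨hmem, fun l' hl' => ?_⟩
    rcases Nat.lt_succ_iff_lt_or_eq.1 hl' with h | rfl
    · exact hmin l' h
    · simpa using hlt.le

/-- Sets the scalar `B` to the minimum of `e` over all agents as rows and all chores as layers. -/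
noncomputable def leastProg (A B : ℕ) (e : NExpr) : TimedProgram :=
  minNum A .agents .chores e ⨟ minNum B .one .agents (.get A layer (.lit 0))

theorem halts_least (hk : ∀ d : Dim, d.size n m ≤ n + m) (hσ : Stage c d σ) (hD : d + 2 ≤ D)
    (hn : 0 < n) (hm : 0 < m) (hdepth : e.depth ≤ 1) (hA : e.Avoids A) (hAB : A ≠ B)
    (hidx : ∀ i l, e.IdxLe (n + m) (σ.atCell i 0 l))
    (hpost : ∀ f g, Stage c (d + 2) ((σ.putNum A f).putNum B g) →
      (∃ (i : Fin n) (j : Fin m), g 0 0 = e.eval (σ.atCell i 0 j)) →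
      (∀ (i : Fin n) (j : Fin m), g 0 0 ≤ e.eval (σ.atCell i 0 j)) →
      Post ((σ.putNum A f).putNum B g)) :
    Halts (Formula c D) (n + m) (leastProg A B e) σ Post := by
  refine halts_seq (halts_minNum hk hσ (by omega) hm hdepth hA hidx fun f hf hrow => ?_)
  refine halts_minNum hk hf (by omega) hn (by simp) (by simpa using hAB) (by simp)
    fun g hg hmin => ?_
  simp only [NExpr.eval, IExpr.eval, layer, Memory.atCell_layer, Memory.atCell_num,
    Memory.putNum_num, if_true] at hmin
  obtain ⟨⟨i, hi, hgi⟩, hle⟩ := hmin 0 one_pos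
  obtain ⟨j, hj, hfi⟩ := (hrow i hi).1
  exact hpost f g hg ⟨⟨i, hi⟩, ⟨j, hj⟩, hgi.trans hfi⟩ fun i j =>
    (hle i i.isLt).trans ((hrow i i.isLt).2 j j.isLt)

end Minimum

/-- The number arrays. -/
inductive Num
  | cost | output | rowLeast | low | negHigh | high | share | load | income | equalIncome | keep
  | deficit | total | rest

/-- The number under which an array is stored. -/
@[simp]
def Num.code : Num → ℕ
  | cost => 0
  | output => 1
  | rowLeast => 2
  | low => 3
  | negHigh => 4
  | high => 5
  | share => 6
  | load => 7
  | income => 8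
  | equalIncome => 9
  | keep => 10
  | deficit => 11
  | total => 12
  | rest => 13

instance : CoeOut Num ℕ := ⟨Num.code⟩

/-- The entries of a vector are stored in column zero. -/
@[simp]
def vecNum (A : ℕ) (i : IExpr) : NExpr := .get A i (.lit 0)

/-- Position `(0, 0)` of number array `A`. -/
@[simp]
def scalarNum (A : ℕ) : NExpr := .get A (.lit 0) (.lit 0)

section Extremes

variable {n m : ℕ} {c : Fin n → Fin m → ℝ} {d D : ℕ} {Post : Memory → Prop}

theorem stage_input (c : Fin n → Fin m → ℝ) : Stage c 0 (input c) where
  agents := by simp [input]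
  chores := by simp [input]
  row := by simp [input]
  col := by simp [input]
  layer := by simp [input]
  formula A i j := by
    simp only [input]
    split_ifs
    exacts [.entry _ _, .zero]

theorem Stage.within_numLe {σ τ : Memory} {e f : NExpr} (hσ : Stage c d σ) (hτ : τ.num = σ.num)
    (hD : d + 1 ≤ D) (he : e.IdxLe (n + m) τ) (hf : f.IdxLe (n + m) τ) (hedepth : e.depth ≤ 1)
    (hfdepth : f.depth ≤ 1) : (Test.numLe e f).Within (Formula c D) τ :=
  have h A i j : Formula c d (τ.num A i j) := hτ ▸ hσ.formula A i j
  ⟨e.within_formula h he (by omega), f.within_formula h hf (by omega)⟩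

/-- Finds the least and the largest cost, and marks where the least cost occurs. -/
noncomputable def extremesProg : TimedProgram :=
  leastProg Num.rowLeast Num.low (.get Num.cost row layer) ⨟
  leastProg Num.rowLeast Num.negHigh (.sub (.ofIdx (.lit 0)) (.get Num.cost row layer)) ⨟
  letNum Num.high .one .one (.sub (.ofIdx (.lit 0)) (scalarNum Num.negHigh)) ⨟
  flagIdx Arr.adj .agents .chores (.numLe (.get Num.cost row col) (scalarNum Num.low))

theorem halts_extremes (hk : ∀ d : Dim, d.size n m ≤ n + m) (hD : 8 < D) (hn : 0 < n) (hm : 0 < m)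
    (hpost : ∀ τ, Stage c 8 τ →
      (∃ i j, τ.num Num.low 0 0 = c i j) → (∃ i j, τ.num Num.high 0 0 = c i j) →
      (∀ i j, τ.num Num.low 0 0 ≤ c i j) → (∀ i j, c i j ≤ τ.num Num.high 0 0) →
      (∀ (i : Fin n) (j : Fin m), 1 ≤ τ.idx Arr.adj i j ↔ c i j ≤ τ.num Num.low 0 0) → Post τ) :
    Halts (Formula c D) (n + m) extremesProg (input c) Post := by
  have hcost (i : Fin n) (j : Fin m) : (input c).num 0 i j = c i j := by simp [input]
  refine halts_seq (halts_least hk (stage_input c) (by omega) hn hm (by simp) (by simp) (by simp)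
    (by simp) fun _ low h₁ hlow_mem hlow_le => ?_)
  refine halts_seq (halts_least hk h₁ (by omega) hn hm (by simp) (by simp) (by simp) (by simp)
    fun _ negHigh h₂ hhigh_mem hhigh_le => ?_)
  refine halts_seq (halts_letNum hk h₂ (by omega) (by simp) (by simp) (by simp)
    fun high h₃ hhigh => ?_)
  have hhigh₀ : high 0 0 = -negHigh 0 0 := by simpa using hhigh 0 one_pos 0 one_pos
  refine halts_flagIdx hk h₃.toReady (by simp)
    (fun τ hτ => h₃.within_numLe hτ (by omega) (by simp) (by simp) (by simp) (by simp)) (by simp)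
    fun adj hadj => hpost _ (h₃.putIdx (by simp) adj) ?_ ?_ ?_ ?_ ?_
  · simpa [hcost] using hlow_mem
  · obtain ⟨i, j, hij⟩ := hhigh_mem
    exact ⟨i, j, by simp [hhigh₀, hij, hcost]⟩
  · simpa [hcost] using hlow_le
  · intro i j
    simpa [hhigh₀, hcost] using neg_le_neg (hhigh_le i j)
  · exact fun i j => by simpa [hcost] using hadj i i.isLt j j.isLt

end Extremes
section Incomes

open Chores

variable {n m : ℕ} {c f : Fin n → Fin m → ℝ} {a b : ℝ} {d D : ℕ} {σ : Memory}
  {Post : Memory → Prop}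

/-- The two costs `a` and `b`, the fractional assignment `f`, its loads, and who is low. -/
structure Incomes (a b : ℝ) (f : Fin n → Fin m → ℝ) (σ : Memory) : Prop where
  low : σ.num Num.low 0 0 = a
  high : σ.num Num.high 0 0 = b
  share : ∀ (i : Fin n) (j : Fin m), σ.num Num.share i j = f i j
  load : ∀ i : Fin n, σ.num Num.load i 0 = Chores.load f i
  isLow : ∀ i : Fin n, 1 ≤ σ.idx Arr.isLow i 0 ↔ i ∈ Chores.low a b f
  equalIncome : σ.num Num.equalIncome 0 0 = Chores.equalIncome a b f

/-- Sets the entries of vector `A` to the income for the set of agents given by `b`. -/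
noncomputable def incomeProg (A : ℕ) (R : Dim) (b : Test) : TimedProgram :=
  sumNum A R .one .agents
    (.div (.mul (scalarNum Num.high) (.ofIdx Dim.chores.expr)) (.ofIdx Dim.agents.expr)) b
    (.div (.mul (.sub (scalarNum Num.low) (scalarNum Num.high)) (vecNum Num.load layer))
      (.ofIdx Dim.agents.expr))

theorem halts_income {A : ℕ} {R : Dim} {t : Test} {S : Fin (R.size n m) → Finset (Fin n)}
    (hk : ∀ d : Dim, d.size n m ≤ n + m) (hσ : Stage c d σ) (hD : d + 4 ≤ D) (hA : 7 < A)
    (hlow : σ.num Num.low 0 0 = a) (hhigh : σ.num Num.high 0 0 = b)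
    (hload : ∀ i : Fin n, σ.num Num.load i 0 = load f i)
    (ht : ∀ τ : Memory, t.Within (Formula c D) τ)
    (htA : ∀ g i j l, t.Holds ((σ.putNum A g).atCell i j l) ↔ t.Holds (σ.atCell i j l))
    (hS : ∀ (i : Fin (R.size n m)) (l : Fin n), t.Holds (σ.atCell i 0 l) ↔ l ∈ S i)
    (hpost : ∀ g, Stage c (d + 4) (σ.putNum A g) →
      (∀ i : Fin (R.size n m), g i 0 = income a b f (S i)) → Post (σ.putNum A g)) :
    Halts (Formula c D) (n + m) (incomeProg A R t) σ Post := by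
  have hn := hσ.agents
  have hm := hσ.chores
  refine halts_sumNum hk hσ hD (by simp) (by simp) ?_ ?_ ht htA ?_ ?_ fun g hg heq =>
    hpost g hg fun i => ?_
  · simp only [NExpr.Avoids, scalarNum, Num.code, and_true]
    omega
  · simp only [NExpr.Avoids, scalarNum, vecNum, Num.code, and_true]
    omega
  · simp [Dim.expr, hn, hm]
  · simp [Dim.expr, hn]
  · simp only [Num.code] at hlow hhigh hload
    rw [heq i i.isLt 0 one_pos]
    calc _ = b * m / n + ∑ h ∈ S i, (a - b) * load f h / n := by
          simp [Dim.expr, hn, hm, hlow, hhigh, hload, hS]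
      _ = income a b f (S i) := by
          rw [income, ← Finset.sum_div, ← Finset.mul_sum, ← add_div]
          ring

/-- Stores the fractional assignment given by the quotients, and its loads. -/
noncomputable def loadsProg : TimedProgram :=
  letNum Num.share .agents .chores
    (.div (.ofIdx (.get Arr.alloc row col)) (.ofIdx (vec Arr.size row))) ⨟
  sumNum Num.load .agents .one .chores (.ofIdx (.lit 0)) always (.get Num.share row layer)

theorem halts_loads (hk : ∀ d : Dim, d.size n m ≤ n + m) (hσ : Stage c d σ) (hD : d + 8 ≤ D)
    (halloc : ∀ (i : Fin n) (j : Fin m), σ.idx Arr.alloc i j ≤ n)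
    (hsize : ∀ i : Fin n, σ.idx Arr.size i 0 ≤ n)
    (hf : ∀ i j, f i j = σ.idx Arr.alloc i j / σ.idx Arr.size i 0)
    (hpost : ∀ share ld, Stage c (d + 8) ((σ.putNum Num.share share).putNum Num.load ld) →
      (∀ (i : Fin n) (j : Fin m), share i j = f i j) → (∀ i : Fin n, ld i 0 = load f i) →
      Post ((σ.putNum Num.share share).putNum Num.load ld)) :
    Halts (Formula c D) (n + m) loadsProg σ Post := by
  classical
  refine halts_seq (halts_letNum hk hσ (by omega) (by simp) (by simp) (fun i hi j hj => ?_)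
    fun share h₁ hshare => ?_)
  · simpa using ⟨(halloc ⟨i, hi⟩ ⟨j, hj⟩).trans (by omega), (hsize ⟨i, hi⟩).trans (by omega)⟩
  have hshare' (i : Fin n) (j : Fin m) : share i j = f i j := by
    simpa [hf] using hshare i i.isLt j j.isLt
  refine halts_sumNum hk h₁ (by omega) (by simp) (by simp) (by simp) (by simp)
    (fun _ => trivial) (by simp) (by simp) (by simp) fun ld h₂ hld =>
      hpost share ld h₂ hshare' fun i => ?_
  simpa [hshare', load] using hld i i.isLt 0 one_pos

/-- Computes who is low, and the income of all agents. -/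
noncomputable def incomesProg : TimedProgram :=
  flagIdx Arr.atMost .agents .agents (.numLe (vecNum Num.load col) (vecNum Num.load row)) ⨟
  incomeProg Num.income .agents (pos (.get Arr.atMost row layer)) ⨟
  flagIdx Arr.isLow .agents .one
    (.numLe (.mul (scalarNum Num.low) (vecNum Num.load row)) (vecNum Num.income row)) ⨟
  incomeProg Num.equalIncome .one (pos (vec Arr.isLow layer))

theorem halts_incomes (hk : ∀ d : Dim, d.size n m ≤ n + m) (hσ : Stage c d σ) (hD : d + 8 ≤ D)
    (hlow : σ.num Num.low 0 0 = a) (hhigh : σ.num Num.high 0 0 = b)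
    (hshare : ∀ (i : Fin n) (j : Fin m), σ.num Num.share i j = f i j)
    (hload : ∀ i : Fin n, σ.num Num.load i 0 = load f i)
    (hpost : ∀ τ, Stage c (d + 8) τ → Incomes a b f τ → Post τ) :
    Halts (Formula c D) (n + m) incomesProg σ Post := by
  simp only [Num.code] at hlow hhigh hshare hload
  refine halts_seq (halts_flagIdx hk hσ.toReady (by simp)
    (fun τ hτ => hσ.within_numLe hτ (by omega) (by simp) (by simp) (by simp) (by simp)) (by simp)
    fun fewer hfewer => ?_)
  have h₁ := hσ.putIdx (A := Arr.atMost) (by simp) fewer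
  refine halts_seq (halts_income (a := a) (b := b) (f := f) (S := atMost f) hk h₁ (by omega)
    (by simp) (by simpa) (by simpa) (by simpa) (fun _ => trivial) (by simp) (fun i l => ?_)
    fun inc h₂ hinc => ?_)
  · simpa [hload] using hfewer i i.isLt l l.isLt
  refine halts_seq (halts_flagIdx hk h₂.toReady (by simp) (fun τ hτ =>
    h₂.within_numLe hτ (by omega) (by simp) (by simp) (by simp) (by simp)) (by simp)
    fun isLow hisLow => ?_)
  have h₃ := h₂.putIdx (A := Arr.isLow) (by simp) isLow
  have hisLow' (i : Fin n) : 1 ≤ isLow i 0 ↔ i ∈ low a b f := by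
    simpa [hlow, hload, hinc] using hisLow i i.isLt 0 one_pos
  refine halts_income (a := a) (b := b) (f := f) (S := fun _ => low a b f) hk h₃ (by omega)
    (by simp) (by simpa) (by simpa) (by simpa) (fun _ => trivial) (by simp)
    (by simpa using hisLow') fun e h₄ he => hpost _ h₄ ?_
  exact ⟨by simpa, by simpa, by simpa, by simpa, by simpa using hisLow',
    by simpa [equalIncome] using he ⟨0, one_pos⟩⟩

end Incomes

section Allocation

open Chores

variable {n m : ℕ} {c f : Fin n → Fin m → ℝ} {a b : ℝ} {d D : ℕ} {σ : Memory}
  {Post : Memory → Prop}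

theorem Incomes.putNum {A : ℕ} (h : Incomes a b f σ) (hA : 9 < A) (g : ℕ → ℕ → ℝ) :
    Incomes a b f (σ.putNum A g) := by
  obtain ⟨h1, h2, h3, h4, h5, h6⟩ := h
  constructor <;> simp only [Memory.putNum_num, Memory.putNum_idx] <;>
    first | assumption | rwa [if_neg (by simp only [Num.code]; omega)]

/-- Computes which fraction of its chores every agent keeps. -/
noncomputable def keepProg : TimedProgram :=
  let kept : NExpr :=
    .div (scalarNum Num.equalIncome) (.mul (scalarNum Num.high) (vecNum Num.load row))
  sumNum Num.keep .agents .one .one kept (pos (vec Arr.isLow row)) (.sub (.ofIdx (.lit 1)) kept)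

theorem halts_keep (hk : ∀ d : Dim, d.size n m ≤ n + m) (hσ : Stage c d σ) (hD : d + 4 ≤ D)
    (hinc : Incomes a b f σ)
    (hpost : ∀ g, Stage c (d + 4) (σ.putNum Num.keep g) → (∀ i : Fin n, g i 0 = keep a b f i) →
      Post (σ.putNum Num.keep g)) :
    Halts (Formula c D) (n + m) keepProg σ Post := by
  classical
  obtain ⟨-, hhigh, -, hload, hisLow, hE⟩ := hinc
  simp only [Num.code, Arr.code] at hhigh hload hisLow hE
  refine halts_sumNum hk hσ hD (by simp) (by simp) (by simp) (by simp) (fun _ => trivial) (by simp)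
    (by simp) (fun _ _ _ _ _ _ => by simpa using hk .one) fun g hg heq => hpost g hg fun i => ?_
  have hi : g i 0 = equalIncome a b f / (b * load f i) +
      if i ∈ low a b f then 1 - equalIncome a b f / (b * load f i) else 0 := by
    simpa [hhigh, hload, hE, hisLow] using heq i i.isLt 0 one_pos
  rw [hi, keep]
  split_ifs <;> ring

/-- Computes the deficits and their sum. -/
noncomputable def deficitsProg : TimedProgram :=
  sumNum Num.deficit .agents .one .one (.ofIdx (.lit 0)) (pos (vec Arr.isLow row))
    (.sub (scalarNum Num.equalIncome) (.mul (scalarNum Num.low) (vecNum Num.load row))) ⨟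
  sumNum Num.total .one .one .agents (.ofIdx (.lit 0)) always (vecNum Num.deficit layer)

theorem halts_deficits (hk : ∀ d : Dim, d.size n m ≤ n + m) (hσ : Stage c d σ) (hD : d + 8 ≤ D)
    (hinc : Incomes a b f σ)
    (hpost : ∀ g t, Stage c (d + 8) ((σ.putNum Num.deficit g).putNum Num.total t) →
      (∀ i : Fin n, g i 0 = deficit a b f i) → t 0 0 = ∑ h, deficit a b f h →
      Post ((σ.putNum Num.deficit g).putNum Num.total t)) :
    Halts (Formula c D) (n + m) deficitsProg σ Post := by
  classical
  obtain ⟨hlow, -, -, hload, hisLow, hE⟩ := hinc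
  simp only [Num.code, Arr.code] at hlow hload hisLow hE
  refine halts_seq (halts_sumNum hk hσ (by omega) (by simp) (by simp) (by simp) (by simp)
    (fun _ => trivial) (by simp) (by simp) (by simp) fun g h₁ hg => ?_)
  have hdeficit (i : Fin n) : g i 0 = deficit a b f i := by
    simpa [hlow, hload, hE, hisLow, deficit] using hg i i.isLt 0 one_pos
  refine halts_sumNum hk h₁ (by omega) (by simp) (by simp) (by simp) (by simp)
    (fun _ => trivial) (by simp) (by simp) (by simp) fun t h₂ ht => hpost g t h₂ hdeficit ?_
  simpa [hdeficit] using ht 0 one_pos 0 one_pos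

/-- Computes the rests, and the allocation from them. -/
noncomputable def outputProg : TimedProgram :=
  sumNum Num.rest .chores .one .agents (.ofIdx (.lit 1)) always
    (.sub (.ofIdx (.lit 0)) (.mul (.get Num.share layer row) (vecNum Num.keep layer))) ⨟
  letNum Num.output .agents .chores
    (.add (.mul (.get Num.share row col) (vecNum Num.keep row))
      (.mul (vecNum Num.rest col) (.div (vecNum Num.deficit row) (scalarNum Num.total))))

theorem halts_output (hk : ∀ d : Dim, d.size n m ≤ n + m) (hσ : Stage c d σ) (hD : d + 8 ≤ D)
    (hshare : ∀ (i : Fin n) (j : Fin m), σ.num Num.share i j = f i j)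
    (hkeep : ∀ i : Fin n, σ.num Num.keep i 0 = keep a b f i)
    (hdeficit : ∀ i : Fin n, σ.num Num.deficit i 0 = deficit a b f i)
    (htotal : σ.num Num.total 0 0 = ∑ h, deficit a b f h)
    (hpost : ∀ τ, output n m τ = fairAllocation a b f → Post τ) :
    Halts (Formula c D) (n + m) outputProg σ Post := by
  classical
  simp only [Num.code] at hshare hkeep hdeficit htotal
  refine halts_seq (halts_sumNum hk hσ (by omega) (by simp) (by simp) (by simp) (by simp)
    (fun _ => trivial) (by simp) (fun _ _ _ _ => by simpa using hk .one) (by simp)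
    fun g h₁ hg => ?_)
  have hrest (j : Fin m) : g j 0 = rest a b f j := by
    simpa [hshare, hkeep, rest, sub_eq_add_neg] using hg j j.isLt 0 one_pos
  refine halts_letNum hk h₁ (by omega) (by simp) (by simp) (by simp) fun x _ hx => hpost _ ?_
  funext i j
  simpa [output, fairAllocation, hshare, hkeep, hdeficit, htotal, hrest]
    using hx i i.isLt j j.isLt

/-- Divides the chores fairly, given the fractional assignment as quotients. -/
noncomputable def allocateProg : TimedProgram :=
  loadsProg ⨟ incomesProg ⨟ keepProg ⨟ deficitsProg ⨟ outputProg

theorem halts_allocate (hk : ∀ d : Dim, d.size n m ≤ n + m) (hσ : Stage c d σ) (hD : d + 36 ≤ D)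
    (hlow : σ.num Num.low 0 0 = a) (hhigh : σ.num Num.high 0 0 = b)
    (halloc : ∀ (i : Fin n) (j : Fin m), σ.idx Arr.alloc i j ≤ n)
    (hsize : ∀ i : Fin n, σ.idx Arr.size i 0 ≤ n)
    (hf : ∀ i j, f i j = σ.idx Arr.alloc i j / σ.idx Arr.size i 0)
    (hpost : ∀ τ, output n m τ = fairAllocation a b f → Post τ) :
    Halts (Formula c D) (n + m) allocateProg σ Post := by
  refine halts_seq (halts_loads hk hσ (by omega) halloc hsize hf fun share ld h₁ hshare hld => ?_)
  refine halts_seq (halts_incomes hk h₁ (by omega) (by simpa) (by simpa) (by simpa) (by simpa)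
    fun τ h₂ hinc => ?_)
  refine halts_seq (halts_keep hk h₂ (by omega) hinc fun kept h₃ hkept => ?_)
  refine halts_seq (halts_deficits hk h₃ (by omega) (hinc.putNum (by simp) kept)
    fun g t h₄ hg ht => ?_)
  have hshare' := hinc.share
  exact halts_output hk h₄ (by omega) (by simpa) (by simpa) (by simpa) (by simpa) hpost

end Allocation

end RAM

namespace Chores

section Bivalued

variable {n m : ℕ} {c : Fin n → Fin m → ℝ}

theorem Bivalued.pos (hc : Bivalued c) (i : Fin n) (j : Fin m) : 0 < c i j := by
  obtain ⟨a, b, ha, hb, hab⟩ := hc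
  rcases hab i j with h | h <;> rwa [h]

theorem Bivalued.eq_high (hc : Bivalued c) {low high : ℝ}
    (hlow : ∃ i j, low = c i j) (hhigh : ∃ i j, high = c i j) (hle : ∀ i j, c i j ≤ high)
    {i : Fin n} {j : Fin m} (hij : low < c i j) : c i j = high := by
  obtain ⟨a, b, -, -, hab⟩ := hc
  obtain ⟨i₀, j₀, rfl⟩ := hlow
  obtain ⟨i₁, j₁, rfl⟩ := hhigh
  have hle := hle i j
  rcases hab i j with h | h <;> rcases hab i₀ j₀ with h₀ | h₀ <;>
    rcases hab i₁ j₁ with h₁ | h₁ <;> linarith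

end Bivalued

end Chores

namespace RAM

section Fair

open Chores

variable {n m : ℕ} {c : Fin n → Fin m → ℝ}

/-- Computes an envy-free and fractionally Pareto-optimal allocation. Without chores there is no
least cost to start from, and nothing to do. -/
noncomputable def fairProg : TimedProgram :=
  .cond (pos Dim.chores.expr) (extremesProg ⨟ balanceProg ⨟ allocateProg) .skip

theorem halts_fairProg (hn : 0 < n) (hc : Bivalued c) :
    Halts (Formula c 44) (n + m) fairProg (input c) fun τ => IsAllocation (output n m τ) ∧
      EnvyFree c (output n m τ) ∧ FracParetoOptimal c (output n m τ) := by
  have hk := Dim.size_le hn m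
  have hpos : (pos Dim.chores.expr).Holds (input c) ↔ 0 < m := by
    simp [pos, Dim.expr, Test.Holds, IExpr.eval, input, Nat.succ_le_iff]
  refine halts_cond trivial (fun hm => ?_) fun hm => halts_skip ?_
  · refine halts_seq (halts_extremes hk (by omega) hn (hpos.1 hm)
      fun σ hσ hlow_mem hhigh_mem hlow hhigh hadj => ?_)
    set a := σ.num Num.low 0 0
    set b := σ.num Num.high 0 0
    refine halts_seq (halts_balance hk hσ.toReady (fun i j => (hadj i j).symm)
      fun τ hτ hnum halloc hsize hf => ?_)
    have hτ' : Stage c 8 τ := ⟨hτ, by simpa [hnum] using hσ.formula⟩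
    refine halts_allocate hk hτ' le_rfl (by rw [hnum]) (by rw [hnum]) halloc hsize
      (fun _ _ => rfl) fun τ hout => ?_
    obtain ⟨i₀, j₀, hmin⟩ := hlow_mem
    have ha : 0 < a := hmin ▸ hc.pos i₀ j₀
    have hab : a ≤ b := hmin ▸ hhigh i₀ j₀
    have heq := hf.equilibrium hn ha hab (fun i j hij => hij.antisymm (hlow i j))
      fun i j hij => hc.eq_high ⟨i₀, j₀, hmin⟩ hhigh_mem hhigh (not_le.1 hij)
    rw [hout]
    exact ⟨heq.isAllocation, heq.envyFree, heq.fracParetoOptimal⟩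
  · obtain rfl : m = 0 := Nat.eq_zero_of_not_pos (hpos.not.1 hm)
    simp [IsAllocation, EnvyFree, FracParetoOptimal, Dominates, bundleCost]

end Fair

end RAM

theorem theorem2 :
    RAM.StronglyPolynomial
      (fun {n m : ℕ} (c : Fin n → Fin m → ℝ) => 0 < n ∧ Chores.Bivalued c)
      (fun {n m : ℕ} (c x : Fin n → Fin m → ℝ) =>
        Chores.IsAllocation x ∧ Chores.EnvyFree c x ∧ Chores.FracParetoOptimal c x) := by
  refine ⟨RAM.fairProg.prog, RAM.fairProg.time, RAM.formulaSize 44, fun n m c ⟨hn, hc⟩ => ?_⟩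
  obtain ⟨t, τ, hrun, ht, hfair⟩ := RAM.halts_fairProg hn hc
  exact ⟨t, τ, hrun.mono fun _ _ => trivial, ht, hfair,
    fun q hq => hrun.mono fun _ hv => hv.exists_bitSize_le hq⟩
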